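/- Manifolds are finite-dimensional, smooth, Hausdorff and without boundary. Let $G$ be a Lie group and $\pi:Q\to M$ a smooth principal $G$-bundle over a manifold $M$ ($G$ acting on $Q$ from the right), with fibres $Q_x=\pi^{-1}(x)$ and vertical spaces $\mathcal V_p=\ker d\pi_p$. A connection on $Q$ is a smooth $G$-invariant distribution $\mathcal H$ on $Q$ with $\mathcal H_p\oplus\mathcal V_p=T_pQ$ for all $p\in Q$. A path is a piecewise smooth (continuous) map $\gamma:[a,b]\to M$ with $a\le b$; its end points are $i(\gamma)=\gamma(a)$ and $e(\gamma)=\gamma(b)$. A family $(\gamma_s)_{s\in S}$ of paths $[a,b]\to M$ parametrized by a manifold $S$ is smooth if there is a partition of $[a,b]$ such that $(s,t)\mapsto\gamma_s(t)$ is smooth on $S\times[t_j,t_{j+1}]$ for each subinterval of the partition. A parallel-transport map on $Q$ assigns to every path $\gamma$ in $M$ a $G$-equivariant map $P(\gamma):Q_{i(\gamma)}\to Q_{e(\gamma)}$ such that 1. (smoothness in families) for every smooth family $(\gamma_s)_{s\in S}$ the maps $P(\gamma_s)$ depend smoothly on $s$, i.e. $s\mapsto P(\gamma_s)(\sigma(s))$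 is smooth for every smooth $\sigma:S\to Q$ with $\pi(\sigma(s))=i(\gamma_s)$; 2. $P(\gamma)=\mathrm{id}$ for every constant path $\gamma$; 3. $P(\gamma\circ\varphi)=P(\gamma)$ for every orientation-preserving diffeomorphism $\varphi$ of compact intervals onto the domain of $\gamma$; 4. $P(\gamma_2\star\gamma_1)=P(\gamma_2)\circ P(\gamma_1)$ for the juxtaposition of paths $\gamma_1,\gamma_2$ with $e(\gamma_1)=i(\gamma_2)$. **Theorem.** There is a natural bijection $$\Phi:\{\text{connections on }Q\}\longrightarrow\{\text{parallel-transport maps on }Q\}.$$ Explicitly: * For a connection $\mathcal H$, every path $\gamma:[a,b]\to M$ and every $q\in Q_{i(\gamma)}$ there is exactly one piecewise smooth horizontal lift $\tilde\gamma:[a,b]\to Q$ of $\gamma$ with $\tilde\gamma(a)=q$, and $\Phi(\mathcal H)(\gamma)(q)=\tilde\gamma(b)$. * For a parallel-transport map $P$ and $p\in Q$, the space $\Phi^{-1}(P)_p\subset T_pQ$ is the set of derivatives at $t=0$ (on $[0,b]$) of the lifted paths $t\mapsto P(\alpha|_{[0,t]})(p)$, where $\alpha:[0,b]\to M$, $b>0$,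 runs through the smooth paths with $\alpha(0)=\pi(p)$ for which this derivative exists. * (Naturality) Let $\pi':Q'\to M'$ be another smooth principal $G$-bundle, $F:Q\to Q'$ a smooth $G$-equivariant map covering a smooth map $f:M\to M'$, $\mathcal H$ and $\mathcal H'$ connections on $Q$ and $Q'$, and $P$, $P'$ the corresponding parallel-transport maps. Then $dF_q(\mathcal H_q)\subset\mathcal H'_{F(q)}$ for all $q\in Q$ if and only if $P'(f\circ\gamma)(F(q))=F(P(\gamma)(q))$ for all paths $\gamma$ in $M$ and all $q\in Q_{i(\gamma)}$. -/

import Mathlib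

open Set Topology MulOpposite
open scoped Manifold ContDiff

/-! ### Piecewise smooth paths -/

/-- A piecewise smooth path `[a, b] → M`: a continuous map which is smooth (up to the end points)
on every closed subinterval whose interior avoids a finite set `T` of break points. -/
structure PSPath {E : Type*} [NormedAddCommGroup E] [NormedSpace ℝ E]
    {H : Type*} [TopologicalSpace H] (I : ModelWithCorners ℝ E H)
    (M : Type*) [TopologicalSpace M] [ChartedSpace H M] (a b : ℝ) where
  toFun : Icc a b → M
  le : a ≤ b
  continuous_toFun : Continuous toFun
  piecewise_smooth : ∃ T : Finset ℝ, ∀ u v : ℝ, Icc u v ⊆ Icc a b → Disjoint (Ioo u v) (T : Set ℝ) →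
    ContMDiffOn 𝓘(ℝ, ℝ) I ∞ (IccExtend le toFun) (Icc u v)

namespace PSPath

variable {E : Type*} [NormedAddCommGroup E] [NormedSpace ℝ E]
  {H : Type*} [TopologicalSpace H] {I : ModelWithCorners ℝ E H}
  {M : Type*} [TopologicalSpace M] [ChartedSpace H M]
  {E' : Type*} [NormedAddCommGroup E'] [NormedSpace ℝ E']
  {H' : Type*} [TopologicalSpace H'] {I' : ModelWithCorners ℝ E' H'}
  {M' : Type*} [TopologicalSpace M'] [ChartedSpace H' M']
  {a b c d : ℝ}

/-- The path as a function on `ℝ`, extended by constants outside `[a, b]`. -/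
noncomputable def extend (γ : PSPath I M a b) : ℝ → M := IccExtend γ.le γ.toFun

/-- The starting point `i(γ)`. -/
def source (γ : PSPath I M a b) : M := γ.toFun ⟨a, left_mem_Icc.2 γ.le⟩

/-- The end point `e(γ)`. -/
def target (γ : PSPath I M a b) : M := γ.toFun ⟨b, right_mem_Icc.2 γ.le⟩

/-- A path without break points. -/
def IsSmooth (γ : PSPath I M a b) : Prop :=
  ContMDiffOn 𝓘(ℝ, ℝ) I ∞ γ.extend (Icc a b)

/-- A constant path. -/
def IsConst (γ : PSPath I M a b) : Prop := ∀ t, γ.toFun t = γ.source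

/-- Restriction of a path to a subinterval `[c, d]`. -/
def restrict (γ : PSPath I M a b) (hcd : c ≤ d) (h : Icc c d ⊆ Icc a b) : PSPath I M c d where
  toFun t := γ.toFun ⟨t, h t.2⟩
  le := hcd
  continuous_toFun := γ.continuous_toFun.comp (continuous_subtype_val.subtype_mk _)
  piecewise_smooth := by
    obtain ⟨T, hT⟩ := γ.piecewise_smooth
    refine ⟨T, fun u v huv hd => (hT u v (huv.trans h) hd).congr fun t ht => ?_⟩
    rw [IccExtend_of_mem _ _ (huv ht), IccExtend_of_mem _ _ (h (huv ht))]

/-- The initial piece `γ|[a, t]`. -/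
def initial (γ : PSPath I M a b) (t : Icc a b) : PSPath I M a t :=
  γ.restrict t.2.1 (Icc_subset_Icc_right t.2.2)

/-- The image of a path under a smooth map. -/
def map (γ : PSPath I M a b) (f : M → M') (hf : ContMDiff I I' ∞ f) : PSPath I' M' a b where
  toFun t := f (γ.toFun t)
  le := γ.le
  continuous_toFun := hf.continuous.comp γ.continuous_toFun
  piecewise_smooth := by
    obtain ⟨T, hT⟩ := γ.piecewise_smooth
    exact ⟨T, fun u v huv hd => hf.comp_contMDiffOn (hT u v huv hd)⟩

/-- The function on `[a, c]` obtained by following `γ₁` on `[a, b]` and then `γ₂` on `[b, c]`. -/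
noncomputable def juxtFun (γ₁ : PSPath I M a b) (γ₂ : PSPath I M b c) (t : ℝ) : M :=
  if t ≤ b then γ₁.extend t else γ₂.extend t

theorem juxtFun_left (γ₁ : PSPath I M a b) (γ₂ : PSPath I M b c) {t : ℝ} (ht : t ≤ b) :
    juxtFun γ₁ γ₂ t = γ₁.extend t := if_pos ht

theorem juxtFun_right (γ₁ : PSPath I M a b) (γ₂ : PSPath I M b c) (h : γ₁.target = γ₂.source)
    {t : ℝ} (ht : b ≤ t) : juxtFun γ₁ γ₂ t = γ₂.extend t := by
  rcases ht.eq_or_lt with rfl | h'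
  · rw [juxtFun_left _ _ le_rfl, extend, extend, IccExtend_of_mem _ _ (right_mem_Icc.2 γ₁.le),
      IccExtend_of_mem _ _ (left_mem_Icc.2 γ₂.le)]
    exact h
  · exact if_neg (not_le.2 h')

theorem continuous_extend (γ : PSPath I M a b) : Continuous γ.extend :=
  γ.continuous_toFun.Icc_extend'

/-- Juxtaposition `γ₂ ⋆ γ₁` of two paths with `e(γ₁) = i(γ₂)`. -/
noncomputable def juxt (γ₁ : PSPath I M a b) (γ₂ : PSPath I M b c)
    (h : γ₁.target = γ₂.source) : PSPath I M a c where
  toFun t := juxtFun γ₁ γ₂ t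
  le := γ₁.le.trans γ₂.le
  continuous_toFun := by
    have : Continuous (juxtFun γ₁ γ₂) := by
      refine Continuous.if_le γ₁.continuous_extend γ₂.continuous_extend continuous_id
        continuous_const fun t ht => ?_
      subst ht
      rw [← juxtFun_right γ₁ γ₂ h le_rfl, juxtFun_left _ _ le_rfl]
    exact this.comp continuous_subtype_val
  piecewise_smooth := by
    classical
    obtain ⟨T₁, hT₁⟩ := γ₁.piecewise_smooth
    obtain ⟨T₂, hT₂⟩ := γ₂.piecewise_smooth
    refine ⟨insert b (T₁ ∪ T₂), fun u v huv hd => ?_⟩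
    rcases lt_or_ge v u with hvu | huv'
    · rw [Icc_eq_empty (not_le.2 hvu)]
      exact fun t ht => ht.elim
    have hu := huv (left_mem_Icc.2 huv')
    have hv := huv (right_mem_Icc.2 huv')
    have hb : v ≤ b ∨ b ≤ u := by
      by_contra hcon
      push Not at hcon
      exact Set.disjoint_left.1 hd (show b ∈ Ioo u v from ⟨hcon.2, hcon.1⟩) (by simp)
    rcases hb with hb | hb
    · refine (hT₁ u v (Icc_subset_Icc hu.1 hb) (hd.mono_right (by
        intro x hx; simp only [Finset.coe_insert, Finset.coe_union]; exact Or.inr (Or.inl hx)))).congr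
        fun t ht => ?_
      rw [IccExtend_of_mem _ _ (huv ht)]
      exact juxtFun_left _ _ (ht.2.trans hb)
    · refine (hT₂ u v (Icc_subset_Icc hb hv.2) (hd.mono_right (by
        intro x hx; simp only [Finset.coe_insert, Finset.coe_union]; exact Or.inr (Or.inr hx)))).congr
        fun t ht => ?_
      rw [IccExtend_of_mem _ _ (huv ht)]
      exact juxtFun_right _ _ h (hb.trans ht.1)

/-- `γ' = γ ∘ φ` for an orientation-preserving diffeomorphism `φ : [c, d] → [a, b]`
(with inverse `ψ`). -/
def IsReparametrization (γ' : PSPath I M c d) (γ : PSPath I M a b) : Prop :=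
  ∃ φ ψ : ℝ → ℝ, MapsTo φ (Icc c d) (Icc a b) ∧ MapsTo ψ (Icc a b) (Icc c d) ∧
    InvOn ψ φ (Icc c d) (Icc a b) ∧ ContDiffOn ℝ ∞ φ (Icc c d) ∧ ContDiffOn ℝ ∞ ψ (Icc a b) ∧
    StrictMonoOn φ (Icc c d) ∧ ∀ t ∈ Icc c d, γ'.extend t = γ.extend (φ t)

/-- A family `Γ` of paths `[a, b] → M` parametrized by a manifold `S` is smooth if
`(s, t) ↦ Γ s t` is smooth on `S × [u, v]` for all `[u, v]` whose interior avoids a finite set of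
break points. -/
def IsSmoothFamily {ES : Type*} [NormedAddCommGroup ES] [NormedSpace ℝ ES]
    {HS : Type*} [TopologicalSpace HS] (IS : ModelWithCorners ℝ ES HS)
    {S : Type*} [TopologicalSpace S] [ChartedSpace HS S] (Γ : S → PSPath I M a b) : Prop :=
  ∃ T : Finset ℝ, ∀ u v : ℝ, Icc u v ⊆ Icc a b → Disjoint (Ioo u v) (T : Set ℝ) →
    ContMDiffOn (IS.prod 𝓘(ℝ, ℝ)) I ∞ (fun p : S × ℝ => (Γ p.1).extend p.2) (univ ×ˢ Icc u v)

end PSPath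

section Bundles

variable {E : Type*} [NormedAddCommGroup E] [NormedSpace ℝ E]
  {H : Type*} [TopologicalSpace H] (I : ModelWithCorners ℝ E H)
  {M : Type*} [TopologicalSpace M] [ChartedSpace H M]
  {EG : Type*} [NormedAddCommGroup EG] [NormedSpace ℝ EG]
  {HG : Type*} [TopologicalSpace HG] (IG : ModelWithCorners ℝ EG HG)
  (G : Type*) [Group G] [TopologicalSpace G] [ChartedSpace HG G]
  {EQ : Type*} [NormedAddCommGroup EQ] [NormedSpace ℝ EQ]
  {HQ : Type*} [TopologicalSpace HQ] (IQ : ModelWithCorners ℝ EQ HQ)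
  {Q : Type*} [TopologicalSpace Q] [ChartedSpace HQ Q] [MulAction Gᵐᵒᵖ Q]

/-! ### Principal bundles and connections -/

/-- `π : Q → M` is a smooth principal `G`-bundle; the right action `q · g` is `op g • q`. -/
structure IsPrincipalBundle (π : Q → M) : Prop where
  contMDiff_act : ContMDiff (IQ.prod IG) IQ ∞ (fun p : Q × G => op p.2 • p.1)
  proj_act : ∀ (q : Q) (g : G), π (op g • q) = π q
  /-- Around every point there is a smooth `G`-equivariant trivialization
  `π⁻¹(U) ≃ U × G`. -/
  exists_trivialization : ∀ x : M, ∃ e : Bundle.Trivialization G π, x ∈ e.baseSet ∧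
    ContMDiffOn IQ (I.prod IG) ∞ e e.source ∧
    ContMDiffOn (I.prod IG) IQ ∞ e.toOpenPartialHomeomorph.symm e.target ∧
    ∀ q ∈ e.source, ∀ g : G, e (op g • q) = ((e q).1, (e q).2 * g)

/-- A family of subspaces of the tangent spaces is a smooth distribution if it is locally spanned
by a smooth frame. -/
def IsSmoothDistribution [IsManifold IQ ∞ Q] (D : ∀ q : Q, Submodule ℝ (TangentSpace IQ q)) : Prop :=
  ∀ q₀ : Q, ∃ U : Set Q, IsOpen U ∧ q₀ ∈ U ∧ ∃ (k : ℕ) (X : Fin k → ∀ q : Q, TangentSpace IQ q),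
    (∀ i, ContMDiffOn IQ IQ.tangent ∞ (fun q => (⟨q, X i q⟩ : TangentBundle IQ Q)) U) ∧
    ∀ q ∈ U, LinearIndependent ℝ (fun i => X i q) ∧
      Submodule.span ℝ (range fun i => X i q) = D q

/-- The vertical space at `q`: the tangent space of the fibre of `π` through `q`. -/
noncomputable def verticalSpace (π : Q → M) (q : Q) : Submodule ℝ (TangentSpace IQ q) :=
  LinearMap.ker (mfderiv IQ I π q).toLinearMap

/-- A connection on `π : Q → M`: a smooth `G`-invariant distribution complementary to the vertical
distribution. -/
@[ext] structure PrincipalConnection [IsManifold IQ ∞ Q] (π : Q → M) where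
  horizontal : ∀ q : Q, Submodule ℝ (TangentSpace IQ q)
  smooth : IsSmoothDistribution IQ horizontal
  isCompl : ∀ q, IsCompl (horizontal q) (verticalSpace I IQ π q)
  invariant : ∀ (g : G) (q : Q),
    (horizontal q).map (mfderiv IQ IQ (fun q' : Q => op g • q') q).toLinearMap =
      horizontal (op g • q)

/-! ### Parallel-transport maps -/

/-- A parallel-transport map on `π : Q → M`. -/
@[ext] structure ParallelTransport (π : Q → M) where
  /-- The map `P(γ) : Q_{i(γ)} → Q_{e(γ)}`. -/
  map : ∀ {a b : ℝ} (γ : PSPath I M a b), π ⁻¹' {γ.source} → π ⁻¹' {γ.target}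
  equivariant : ∀ {a b : ℝ} (γ : PSPath I M a b) (q q' : π ⁻¹' {γ.source}) (g : G),
    (q' : Q) = op g • (q : Q) → (map γ q' : Q) = op g • (map γ q : Q)
  /-- Smoothness in families: for every smooth family `Γ` of paths parametrized by a
  finite-dimensional manifold `S`, the maps `P(Γ s)` depend smoothly on `s`; that is, they turn
  smooth families `σ s` of points of `Q` over the starting points into smooth families. -/
  smooth : ∀ {a b : ℝ} (n : ℕ) (S : Type) [TopologicalSpace S] [T2Space S]
    [SecondCountableTopology S] [ChartedSpace (EuclideanSpace ℝ (Fin n)) S] [IsManifold (𝓡 n) ∞ S]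
    (Γ : S → PSPath I M a b), PSPath.IsSmoothFamily (𝓡 n) Γ →
    ∀ σ : ∀ s : S, π ⁻¹' {(Γ s).source}, ContMDiff (𝓡 n) IQ ∞ (fun s => (σ s : Q)) →
      ContMDiff (𝓡 n) IQ ∞ (fun s => (map (Γ s) (σ s) : Q))
  map_const : ∀ {a b : ℝ} (γ : PSPath I M a b), γ.IsConst →
    ∀ q : π ⁻¹' {γ.source}, (map γ q : Q) = q
  map_reparam : ∀ {a b c d : ℝ} (γ : PSPath I M a b) (γ' : PSPath I M c d),
    γ'.IsReparametrization γ → ∀ (q : π ⁻¹' {γ.source}) (q' : π ⁻¹' {γ'.source}),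
      (q' : Q) = q → (map γ' q' : Q) = map γ q
  map_juxt : ∀ {a b c : ℝ} (γ₁ : PSPath I M a b) (γ₂ : PSPath I M b c)
    (h : γ₁.target = γ₂.source) (q : π ⁻¹' {γ₁.source}) (q' : π ⁻¹' {(γ₁.juxt γ₂ h).source}),
      (q' : Q) = q → (map (γ₁.juxt γ₂ h) q' : Q) = map γ₂ ⟨map γ₁ q, (map γ₁ q).2.trans h⟩

variable {I IQ G} [IsManifold IQ ∞ Q] {π : Q → M}

/-- `γ'` is a horizontal lift of `γ`: it covers `γ` and its velocity is horizontal wherever it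
exists (so everywhere but at finitely many points). -/
def PrincipalConnection.IsHorizontalLift (A : PrincipalConnection I G IQ π) {a b : ℝ}
    (γ : PSPath I M a b) (γ' : PSPath IQ Q a b) : Prop :=
  (∀ t, π (γ'.toFun t) = γ.toFun t) ∧
    ∀ t ∈ Ioo a b, MDifferentiableAt 𝓘(ℝ, ℝ) IQ γ'.extend t →
      mfderiv 𝓘(ℝ, ℝ) IQ γ'.extend t (1 : ℝ) ∈ A.horizontal (γ'.extend t)

/-- `P` is the parallel transport of the connection `A`: it sends `q` to the end point of a
horizontal lift starting at `q`. -/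
def PrincipalConnection.IsTransportedBy (A : PrincipalConnection I G IQ π)
    (P : ParallelTransport I G IQ π) : Prop :=
  ∀ {a b : ℝ} (γ : PSPath I M a b) (q : π ⁻¹' {γ.source}),
    ∃ γ' : PSPath IQ Q a b, A.IsHorizontalLift γ γ' ∧ γ'.source = q ∧ γ'.target = P.map γ q

/-- The lifted path `t ↦ P(γ|[a, t])(q)`. -/
def ParallelTransport.lift (P : ParallelTransport I G IQ π) {a b : ℝ} (γ : PSPath I M a b)
    (q : π ⁻¹' {γ.source}) (t : Icc a b) : Q :=
  P.map (γ.initial t) q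

/-- The vectors at `p` which are derivatives at `0` of lifted paths `t ↦ P(α|[0, t])(p)`, for
smooth paths `α : [0, b] → M`, `0 < b`, starting at `π p`. -/
def ParallelTransport.liftedVectors (P : ParallelTransport I G IQ π) (p : Q) :
    Set (TangentSpace IQ p) :=
  {v | ∃ (b : ℝ) (α : PSPath I M 0 b) (hp : π p = α.source), 0 < b ∧ α.IsSmooth ∧
    MDifferentiableWithinAt 𝓘(ℝ, ℝ) IQ (IccExtend α.le (P.lift α ⟨p, hp⟩)) (Icc 0 b) 0 ∧
    tangentMapWithin 𝓘(ℝ, ℝ) IQ (IccExtend α.le (P.lift α ⟨p, hp⟩)) (Icc 0 b)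
      (⟨0, (1 : ℝ)⟩ : TangentBundle 𝓘(ℝ, ℝ) ℝ) = (⟨p, v⟩ : TangentBundle IQ Q)}

end Bundles

/-!
# Principal connections and parallel transport

For a connection, horizontal lifts of paths exist and are unique, and transport along them is a
parallel-transport map; conversely, the lifts of curves prescribed by a parallel-transport map have
velocities which form a connection.

*From connections to transport.* In charts, a connection is a smooth family of linear maps
`L y : E → EQ`, where `L y w` is the horizontal vector at `y` over `w`
(`PrincipalConnection.exists_isLocalForm`), and a curve `y` over `x` is horizontal if and only if
`y' = L(y) x'`. Picard–Lindelöf gives horizontal lifts on short intervals. By `G`-equivariance the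
length of these intervals does not depend on the starting point in the fibre, so lifts exist
(`exists_liftOn`) and are unique (`LiftOn.eqOn`) along every piecewise smooth path. Smoothness of the
transport in families (`contMDiffAt_liftOn_right`) follows from the smooth dependence of flows on
initial values (`exists_smooth_flow`), which is an application of the inverse function theorem in
`C([0, 1], X)`; the passage from families on `S × [u, v]` to flows uses the substitution
`t ± τ²` to get rid of the end points. A horizontal vector is the initial velocity of the lift of
any curve with the projected initial velocity (`LiftOn.tangentMapWithin_left_eq`), so the connection
is recovered from its transport (`liftedVectors_transport`). The same fact and the uniqueness of
lifts give naturality (`map_horizontal_iff`).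

*From transport to connections.* The axioms say little about the velocity of
`s ↦ P(γ|[0, s])(q)` for a single curve `γ`. By Hadamard's lemma, `γ t = x + t k(t)` in a chart, and
the family of paths `t ↦ x + r t k(s t)` with the parameters `(s, r)` interpolates between constant
paths (`r = 0`), straight lines (`s = 0`) and `t ↦ γ (s t)` (`r = s`). As `P` is smooth in this
family, the velocity is the derivative along the diagonal, hence the one obtained from a straight
line (`hasDerivAt_liftCurve`). It is therefore `L y (γ' 0)` with `L` smooth and linear in `γ' 0`
(`exists_isLocalForm_velocities`): the velocities form a connection.

*These constructions are inverse to each other.* Let `A` be the connection of `P`, and let `γ` be a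
smooth piece of a path, on `[u, v]`. The lifted path `t ↦ P(γ|[u, t])(q)` is smooth and
`A`-horizontal on the open interval (`horizOn_along`) and continuous on the closed one
(`continuousOn_along`), so it is the horizontal lift of `γ` (`along_eq_of_contMDiffOn`).
-/

set_option linter.unusedSectionVars false

/-! ### Superposition operators on spaces of continuous functions -/

section Superposition

universe u v w

variable {K : Type w} [TopologicalSpace K] [CompactSpace K]
  {X : Type u} [NormedAddCommGroup X] [NormedSpace ℝ X]

/-- The linear operator `h ↦ (k ↦ A k (h k))` on continuous functions on a compact space. -/
noncomputable def pointwiseApply {Y : Type*} [NormedAddCommGroup Y] [NormedSpace ℝ Y] :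
    C(K, X →L[ℝ] Y) →L[ℝ] C(K, X) →L[ℝ] C(K, Y) :=
  LinearMap.mkContinuous₂
    (LinearMap.mk₂ ℝ (fun (A : C(K, X →L[ℝ] Y)) (h : C(K, X)) =>
        (⟨fun k => A k (h k), A.continuous.clm_apply h.continuous⟩ : C(K, Y)))
      (fun A B h => by ext k; simp) (fun c A h => by ext k; simp)
      (fun A h h' => by ext k; simp) (fun c A h => by ext k; simp)) 1
    (fun A h => by
      rw [one_mul, ContinuousMap.norm_le _ (by positivity)]
      intro k
      exact ((A k).le_opNorm _).trans
        (mul_le_mul (A.norm_coe_le_norm k) (h.norm_coe_le_norm k) (norm_nonneg _)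
          (norm_nonneg A)))

theorem hasFDerivAt_superposition {Y : Type*} [NormedAddCommGroup Y] [NormedSpace ℝ Y]
    {g : X → Y} (hg : ContDiff ℝ 1 g) (u : C(K, X)) :
    HasFDerivAt (fun u : C(K, X) => (⟨g, hg.continuous⟩ : C(X, Y)).comp u)
      (pointwiseApply ((⟨fderiv ℝ g, hg.continuous_fderiv one_ne_zero⟩ : C(X, X →L[ℝ] Y)).comp u)) u := by
  rw [hasFDerivAt_iff_isLittleO_nhds_zero, Asymptotics.isLittleO_iff]
  intro ε hε
  have hc : IsCompact (range u) := isCompact_range u.continuous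
  have huc := hc.uniformContinuousAt_of_continuousAt (fderiv ℝ g)
    (fun x _ => (hg.continuous_fderiv one_ne_zero).continuousAt) (Metric.dist_mem_uniformity hε)
  obtain ⟨δ, hδ, hδ'⟩ := Metric.mem_uniformity_dist.1 huc
  filter_upwards [Metric.ball_mem_nhds (0 : C(K, X)) hδ] with h hh
  rw [mem_ball_zero_iff] at hh
  rw [ContinuousMap.norm_le _ (by positivity)]
  intro k
  have hk : ‖h k‖ < δ := (h.norm_coe_le_norm k).trans_lt hh
  have key := (convex_ball (u k) δ).norm_image_sub_le_of_norm_hasFDerivWithin_le'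
    (f := g) (f' := fderiv ℝ g) (φ := fderiv ℝ g (u k)) (C := ε) (x := u k) (y := u k + h k)
    (fun x _ => (hg.differentiable one_ne_zero x).hasFDerivAt.hasFDerivWithinAt)
    (fun x hx => by
      have := hδ' (a := u k) (b := x) (by rw [dist_comm]; exact hx) ⟨k, rfl⟩
      change dist (fderiv ℝ g (u k)) (fderiv ℝ g x) < ε at this
      rw [dist_comm, dist_eq_norm] at this
      exact le_of_lt this)
    (Metric.mem_ball_self hδ) (by simpa [dist_eq_norm] using hk)
  simp only [add_sub_cancel_left] at key
  exact key.trans (mul_le_mul_of_nonneg_left (h.norm_coe_le_norm k) hε.le)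

/-- By induction on `n`: the derivative of `u ↦ g ∘ u` is the superposition operator of the
derivative of `g`, followed by a bounded linear map. The target space changes in the induction,
whence the restriction on its universe. -/
theorem contDiff_superposition_nat (n : ℕ) : ∀ {Y : Type (max u v)} [NormedAddCommGroup Y]
    [NormedSpace ℝ Y] {g : X → Y} (hg : ContDiff ℝ n g),
    ContDiff ℝ n (fun u : C(K, X) => (⟨g, hg.continuous⟩ : C(X, Y)).comp u) := by
  induction n with
  | zero =>
    intro Y _ _ g hg
    exact contDiff_zero.2 (ContinuousMap.continuous_postcomp _)
  | succ n ih =>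
    intro Y _ _ g hg
    have hg1 : ContDiff ℝ 1 g := hg.of_le (by exact_mod_cast Nat.le_add_left 1 n)
    have hg' : ContDiff ℝ n (fderiv ℝ g) := hg.fderiv_right (by norm_cast)
    have hd := hasFDerivAt_superposition (K := K) hg1
    have hfd : (fderiv ℝ fun u : C(K, X) => (⟨g, hg.continuous⟩ : C(X, Y)).comp u) = fun u =>
        pointwiseApply ((⟨fderiv ℝ g, hg'.continuous⟩ : C(X, X →L[ℝ] Y)).comp u) :=
      funext fun u => (hd u).fderiv
    have h := (pointwiseApply (K := K) (X := X) (Y := Y)).contDiff.comp (ih hg')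
    generalize (fun u : C(K, X) => (⟨g, hg.continuous⟩ : C(X, Y)).comp u) = F at hd hfd ⊢
    rw [show ((n + 1 : ℕ) : WithTop ℕ∞) = n + 1 by norm_cast, contDiff_succ_iff_fderiv, hfd]
    exact ⟨fun u => (hd u).differentiableAt, by simp, h⟩

/-- Composition with a smooth map is a smooth map between spaces of continuous functions. -/
theorem contDiff_superposition {Y : Type (max u v)} [NormedAddCommGroup Y]
    [NormedSpace ℝ Y] {g : X → Y} (hg : ContDiff ℝ ∞ g) :
    ContDiff ℝ ∞ (fun u : C(K, X) => (⟨g, hg.continuous⟩ : C(X, Y)).comp u) :=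
  contDiff_infty.2 fun n => contDiff_superposition_nat.{u, v, w} n (contDiff_infty.1 hg n)

end Superposition

/-! ### Integration and Hadamard's lemma -/

section Integration

variable {X : Type*} [NormedAddCommGroup X]

theorem continuous_IccExtend_zero_one (u : C(Icc (0 : ℝ) 1, X)) :
    Continuous (IccExtend zero_le_one u) := u.continuous.Icc_extend'

theorem norm_IccExtend_le (u : C(Icc (0 : ℝ) 1, X)) (s : ℝ) :
    ‖IccExtend zero_le_one u s‖ ≤ ‖u‖ := u.norm_coe_le_norm _

variable [NormedSpace ℝ X]

/-- The operator `u ↦ (t ↦ ∫₀ᵗ u)` on continuous functions on `[0, 1]`. -/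
noncomputable def primitiveOp : C(Icc (0 : ℝ) 1, X) →L[ℝ] C(Icc (0 : ℝ) 1, X) :=
  LinearMap.mkContinuous
    { toFun := fun u => ⟨fun t => ∫ s in (0 : ℝ)..t, IccExtend zero_le_one u s, by
        have := intervalIntegral.continuous_primitive (μ := MeasureTheory.volume)
          (fun a b => (continuous_IccExtend_zero_one u).intervalIntegrable a b) 0
        exact this.comp continuous_subtype_val⟩
      map_add' := fun u v => by
        ext t
        exact intervalIntegral.integral_add
          ((continuous_IccExtend_zero_one u).intervalIntegrable _ _)
          ((continuous_IccExtend_zero_one v).intervalIntegrable _ _)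
      map_smul' := fun c u => by
        ext t
        exact intervalIntegral.integral_smul c _ } 1
    (fun u => by
      rw [one_mul, ContinuousMap.norm_le _ (by positivity)]
      intro t
      have h := intervalIntegral.norm_integral_le_of_norm_le_const (a := 0) (b := (t : ℝ))
        (f := IccExtend zero_le_one u) (C := ‖u‖) (fun s _ => norm_IccExtend_le u s)
      refine h.trans ?_
      have : |(t : ℝ) - 0| ≤ 1 := by rw [sub_zero, abs_of_nonneg t.2.1]; exact t.2.2
      nlinarith [norm_nonneg u])

end Integration

/-- **Hadamard's lemma** for curves: a smooth curve `x` in a Banach space is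
`x 0 + t • k t` with `k` smooth. -/
theorem exists_contDiff_eq_add_smul {X : Type*} [NormedAddCommGroup X] [NormedSpace ℝ X]
    [CompleteSpace X] {x : ℝ → X} (hx : ContDiff ℝ ∞ x) :
    ∃ k : ℝ → X, ContDiff ℝ ∞ k ∧ (∀ t, x t = x 0 + t • k t) ∧ k 0 = deriv x 0 := by
  have hx' : ContDiff ℝ ∞ (deriv x) := ((contDiff_infty_iff_deriv).1 hx).2
  let ι : C(Icc (0 : ℝ) 1, ℝ) := ⟨fun θ => θ, continuous_subtype_val⟩
  let k : ℝ → X := fun t => primitiveOp ((⟨deriv x, hx'.continuous⟩ : C(ℝ, X)).comp (t • ι))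
    ⟨1, right_mem_Icc.2 zero_le_one⟩
  have hk : ∀ t, k t = ∫ s in (0 : ℝ)..1, deriv x (t * s) := by
    intro t
    refine intervalIntegral.integral_congr fun s hs => ?_
    rw [uIcc_of_le zero_le_one] at hs
    rw [IccExtend_of_mem _ _ hs]
    rfl
  refine ⟨k, ?_, fun t => ?_, ?_⟩
  · have h1 : ContDiff ℝ ∞ fun t : ℝ => t • ι := contDiff_id.smul contDiff_const
    have h2 := (contDiff_superposition (K := Icc (0 : ℝ) 1) hx').comp h1
    exact ((ContinuousMap.evalCLM ℝ (⟨1, right_mem_Icc.2 zero_le_one⟩ : Icc (0 : ℝ) 1)).contDiff.comp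
      (primitiveOp (X := X)).contDiff).comp h2
  · rw [hk, intervalIntegral.smul_integral_comp_mul_left]
    rw [intervalIntegral.integral_deriv_eq_sub (fun s _ => hx.differentiable (by simp) s)
      (hx'.continuous.intervalIntegrable _ _)]
    simp
  · rw [hk]; simp

/-! ### Smooth dependence of flows on initial values -/

section Flow

universe u

variable {X : Type u} [NormedAddCommGroup X] [NormedSpace ℝ X]

/-- Solutions of `u' = l f(u)`, `u 0 = z` on `[0, 1]` are the solutions of
`integralEquationMap f (l, u) = (l, z)`. Rescaling the time interval by the extra parameter `l`
makes the derivative at `l = 0` trivially invertible. -/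
noncomputable def integralEquationMap (f : C(X, X)) (p : ℝ × C(Icc (0 : ℝ) 1, X)) :
    ℝ × C(Icc (0 : ℝ) 1, X) :=
  (p.1, p.2 - p.1 • primitiveOp (f.comp p.2))

theorem contDiff_integralEquationMap {f : X → X} (hf : ContDiff ℝ ∞ f) :
    ContDiff ℝ ∞ (integralEquationMap ⟨f, hf.continuous⟩) := by
  have h := (contDiff_superposition.{u, u, 0} (K := Icc (0 : ℝ) 1) hf)
  exact contDiff_fst.prodMk (contDiff_snd.sub (contDiff_fst.smul
    ((primitiveOp (X := X)).contDiff.comp (h.comp contDiff_snd))))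

theorem hasFDerivAt_integralEquationMap {f : X → X} (hf : ContDiff ℝ ∞ f)
    (u : C(Icc (0 : ℝ) 1, X)) : ∃ e : (ℝ × C(Icc (0 : ℝ) 1, X)) ≃L[ℝ] (ℝ × C(Icc (0 : ℝ) 1, X)),
      HasFDerivAt (integralEquationMap ⟨f, hf.continuous⟩)
        (e : (ℝ × C(Icc (0 : ℝ) 1, X)) →L[ℝ] (ℝ × C(Icc (0 : ℝ) 1, X))) (0, u) := by
  set c := primitiveOp ((⟨f, hf.continuous⟩ : C(X, X)).comp u) with hc
  let A : (ℝ × C(Icc (0 : ℝ) 1, X)) →L[ℝ] (ℝ × C(Icc (0 : ℝ) 1, X)) :=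
    (ContinuousLinearMap.fst ℝ _ _).prod
      (ContinuousLinearMap.snd ℝ _ _ - (ContinuousLinearMap.fst ℝ _ _).smulRight c)
  let B : (ℝ × C(Icc (0 : ℝ) 1, X)) →L[ℝ] (ℝ × C(Icc (0 : ℝ) 1, X)) :=
    (ContinuousLinearMap.fst ℝ _ _).prod
      (ContinuousLinearMap.snd ℝ _ _ + (ContinuousLinearMap.fst ℝ _ _).smulRight c)
  refine ⟨ContinuousLinearEquiv.equivOfInverse A B (fun p => by ext <;> simp [A, B])
    (fun p => by ext <;> simp [A, B]), ?_⟩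
  have h1 : HasFDerivAt (fun p : ℝ × C(Icc (0 : ℝ) 1, X) =>
      primitiveOp ((⟨f, hf.continuous⟩ : C(X, X)).comp p.2)) (fderiv ℝ (fun p : ℝ × C(Icc (0 : ℝ) 1, X) =>
      primitiveOp ((⟨f, hf.continuous⟩ : C(X, X)).comp p.2)) (0, u)) (0, u) := by
    refine (DifferentiableAt.hasFDerivAt ?_)
    have h := (contDiff_superposition.{u, u, 0} (K := Icc (0 : ℝ) 1) hf)
    exact (((primitiveOp (X := X)).contDiff.comp (h.comp contDiff_snd)).differentiable
      (by simp : (∞ : WithTop ℕ∞) ≠ 0)) _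
  have h2 := (hasFDerivAt_fst (𝕜 := ℝ) (p := ((0 : ℝ), u))).prodMk
    ((hasFDerivAt_snd (𝕜 := ℝ) (p := ((0 : ℝ), u))).sub ((hasFDerivAt_fst (𝕜 := ℝ) (p := ((0 : ℝ), u))).smul h1))
  refine h2.congr_fderiv ?_
  ext p <;> simp [A, hc]

/-- Smooth local flows: near `z₀` the equation `u' = l f(u)` has solutions on `[0, 1]` which stay
in a given neighbourhood `O` of `z₀` and whose end point depends smoothly on `(l, u 0)`. -/
theorem exists_smooth_flow [CompleteSpace X] {f : X → X} (hf : ContDiff ℝ ∞ f) (z₀ : X) {O : Set X} (hO : O ∈ 𝓝 z₀) :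
    ∃ ε > 0, ∃ Ψ : ℝ → X → ℝ → X,
      (∀ l z, |l| < ε → dist z z₀ < ε → Ψ l z 0 = z ∧
        ∀ t ∈ Icc (0 : ℝ) 1, Ψ l z t ∈ O ∧
          HasDerivWithinAt (Ψ l z) (l • f (Ψ l z t)) (Icc 0 1) t) ∧
      ∀ l z, |l| < ε → dist z z₀ < ε → ContDiffAt ℝ ∞ (fun z => Ψ l z 1) z := by
  set F := integralEquationMap (⟨f, hf.continuous⟩ : C(X, X)) with hF
  have hFs : ContDiff ℝ ∞ F := contDiff_integralEquationMap hf
  let κ : X →L[ℝ] C(Icc (0 : ℝ) 1, X) := ContinuousLinearMap.const ℝ _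
  have hκ : ∀ z t, κ z t = z := fun z t => rfl
  obtain ⟨e, he⟩ := hasFDerivAt_integralEquationMap hf (κ z₀)
  have hF0 : F (0, κ z₀) = (0, κ z₀) := by simp [hF, integralEquationMap]
  set R := hFs.contDiffAt.toOpenPartialHomeomorph F he (by simp) with hR
  have hRF : (R : _ → _) = F := rfl
  have hsrc : (0, κ z₀) ∈ R.source := ContDiffAt.mem_toOpenPartialHomeomorph_source _ he (by simp)
  have htgt : (0, κ z₀) ∈ R.target := by
    have := R.map_source hsrc
    rwa [hRF, hF0] at this
  have hsymm0 : R.symm (0, κ z₀) = (0, κ z₀) := by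
    have := R.left_inv hsrc
    rwa [hRF, hF0] at this
  have hsc : ContinuousAt R.symm (0, κ z₀) := R.continuousAt_symm htgt
  -- near the base point the derivative stays invertible
  have hinv : ∀ᶠ p in 𝓝 ((0 : ℝ), κ z₀),
      ∃ e' : (ℝ × C(Icc (0 : ℝ) 1, X)) ≃L[ℝ] (ℝ × C(Icc (0 : ℝ) 1, X)),
        (e' : (ℝ × C(Icc (0 : ℝ) 1, X)) →L[ℝ] (ℝ × C(Icc (0 : ℝ) 1, X))) = fderiv ℝ F p := by
    have h1 : ContinuousAt (fderiv ℝ F) (0, κ z₀) := (hFs.continuous_fderiv (by simp)).continuousAt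
    refine h1.eventually (p := fun A => ∃ e' : (ℝ × C(Icc (0 : ℝ) 1, X)) ≃L[ℝ]
      (ℝ × C(Icc (0 : ℝ) 1, X)),
        (e' : (ℝ × C(Icc (0 : ℝ) 1, X)) →L[ℝ] (ℝ × C(Icc (0 : ℝ) 1, X))) = A) ?_
    rw [he.fderiv]
    exact ContinuousLinearEquiv.nhds e
  have hstay : ∀ᶠ p : ℝ × C(Icc (0 : ℝ) 1, X) in 𝓝 ((0 : ℝ), κ z₀), ∀ t, p.2 t ∈ O := by
    obtain ⟨r, hr, hrO⟩ := Metric.mem_nhds_iff.1 hO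
    filter_upwards [Metric.ball_mem_nhds ((0 : ℝ), κ z₀) hr] with p hp t
    refine hrO (Metric.mem_ball.2 (lt_of_le_of_lt ?_ (Metric.mem_ball.1 hp)))
    refine le_trans ?_ (le_max_right _ _)
    exact ContinuousMap.dist_apply_le_dist (f := p.2) (g := κ z₀) t
  have hall : ∀ᶠ p : ℝ × C(Icc (0 : ℝ) 1, X) in 𝓝 ((0 : ℝ), κ z₀), p ∈ R.target ∧ (∀ t, (R.symm p).2 t ∈ O) ∧
      ∃ e' : (ℝ × C(Icc (0 : ℝ) 1, X)) ≃L[ℝ] (ℝ × C(Icc (0 : ℝ) 1, X)),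
        (e' : (ℝ × C(Icc (0 : ℝ) 1, X)) →L[ℝ] (ℝ × C(Icc (0 : ℝ) 1, X))) =
          fderiv ℝ F (R.symm p) := by
    refine (R.open_target.mem_nhds htgt |> Filter.eventually_mem_set.2).and (Filter.Eventually.and ?_ ?_)
    · exact hsc.eventually (by rw [hsymm0]; exact hstay)
    · exact hsc.eventually (by rw [hsymm0]; exact hinv)
  have hκc : ContinuousAt (fun p : ℝ × X => (p.1, κ p.2)) (0, z₀) := by fun_prop
  obtain ⟨ε, hε, hball⟩ := Metric.eventually_nhds_iff_ball.1 (hκc.eventually hall)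
  have hmem : ∀ l z, |l| < ε → dist z z₀ < ε → (l, z) ∈ Metric.ball ((0 : ℝ), z₀) ε := by
    intro l z hl hz
    rw [Metric.mem_ball, Prod.dist_eq]
    exact max_lt (by simpa using hl) hz
  let Ψ : ℝ → X → ℝ → X := fun l z => IccExtend zero_le_one (R.symm (l, κ z)).2
  refine ⟨ε, hε, Ψ, fun l z hl hz => ?_, fun l z hl hz => ?_⟩
  · obtain ⟨h1, h2, -⟩ := hball _ (hmem l z hl hz)
    set p := R.symm (l, κ z) with hp
    have heq : F p = (l, κ z) := R.right_inv h1
    have hp1 : p.1 = l := congrArg Prod.fst heq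
    have hp2 : ∀ t : Icc (0 : ℝ) 1, p.2 t = z + l • ∫ s in (0 : ℝ)..t, f (Ψ l z s) := by
      intro t
      have h := congrArg (fun q : ℝ × C(Icc (0 : ℝ) 1, X) => q.2 t) heq
      simp only [hF, integralEquationMap, ContinuousMap.sub_apply, ContinuousMap.smul_apply, hp1, hκ] at h
      rw [sub_eq_iff_eq_add] at h
      rw [h]
      rfl
    have hc : Continuous fun s => f (Ψ l z s) :=
      hf.continuous.comp (continuous_IccExtend_zero_one _)
    have hΨ : ∀ t ∈ Icc (0 : ℝ) 1, Ψ l z t = z + l • ∫ s in (0 : ℝ)..t, f (Ψ l z s) := by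
      intro t ht
      rw [← hp2 ⟨t, ht⟩]
      exact IccExtend_of_mem _ _ ht
    refine ⟨?_, fun t ht => ⟨h2 _, ?_⟩⟩
    · rw [hΨ 0 (left_mem_Icc.2 zero_le_one)]; simp
    · have hd : HasDerivAt (fun t => z + l • ∫ s in (0 : ℝ)..t, f (Ψ l z s)) (l • f (Ψ l z t)) t :=
        ((hc.integral_hasStrictDerivAt 0 t).hasDerivAt.const_smul l).const_add z
      exact hd.hasDerivWithinAt.congr hΨ (hΨ t ht)
  · obtain ⟨h1, -, e', he'⟩ := hball _ (hmem l z hl hz)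
    have hd : HasFDerivAt F
        (e' : (ℝ × C(Icc (0 : ℝ) 1, X)) →L[ℝ] (ℝ × C(Icc (0 : ℝ) 1, X))) (R.symm (l, κ z)) := by
      rw [he']; exact (hFs.differentiable (by simp) _).hasFDerivAt
    have hs : ContDiffAt ℝ ∞ R.symm (l, κ z) := R.contDiffAt_symm h1 hd hFs.contDiffAt
    have hs' : ContDiffAt ℝ ∞ (fun z => R.symm (l, κ z)) z :=
      ContDiffAt.comp z (g := R.symm) (f := fun z => (l, κ z)) hs
        (contDiff_const.prodMk κ.contDiff).contDiffAt
    have := ((ContinuousMap.evalCLM ℝ (projIcc (0 : ℝ) 1 zero_le_one 1)).contDiff.comp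
      contDiff_snd).contDiffAt.comp z hs'
    exact this

end Flow

/-! ### Curves in charts -/

section Charts

variable {E : Type*} [NormedAddCommGroup E] [NormedSpace ℝ E]
  {H : Type*} [TopologicalSpace H] {I : ModelWithCorners ℝ E H}
  {M : Type*} [TopologicalSpace M] [ChartedSpace H M] [IsManifold I ∞ M]

variable (I M) in
theorem isManifold_one_of_infty : IsManifold I 1 M := IsManifold.of_le (n := ∞) (by exact_mod_cast le_top)

variable (I) in
/-- The derivative at `x` of the chart at `x₀`, as a map into the model space. -/
noncomputable def chartDeriv (x₀ x : M) : TangentSpace I x →L[ℝ] E :=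
  mfderiv I 𝓘(ℝ, E) (extChartAt I x₀) x

theorem HasMFDerivWithinAt.hasDerivWithinAt_extChartAt {c : ℝ → M} {s : Set ℝ} {t : ℝ} {x₀ : M}
    {c' : TangentSpace 𝓘(ℝ, ℝ) t →L[ℝ] TangentSpace I (c t)}
    (hc : HasMFDerivWithinAt 𝓘(ℝ, ℝ) I c s t c') (ht : c t ∈ (chartAt H x₀).source) :
    HasDerivWithinAt (extChartAt I x₀ ∘ c)
      (chartDeriv I x₀ (c t) (c' (1 : ℝ))) s t := by
  have := isManifold_one_of_infty I M
  have h1 := (mdifferentiableAt_extChartAt (I := I) ht).hasMFDerivAt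
  let A : ℝ →L[ℝ] E := (mfderiv I 𝓘(ℝ, E) (extChartAt I x₀) (c t)).comp c'
  have h2 : HasFDerivWithinAt (extChartAt I x₀ ∘ c) A s t :=
    (h1.comp_hasMFDerivWithinAt t hc).hasFDerivWithinAt
  exact h2.hasDerivWithinAt

theorem MDifferentiableWithinAt.derivWithin_extChartAt {c : ℝ → M} {s : Set ℝ} {t : ℝ} {x₀ : M}
    (hc : MDifferentiableWithinAt 𝓘(ℝ, ℝ) I c s t) (ht : c t ∈ (chartAt H x₀).source)
    (hs : UniqueDiffWithinAt ℝ s t) :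
    derivWithin (extChartAt I x₀ ∘ c) s t =
      chartDeriv I x₀ (c t) (mfderivWithin 𝓘(ℝ, ℝ) I c s t (1 : ℝ)) :=
  (hc.hasMFDerivWithinAt.hasDerivWithinAt_extChartAt ht).derivWithin hs

theorem contMDiffOn_extChartAt_comp {c : ℝ → M} {s : Set ℝ} {x₀ : M} {n : WithTop ℕ∞}
    (hn : n ≤ ∞) (hc : ContMDiffOn 𝓘(ℝ, ℝ) I n c s)
    (hs : MapsTo c s (chartAt H x₀).source) : ContDiffOn ℝ n (extChartAt I x₀ ∘ c) s := by
  have := IsManifold.of_le (I := I) (M := M) hn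
  exact ((contMDiffOn_extChartAt (I := I) (n := n) (x := x₀)).comp hc hs).contDiffOn

theorem contMDiffOn_extChartAt_symm_comp [I.Boundaryless] {F : Type*} [NormedAddCommGroup F]
    [NormedSpace ℝ F] {y : F → E} {s : Set F} {x₀ : M}
    (hy : ContDiffOn ℝ ∞ y s) (hs : MapsTo y s (extChartAt I x₀).target) :
    ContMDiffOn 𝓘(ℝ, F) I ∞ (fun t => (extChartAt I x₀).symm (y t)) s :=
  (contMDiffOn_extChartAt_symm (I := I) (n := ∞) x₀).comp hy.contMDiffOn hs

theorem chartDeriv_injective {x₀ x : M} (hx : x ∈ (chartAt H x₀).source) :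
    Function.Injective (chartDeriv I x₀ x) := by
  have := isManifold_one_of_infty I M
  exact (isInvertible_mfderiv_extChartAt (I := I) (by rwa [extChartAt_source])).injective

theorem chartDeriv_surjective {x₀ x : M} (hx : x ∈ (chartAt H x₀).source) :
    Function.Surjective (chartDeriv I x₀ x) := by
  have := isManifold_one_of_infty I M
  exact (isInvertible_mfderiv_extChartAt (I := I) (by rwa [extChartAt_source])).surjective

end Charts

/-! ### Principal bundles -/

section Bundle

variable {E : Type*} [NormedAddCommGroup E] [NormedSpace ℝ E]
  {H : Type*} [TopologicalSpace H] {I : ModelWithCorners ℝ E H}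
  {M : Type*} [TopologicalSpace M] [ChartedSpace H M]
  {EG : Type*} [NormedAddCommGroup EG] [NormedSpace ℝ EG]
  {HG : Type*} [TopologicalSpace HG] {IG : ModelWithCorners ℝ EG HG}
  {G : Type*} [Group G] [TopologicalSpace G] [ChartedSpace HG G]
  {EQ : Type*} [NormedAddCommGroup EQ] [NormedSpace ℝ EQ]
  {HQ : Type*} [TopologicalSpace HQ] {IQ : ModelWithCorners ℝ EQ HQ}
  {Q : Type*} [TopologicalSpace Q] [ChartedSpace HQ Q] [MulAction Gᵐᵒᵖ Q] {π : Q → M}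

namespace IsPrincipalBundle

theorem contMDiff_proj (hπ : IsPrincipalBundle I IG G IQ π) : ContMDiff IQ I ∞ π := by
  intro q
  obtain ⟨e, hx, he, -, -⟩ := hπ.exists_trivialization (π q)
  have hq : q ∈ e.source := e.mem_source.2 hx
  have h1 : ContMDiffAt IQ I ∞ (fun q => (e q).1) q :=
    contMDiffAt_fst.comp q ((he q hq).contMDiffAt (e.open_source.mem_nhds hq))
  refine h1.congr_of_eventuallyEq ?_
  filter_upwards [e.open_source.mem_nhds hq] with q' hq' using (e.coe_fst hq').symm

theorem contMDiff_smul (hπ : IsPrincipalBundle I IG G IQ π) (g : G) :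
    ContMDiff IQ IQ ∞ (fun q : Q => op g • q) :=
  hπ.contMDiff_act.comp (contMDiff_id.prodMk contMDiff_const)

theorem exists_smul_eq (hπ : IsPrincipalBundle I IG G IQ π) {q q' : Q} (h : π q = π q') :
    ∃ g : G, q' = op g • q := by
  obtain ⟨e, hx, -, -, hg⟩ := hπ.exists_trivialization (π q)
  have hq : q ∈ e.source := e.mem_source.2 hx
  have hq' : q' ∈ e.source := e.mem_source.2 (h ▸ hx)
  refine ⟨(e q).2⁻¹ * (e q').2, e.injOn hq' (e.mem_source.2 ?_) ?_⟩
  · rwa [hπ.proj_act]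
  · refine Eq.trans ?_ (hg q hq _).symm
    change e q' = _
    refine Prod.ext ?_ (by simp)
    rw [e.coe_fst hq, e.coe_fst hq', h]

theorem eq_one_of_smul_eq (hπ : IsPrincipalBundle I IG G IQ π) {q : Q} {g : G}
    (h : op g • q = q) : g = 1 := by
  obtain ⟨e, hx, -, -, hg⟩ := hπ.exists_trivialization (π q)
  have h2 := hg q (e.mem_source.2 hx) g
  rw [h] at h2
  simpa using congrArg Prod.snd h2

/-- Through every point of a principal bundle there is a smooth local section. -/
theorem exists_local_section (hπ : IsPrincipalBundle I IG G IQ π) (q : Q) :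
    ∃ (U : Set M) (σ : M → Q), IsOpen U ∧ π q ∈ U ∧ ContMDiffOn I IQ ∞ σ U ∧ σ (π q) = q ∧
      ∀ x ∈ U, π (σ x) = x := by
  obtain ⟨e, hx, -, he, -⟩ := hπ.exists_trivialization (π q)
  have hq : q ∈ e.source := e.mem_source.2 hx
  refine ⟨e.baseSet, fun x => e.toOpenPartialHomeomorph.symm (x, (e q).2), e.open_baseSet, hx, ?_,
    ?_, fun x hx => e.proj_symm_apply (e.mem_target.2 hx)⟩
  · exact he.comp (contMDiff_id.prodMk contMDiff_const).contMDiffOn fun x hx => e.mem_target.2 hx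
  · have : (π q, (e q).2) = e q := Prod.ext (e.coe_fst hq).symm rfl
    dsimp only
    rw [this]
    exact e.toOpenPartialHomeomorph.left_inv hq

theorem mfderiv_proj_surjective (hπ : IsPrincipalBundle I IG G IQ π) (q : Q) :
    Function.Surjective (mfderiv IQ I π q) := by
  obtain ⟨U, σ, hU, hq, hσ, hσq, hπσ⟩ := hπ.exists_local_section q
  have h1 : MDifferentiableAt I IQ σ (π q) :=
    ((hσ _ hq).contMDiffAt (hU.mem_nhds hq)).mdifferentiableAt (by simp)
  have h2 : MDifferentiableAt IQ I π (σ (π q)) := hπ.contMDiff_proj.mdifferentiable (by simp) _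
  have h3 := h2.hasMFDerivAt.comp (π q) h1.hasMFDerivAt
  have h4 : HasMFDerivAt I I (π ∘ σ) (π q) (ContinuousLinearMap.id ℝ (TangentSpace I (π q))) :=
    (hasMFDerivAt_id (π q)).congr_of_eventuallyEq
      (Filter.eventuallyEq_of_mem (hU.mem_nhds hq) hπσ)
  have h5 := hasMFDerivAt_unique h3 h4
  rw [hσq] at h5
  intro v
  exact ⟨_, DFunLike.congr_fun h5 v⟩

theorem surjective (hπ : IsPrincipalBundle I IG G IQ π) : Function.Surjective π := by
  intro x
  obtain ⟨e, hx, -⟩ := hπ.exists_trivialization x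
  exact ⟨_, e.proj_symm_apply (e.mem_target.2 hx : (x, (1 : G)) ∈ e.target)⟩

end IsPrincipalBundle

/-! ### Horizontal distributions in charts -/

variable (I IQ π) in
/-- The projection of a bundle in the charts at `q₀` and `π q₀`. -/
noncomputable def projInCharts (q₀ : Q) (y : EQ) : E :=
  extChartAt I (π q₀) (π ((extChartAt IQ q₀).symm y))

variable (I IQ π) in
/-- In the charts at `q₀` and `π q₀`, over the open set `W`, the family `D` of sets of tangent
vectors consists of the horizontal lifts `L y w` of the vectors `w` tangent to the base. -/
structure IsLocalForm (D : ∀ q : Q, Set (TangentSpace IQ q)) (q₀ : Q) (W : Set EQ)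
    (L : EQ → E →L[ℝ] EQ) : Prop where
  isOpen : IsOpen W
  mem : extChartAt IQ q₀ q₀ ∈ W
  subset : W ⊆ (extChartAt IQ q₀).target
  proj_mem : ∀ y ∈ W, π ((extChartAt IQ q₀).symm y) ∈ (chartAt H (π q₀)).source
  contDiffOn : ContDiffOn ℝ ∞ L W
  proj_lift : ∀ y ∈ W, ∀ w, fderiv ℝ (projInCharts I IQ π q₀) y (L y w) = w
  mem_iff : ∀ q ∈ (chartAt HQ q₀).source, extChartAt IQ q₀ q ∈ W → ∀ v : TangentSpace IQ q,
    v ∈ D q ↔ chartDeriv IQ q₀ q v =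
      L (extChartAt IQ q₀ q) (fderiv ℝ (projInCharts I IQ π q₀) (extChartAt IQ q₀ q)
        (chartDeriv IQ q₀ q v))

variable [IsManifold I ∞ M] [IsManifold IQ ∞ Q]

variable (I IQ π) in
/-- The part of the chart target at `q₀` lying over the chart source at `π q₀`. -/
def chartDomain (q₀ : Q) (U : Set Q) : Set EQ :=
  (extChartAt IQ q₀).target ∩ (extChartAt IQ q₀).symm ⁻¹' (U ∩ π ⁻¹' (chartAt H (π q₀)).source)

omit [IsManifold I ∞ M] [IsManifold IQ ∞ Q] in
theorem isOpen_chartDomain [IQ.Boundaryless] (hπ : Continuous π) (q₀ : Q) {U : Set Q}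
    (hU : IsOpen U) : IsOpen (chartDomain (H := H) IQ π q₀ U) :=
  (continuousOn_extChartAt_symm q₀).isOpen_inter_preimage (isOpen_extChartAt_target q₀)
    (hU.inter (hπ.isOpen_preimage _ (chartAt H (π q₀)).open_source))

theorem contDiffOn_projInCharts [IQ.Boundaryless] (hπ : ContMDiff IQ I ∞ π) (q₀ : Q) (U : Set Q) :
    ContDiffOn ℝ ∞ (projInCharts I IQ π q₀) (chartDomain (H := H) IQ π q₀ U) := by
  rw [← contMDiffOn_iff_contDiffOn]
  refine (contMDiffOn_extChartAt (I := I) (n := ∞) (x := π q₀)).comp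
    (hπ.comp_contMDiffOn ((contMDiffOn_extChartAt_symm (I := IQ) (n := ∞) q₀).mono
      inter_subset_left)) ?_
  exact fun y hy => hy.2.2

theorem fderiv_projInCharts_comp [IQ.Boundaryless] (hπ : ContMDiff IQ I ∞ π) {q₀ q : Q}
    (hq : q ∈ (chartAt HQ q₀).source) (hq' : π q ∈ (chartAt H (π q₀)).source)
    (v : TangentSpace IQ q) :
    fderiv ℝ (projInCharts I IQ π q₀) (extChartAt IQ q₀ q)
        (chartDeriv IQ q₀ q v) =
      chartDeriv I (π q₀) (π q) (mfderiv IQ I π q v) := by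
  have := isManifold_one_of_infty I M
  have := isManifold_one_of_infty IQ Q
  have hqs : q ∈ (extChartAt IQ q₀).source := by rwa [extChartAt_source]
  have hmem : extChartAt IQ q₀ q ∈ chartDomain (H := H) IQ π q₀ univ :=
    ⟨(extChartAt IQ q₀).map_source hqs, trivial, by
      rw [mem_preimage, (extChartAt IQ q₀).left_inv hqs]; exact hq'⟩
  have h0 : HasFDerivAt (projInCharts I IQ π q₀)
      (fderiv ℝ (projInCharts I IQ π q₀) (extChartAt IQ q₀ q)) (extChartAt IQ q₀ q) :=
    (((contDiffOn_projInCharts hπ q₀ univ).contDiffAt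
      ((isOpen_chartDomain hπ.continuous q₀ isOpen_univ).mem_nhds hmem)).differentiableAt
        (by simp)).hasFDerivAt
  have h2 := h0.hasMFDerivAt.comp q (mdifferentiableAt_extChartAt (I := IQ) hq).hasMFDerivAt
  have h3 := (mdifferentiableAt_extChartAt (I := I) hq').hasMFDerivAt.comp q
    (hπ.mdifferentiable (by simp) q).hasMFDerivAt
  have h4 := hasMFDerivAt_unique h2 (h3.congr_of_eventuallyEq (by
    filter_upwards [(chartAt HQ q₀).open_source.mem_nhds hq] with q' hq'
    simp only [projInCharts, Function.comp]
    rw [(extChartAt IQ q₀).left_inv (by rwa [extChartAt_source])]))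
  exact DFunLike.congr_fun h4 v

end Bundle

section LocalForm

variable {E : Type*} [NormedAddCommGroup E] [NormedSpace ℝ E]
  {H : Type*} [TopologicalSpace H] {I : ModelWithCorners ℝ E H}
  {M : Type*} [TopologicalSpace M] [ChartedSpace H M] [IsManifold I ∞ M]
  {EG : Type*} [NormedAddCommGroup EG] [NormedSpace ℝ EG]
  {HG : Type*} [TopologicalSpace HG] {IG : ModelWithCorners ℝ EG HG}
  {G : Type*} [Group G] [TopologicalSpace G] [ChartedSpace HG G]
  {EQ : Type*} [NormedAddCommGroup EQ] [NormedSpace ℝ EQ]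
  {HQ : Type*} [TopologicalSpace HQ] {IQ : ModelWithCorners ℝ EQ HQ}
  {Q : Type*} [TopologicalSpace Q] [ChartedSpace HQ Q] [IsManifold IQ ∞ Q] [MulAction Gᵐᵒᵖ Q]
  {π : Q → M}

theorem contDiffOn_mfderiv_extChartAt_section [IQ.Boundaryless] {q₀ : Q} {U : Set Q}
    (hU : IsOpen U) (hUs : U ⊆ (chartAt HQ q₀).source) {X : ∀ q : Q, TangentSpace IQ q}
    (hX : ContMDiffOn IQ IQ.tangent ∞ (fun q => (⟨q, X q⟩ : TangentBundle IQ Q)) U) :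
    ContDiffOn ℝ ∞ (fun y => chartDeriv IQ q₀ ((extChartAt IQ q₀).symm y)
      (X ((extChartAt IQ q₀).symm y)))
      ((extChartAt IQ q₀).target ∩ (extChartAt IQ q₀).symm ⁻¹' U) := by
  have := isManifold_one_of_infty IQ Q
  have hb : (trivializationAt EQ (TangentSpace IQ : Q → Type _) q₀).baseSet =
      (chartAt HQ q₀).source := TangentBundle.trivializationAt_baseSet q₀
  have h1 := ((trivializationAt EQ (TangentSpace IQ : Q → Type _) q₀).contMDiffOn_section_iff
    (IB := IQ) (n := ∞) (s := X) hU (by rw [hb]; exact hUs)).1 hX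
  have h2 : ContMDiffOn IQ 𝓘(ℝ, EQ) ∞ (fun q => chartDeriv IQ q₀ q (X q)) U := by
    refine h1.congr fun q hq => ?_
    have h3 : chartDeriv IQ q₀ q = (trivializationAt EQ (TangentSpace IQ) q₀).continuousLinearMapAt ℝ q :=
      (TangentBundle.continuousLinearMapAt_trivializationAt (hUs hq)).symm
    rw [h3, Bundle.Trivialization.continuousLinearMapAt_apply,
      Bundle.Trivialization.coe_linearMapAt_of_mem _ (by rw [hb]; exact hUs hq)]
  rw [← contMDiffOn_iff_contDiffOn]
  exact h2.comp ((contMDiffOn_extChartAt_symm (I := IQ) (n := ∞) q₀).mono inter_subset_left)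
    fun y hy => hy.2

/-- A frame `ξ` of a horizontal distribution in a chart determines smooth horizontal lifts: they
are combinations of the frame whose coefficients solve a linear system. -/
theorem contDiffOn_lift_of_frame {ι : Type*} [Fintype ι] [CompleteSpace E] {W : Set EQ} {ξ : ι → EQ → EQ}
    (hξ : ∀ i, ContDiffOn ℝ ∞ (ξ i) W) {p : EQ → EQ →L[ℝ] E} (hp : ContDiffOn ℝ ∞ p W)
    (hinv : ∀ y ∈ W, Function.Bijective fun a : ι → ℝ => p y (∑ i, a i • ξ i y)) :
    ∃ L : EQ → E →L[ℝ] EQ, ContDiffOn ℝ ∞ L W ∧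
      ∀ y ∈ W, (∀ w, p y (L y w) = w) ∧ ∀ v, (v = L y (p y v) ↔ ∃ a : ι → ℝ, v = ∑ i, a i • ξ i y) := by
  let Ξ : EQ → (ι → ℝ) →L[ℝ] EQ := fun y =>
    ∑ i, (ContinuousLinearMap.proj (R := ℝ) (φ := fun _ : ι => ℝ) i).smulRight (ξ i y)
  have hΞa : ∀ y a, Ξ y a = ∑ i, a i • ξ i y := fun y a => by simp [Ξ]
  have hΞ : ContDiffOn ℝ ∞ Ξ W := ContDiffOn.sum fun i _ =>
    contDiffOn_const.smulRight (hξ i)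
  let B : EQ → (ι → ℝ) →L[ℝ] E := fun y => (p y).comp (Ξ y)
  have hB : ContDiffOn ℝ ∞ B W := hp.clm_comp hΞ
  have hBe : ∀ y ∈ W, ∃ e : (ι → ℝ) ≃L[ℝ] E, (e : (ι → ℝ) →L[ℝ] E) = B y := by
    intro y hy
    have hbij : Function.Bijective (B y) := by
      have := hinv y hy
      simp_rw [← hΞa] at this
      exact this
    exact ⟨ContinuousLinearEquiv.ofBijective (B y) (LinearMap.ker_eq_bot.2 hbij.1)
      (LinearMap.range_eq_top.2 hbij.2), by ext1; rfl⟩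
  refine ⟨fun y => (Ξ y).comp (B y).inverse, ?_, fun y hy => ?_⟩
  · refine hΞ.clm_comp fun y hy => ?_
    obtain ⟨e, he⟩ := hBe y hy
    have h1 : ContDiffAt ℝ ∞ ContinuousLinearMap.inverse (B y) := by
      rw [← he]; exact contDiffAt_map_inverse e
    exact h1.comp_contDiffWithinAt y (hB y hy)
  · obtain ⟨e, he⟩ := hBe y hy
    have hL : ∀ w, (Ξ y).comp (B y).inverse w = Ξ y (e.symm w) := by
      intro w; rw [← he, ContinuousLinearMap.inverse_equiv]; rfl
    have hpe : ∀ a, p y (Ξ y a) = e a := fun a =>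
      (DFunLike.congr_fun he a).symm
    refine ⟨fun w => by rw [hL, hpe, e.apply_symm_apply], fun v => ⟨fun h => ?_, ?_⟩⟩
    · rw [hL, hΞa] at h
      exact ⟨_, h⟩
    · rintro ⟨a, rfl⟩
      rw [← hΞa, hL, hpe, e.symm_apply_apply]

variable [FiniteDimensional ℝ E] [IQ.Boundaryless]

/-- A connection has local forms: its frames determine the horizontal lifts, since `dπ` restricts to
isomorphisms on the horizontal spaces. -/
theorem PrincipalConnection.exists_isLocalForm (hπ : IsPrincipalBundle I IG G IQ π)
    (A : PrincipalConnection I G IQ π) (q₀ : Q) :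
    ∃ W L, IsLocalForm I IQ π (fun q => (A.horizontal q : Set (TangentSpace IQ q))) q₀ W L := by
  have := isManifold_one_of_infty I M
  have := isManifold_one_of_infty IQ Q
  have : CompleteSpace E := FiniteDimensional.complete ℝ E
  obtain ⟨U, hU, hqU, k, X, hX, hXs⟩ := A.smooth q₀
  set U' := U ∩ (chartAt HQ q₀).source with hU'
  have hU'o : IsOpen U' := hU.inter (chartAt HQ q₀).open_source
  have hpi := hπ.contMDiff_proj
  set W := chartDomain (H := H) IQ π q₀ U' with hW
  have hWo : IsOpen W := isOpen_chartDomain hpi.continuous q₀ hU'o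
  let ξ : Fin k → EQ → EQ := fun i y =>
    chartDeriv IQ q₀ ((extChartAt IQ q₀).symm y)
      (X i ((extChartAt IQ q₀).symm y))
  have hξ : ∀ i, ContDiffOn ℝ ∞ (ξ i) W := fun i =>
    (contDiffOn_mfderiv_extChartAt_section hU'o inter_subset_right
      ((hX i).mono inter_subset_left)).mono fun y hy => ⟨hy.1, hy.2.1⟩
  have hp : ContDiffOn ℝ ∞ (fderiv ℝ (projInCharts I IQ π q₀)) W :=
    (contDiffOn_projInCharts hpi q₀ U').fderiv_of_isOpen hWo (by simp)
  have hsum : ∀ y (a : Fin k → ℝ), ∑ i, a i • ξ i y =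
      chartDeriv IQ q₀ ((extChartAt IQ q₀).symm y)
        (∑ i, a i • X i ((extChartAt IQ q₀).symm y)) := by
    intro y a
    rw [map_sum]
    exact Finset.sum_congr rfl fun i _ => (map_smul _ _ _).symm
  have hspan : ∀ q ∈ U, ∀ v, v ∈ A.horizontal q ↔ ∃ a : Fin k → ℝ, v = ∑ i, a i • X i q := by
    intro q hq v
    rw [← (hXs q hq).2, Submodule.mem_span_range_iff_exists_fun]
    exact exists_congr fun a => eq_comm
  have hker : ∀ q v, v ∈ verticalSpace I IQ π q ↔ mfderiv IQ I π q v = 0 := fun q v => Iff.rfl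
  obtain ⟨L, hL, hL'⟩ := contDiffOn_lift_of_frame hξ hp (by
    intro y hy
    set q := (extChartAt IQ q₀).symm y with hq
    have hqy : extChartAt IQ q₀ q = y := (extChartAt IQ q₀).right_inv hy.1
    have key : ∀ a : Fin k → ℝ, fderiv ℝ (projInCharts I IQ π q₀) y (∑ i, a i • ξ i y) =
        chartDeriv I (π q₀) (π q) (mfderiv IQ I π q (∑ i, a i • X i q)) := by
      intro a
      rw [hsum, ← fderiv_projInCharts_comp hpi hy.2.1.2 hy.2.2, hqy]
    constructor
    · refine (injective_iff_map_eq_zero' ((fderiv ℝ (projInCharts I IQ π q₀) y).toLinearMap ∘ₗ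
        Fintype.linearCombination ℝ (fun i => ξ i y))).2 fun a => ⟨fun ha => ?_, fun ha => by simp [ha]⟩
      have h0 : chartDeriv I (π q₀) (π q)
          (mfderiv IQ I π q (∑ i, a i • X i q)) = 0 := by
        rw [← key]; exact ha
      have h1 := chartDeriv_injective (I := I) hy.2.2 (h0.trans (map_zero _).symm)
      have h2 : (∑ i, a i • X i q) ∈ A.horizontal q := (hspan q hy.2.1.1 _).2 ⟨a, rfl⟩
      have h3 := (Submodule.disjoint_def.1 (A.isCompl q).disjoint) _ h2 ((hker q _).2 h1)
      exact funext (Fintype.linearIndependent_iff.1 (hXs q hy.2.1.1).1 a h3)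
    · intro w
      obtain ⟨w', hw'⟩ := chartDeriv_surjective (I := I) hy.2.2 w
      obtain ⟨v, hv⟩ := hπ.mfderiv_proj_surjective q w'
      obtain ⟨h, hh, z, hz, hhz⟩ := Submodule.mem_sup.1
        ((A.isCompl q).sup_eq_top ▸ Submodule.mem_top : v ∈ A.horizontal q ⊔ verticalSpace I IQ π q)
      obtain ⟨a, rfl⟩ := (hspan q hy.2.1.1 _).1 hh
      refine ⟨a, ?_⟩
      dsimp only
      rw [key, ← hw', ← hv, ← hhz, map_add, (hker q z).1 hz, add_zero])
  refine ⟨W, L, hWo, ?_, inter_subset_left, fun y hy => hy.2.2, hL, fun y hy => (hL' y hy).1, ?_⟩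
  · refine ⟨mem_extChartAt_target q₀, ?_⟩
    rw [mem_preimage, extChartAt_to_inv]
    exact ⟨⟨hqU, mem_chart_source _ _⟩, mem_chart_source _ _⟩
  · intro q hq hqW v
    have hqs : (extChartAt IQ q₀).symm (extChartAt IQ q₀ q) = q :=
      (extChartAt IQ q₀).left_inv (by rwa [extChartAt_source])
    rw [(hL' _ hqW).2]
    have hqU : q ∈ U := by
      have := hqW.2.1.1
      rwa [hqs] at this
    refine (hspan q hqU v).trans (exists_congr fun a => ?_)
    rw [hsum, hqs]
    exact (chartDeriv_injective hq).eq_iff.symm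

end LocalForm

/-! ### The differential equation of horizontal lifts -/

section ODE

variable {E F : Type*} [NormedAddCommGroup E] [NormedSpace ℝ E] [NormedAddCommGroup F]
  [NormedSpace ℝ F] {L : F → E →L[ℝ] F} {W : Set F} {ξ : ℝ → E} {u v : ℝ}

/-- Near a point of `W`, the right-hand side of `y' = L(y) ξ(t)` is bounded and Lipschitz. -/
theorem exists_closedBall_lipschitz (hW : IsOpen W) (hL : ContDiffOn ℝ ∞ L W)
    (hξ : ContinuousOn ξ (Icc u v)) {y₀ : F} (hy₀ : y₀ ∈ W) :
    ∃ a : NNReal, 0 < a ∧ Metric.closedBall y₀ a ⊆ W ∧ ∃ K B : NNReal,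
      (∀ t ∈ Icc u v, LipschitzOnWith K (fun y => L y (ξ t)) (Metric.closedBall y₀ a)) ∧
      ∀ t ∈ Icc u v, ∀ y ∈ Metric.closedBall y₀ a, ‖L y (ξ t)‖ ≤ B := by
  have hLa : ContDiffAt ℝ ∞ L y₀ := hL.contDiffAt (hW.mem_nhds hy₀)
  obtain ⟨K, s, hs, hK⟩ := (hLa.of_le (m := 1) (by exact_mod_cast le_top)).exists_lipschitzOnWith
  obtain ⟨B, hB⟩ := isCompact_Icc.exists_bound_of_continuousOn hξ
  have hB0 : ∀ t ∈ Icc u v, ‖ξ t‖ ≤ B.toNNReal := fun t ht => (hB t ht).trans (Real.le_coe_toNNReal B)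
  have hbd : ∀ᶠ y in 𝓝 y₀, ‖L y‖ < ‖L y₀‖ + 1 :=
    hLa.continuousAt.norm.eventually_lt_const (by linarith)
  obtain ⟨a, ha, hsub⟩ := Metric.nhds_basis_closedBall.mem_iff.1
    (Filter.inter_mem (Filter.inter_mem hs (hW.mem_nhds hy₀)) hbd)
  refine ⟨⟨a, ha.le⟩, ha, fun y hy => (hsub hy).1.2, B.toNNReal * K,
    (‖L y₀‖₊ + 1) * B.toNNReal, fun t ht => ?_, fun t ht y hy => ?_⟩
  · refine LipschitzOnWith.of_dist_le_mul fun y hy z hz => ?_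
    rw [dist_eq_norm, ← sub_apply]
    have h1 := (hK.mono fun y hy => (hsub hy).1.1).dist_le_mul y hy z hz
    rw [dist_eq_norm] at h1
    calc ‖(L y - L z) (ξ t)‖ ≤ ‖L y - L z‖ * ‖ξ t‖ := ContinuousLinearMap.le_opNorm _ _
      _ ≤ (K * dist y z) * B.toNNReal := by gcongr; exact hB0 t ht
      _ = _ := by push_cast; ring
  · refine (ContinuousLinearMap.le_opNorm _ _).trans ?_
    push_cast
    exact mul_le_mul (le_of_lt (hsub hy).2) (hB0 t ht) (norm_nonneg _) (by positivity)

/-- One-sided at the end points: `t₀` may be an end point of `[u, v]`. -/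
theorem exists_solution_near [CompleteSpace F] (hW : IsOpen W) (hL : ContDiffOn ℝ ∞ L W)
    (hξ : ContinuousOn ξ (Icc u v)) {t₀ : ℝ} (ht₀ : t₀ ∈ Icc u v) {y₀ : F} (hy₀ : y₀ ∈ W) :
    ∃ ε > 0, ∃ y : ℝ → F, y t₀ = y₀ ∧
      ∀ t ∈ Icc (max u (t₀ - ε)) (min v (t₀ + ε)), y t ∈ W ∧
        HasDerivWithinAt y (L (y t) (ξ t)) (Icc (max u (t₀ - ε)) (min v (t₀ + ε))) t := by
  obtain ⟨a, ha, haW, K, B, hK, hB⟩ := exists_closedBall_lipschitz hW hL hξ hy₀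
  have hsub : ∀ ε, Icc (max u (t₀ - ε)) (min v (t₀ + ε)) ⊆ Icc u v := fun ε =>
    Icc_subset_Icc (le_max_left _ _) (min_le_left _ _)
  have hmem : ∀ ε, 0 < ε → t₀ ∈ Icc (max u (t₀ - ε)) (min v (t₀ + ε)) := fun ε hε =>
    ⟨max_le ht₀.1 (by linarith), le_min ht₀.2 (by linarith)⟩
  have ha' : (0 : ℝ) < a := ha
  set ε : ℝ := a / (B + 1) with hε
  have hε0 : 0 < ε := by positivity
  have hpl : IsPicardLindelof (fun t y => L y (ξ t)) (tmin := max u (t₀ - ε))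
      (tmax := min v (t₀ + ε)) ⟨t₀, hmem ε hε0⟩ y₀ a 0 B K := by
    refine ⟨fun t ht => hK t (hsub ε ht), fun y hy => ?_, fun t ht => hB t (hsub ε ht), ?_⟩
    · exact ((L y).continuous.comp_continuousOn hξ).mono (hsub ε)
    · have h1 : max (min v (t₀ + ε) - t₀) (t₀ - max u (t₀ - ε)) ≤ ε :=
        max_le (by linarith [min_le_right v (t₀ + ε)]) (by linarith [le_max_right u (t₀ - ε)])
      calc (B : ℝ) * max (min v (t₀ + ε) - t₀) (t₀ - max u (t₀ - ε)) ≤ B * ε := by gcongr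
        _ ≤ (B + 1) * ε := by gcongr; linarith
        _ = a - (0 : NNReal) := by rw [hε]; field_simp; simp
  obtain ⟨y, hy0, hy⟩ := hpl.exists_eq_forall_mem_Icc_hasDerivWithinAt₀
  dsimp only at hy0
  have hc : ∀ᶠ t in 𝓝[Icc (max u (t₀ - ε)) (min v (t₀ + ε))] t₀, y t ∈ W :=
    (hy t₀ (hmem ε hε0)).continuousWithinAt.eventually (by rw [hy0]; exact hW.mem_nhds hy₀)
  rw [eventually_nhdsWithin_iff] at hc
  obtain ⟨δ, hδ, hδ'⟩ := Metric.eventually_nhds_iff.1 hc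
  set η := min ε (δ / 2) with hη
  have hη0 : 0 < η := lt_min hε0 (by linarith)
  have hsub' : Icc (max u (t₀ - η)) (min v (t₀ + η)) ⊆ Icc (max u (t₀ - ε)) (min v (t₀ + ε)) := by
    have : η ≤ ε := min_le_left _ _
    exact Icc_subset_Icc (max_le_max le_rfl (by linarith)) (min_le_min le_rfl (by linarith))
  refine ⟨η, hη0, y, hy0, fun t ht => ⟨hδ' ?_ (hsub' ht), (hy t (hsub' ht)).mono hsub'⟩⟩
  have h1 : t₀ - η ≤ t := (le_max_right _ _).trans ht.1
  have h2 : t ≤ t₀ + η := ht.2.trans (min_le_right _ _)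
  have h3 : η ≤ δ / 2 := min_le_right _ _
  rw [Real.dist_eq, abs_lt]
  constructor <;> linarith

theorem solution_unique_right (hW : IsOpen W) (hL : ContDiffOn ℝ ∞ L W)
    (hξ : ContinuousOn ξ (Icc u v)) (huv : u < v) {y z : ℝ → F}
    (hy : ∀ t ∈ Icc u v, HasDerivWithinAt y (L (y t) (ξ t)) (Icc u v) t)
    (hz : ∀ t ∈ Icc u v, HasDerivWithinAt z (L (z t) (ξ t)) (Icc u v) t)
    (h : y u = z u) (hu : y u ∈ W) : ∃ w ∈ Ioc u v, EqOn y z (Icc u w) := by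
  obtain ⟨a, ha, haW, K, B, hK, hB⟩ := exists_closedBall_lipschitz hW hL hξ hu
  have hul : u ∈ Icc u v := left_mem_Icc.2 huv.le
  have hball : Metric.closedBall (y u) a ∈ 𝓝 (y u) := Metric.closedBall_mem_nhds _ ha
  have hev : ∀ᶠ t in 𝓝[Icc u v] u, y t ∈ Metric.closedBall (y u) a ∧ z t ∈ Metric.closedBall (y u) a :=
    ((hy u hul).continuousWithinAt.eventually hball).and
      ((hz u hul).continuousWithinAt.eventually (by rw [← h]; exact hball))
  rw [nhdsWithin_Icc_eq_nhdsGE huv] at hev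
  obtain ⟨w, hw, hw'⟩ := (mem_nhdsGE_iff_exists_mem_Ioc_Ico_subset huv).1 hev
  have hsub : Icc u w ⊆ Icc u v := Icc_subset_Icc_right hw.2
  have hder : ∀ y : ℝ → F, (∀ t ∈ Icc u v, HasDerivWithinAt y (L (y t) (ξ t)) (Icc u v) t) →
      ∀ t ∈ Ico u w, HasDerivWithinAt y (L (y t) (ξ t)) (Ici t) t := fun y hy t ht =>
    (hy t (hsub (Ico_subset_Icc_self ht))).mono_of_mem_nhdsWithin
      (Icc_mem_nhdsGE_of_mem ⟨ht.1, ht.2.trans_le hw.2⟩)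
  refine ⟨w, hw, ODE_solution_unique_of_mem_Icc_right (v := fun t y => L y (ξ t))
    (s := fun _ => Metric.closedBall (y u) a)
    (fun t ht => hK t (hsub (Ico_subset_Icc_self ht)))
    (fun t ht => ((hy t (hsub ht)).continuousWithinAt).mono hsub) (hder y hy) (fun t ht => (hw' ht).1)
    (fun t ht => ((hz t (hsub ht)).continuousWithinAt).mono hsub) (hder z hz) (fun t ht => (hw' ht).2)
    h⟩

end ODE

/-! ### Horizontal curves -/

section Horizontal

variable {E : Type*} [NormedAddCommGroup E] [NormedSpace ℝ E]
  {H : Type*} [TopologicalSpace H] {I : ModelWithCorners ℝ E H}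
  {M : Type*} [TopologicalSpace M] [ChartedSpace H M] [IsManifold I ∞ M]
  {EG : Type*} [NormedAddCommGroup EG] [NormedSpace ℝ EG]
  {HG : Type*} [TopologicalSpace HG] {IG : ModelWithCorners ℝ EG HG}
  {G : Type*} [Group G] [TopologicalSpace G] [ChartedSpace HG G]
  {EQ : Type*} [NormedAddCommGroup EQ] [NormedSpace ℝ EQ]
  {HQ : Type*} [TopologicalSpace HQ] {IQ : ModelWithCorners ℝ EQ HQ}
  {Q : Type*} [TopologicalSpace Q] [ChartedSpace HQ Q] [IsManifold IQ ∞ Q] [MulAction Gᵐᵒᵖ Q]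
  {π : Q → M}

/-- In charts, a curve has horizontal velocity if and only if it solves the equation
`y' = L(y) x'`, where `x` is its projection to the base. -/
theorem IsLocalForm.mem_iff_derivWithin [IQ.Boundaryless] (hπ : ContMDiff IQ I ∞ π)
    {D : ∀ q : Q, Set (TangentSpace IQ q)} {q₀ : Q} {W : Set EQ} {L : EQ → E →L[ℝ] EQ}
    (hL : IsLocalForm I IQ π D q₀ W L) {c : ℝ → Q} {s : Set ℝ} {t : ℝ}
    (hc : MDifferentiableWithinAt 𝓘(ℝ, ℝ) IQ c s t) (hs : UniqueDiffWithinAt ℝ s t)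
    (ht : c t ∈ (chartAt HQ q₀).source) (htW : extChartAt IQ q₀ (c t) ∈ W) :
    mfderivWithin 𝓘(ℝ, ℝ) IQ c s t (1 : ℝ) ∈ D (c t) ↔
      derivWithin (extChartAt IQ q₀ ∘ c) s t =
        L (extChartAt IQ q₀ (c t)) (derivWithin (extChartAt I (π q₀) ∘ π ∘ c) s t) := by
  have hπt : π (c t) ∈ (chartAt H (π q₀)).source := by
    have := hL.proj_mem _ htW
    rwa [(extChartAt IQ q₀).left_inv (by rwa [extChartAt_source])] at this
  rw [hL.mem_iff _ ht htW, fderiv_projInCharts_comp hπ ht hπt, hc.derivWithin_extChartAt ht hs]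
  have h1 : HasMFDerivWithinAt 𝓘(ℝ, ℝ) I (π ∘ c) s t _ :=
    (hπ.mdifferentiable (by simp) (c t)).hasMFDerivAt.comp_hasMFDerivWithinAt t hc.hasMFDerivWithinAt
  have h2 := (h1.hasDerivWithinAt_extChartAt (x₀ := π q₀) hπt).derivWithin hs
  rw [h2]
  rfl

end Horizontal

section HorizontalCurves

variable {E : Type*} [NormedAddCommGroup E] [NormedSpace ℝ E]
  {H : Type*} [TopologicalSpace H] {I : ModelWithCorners ℝ E H}
  {M : Type*} [TopologicalSpace M] [ChartedSpace H M] [IsManifold I ∞ M]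
  {EG : Type*} [NormedAddCommGroup EG] [NormedSpace ℝ EG]
  {HG : Type*} [TopologicalSpace HG] {IG : ModelWithCorners ℝ EG HG}
  {G : Type*} [Group G] [TopologicalSpace G] [ChartedSpace HG G]
  {EQ : Type*} [NormedAddCommGroup EQ] [NormedSpace ℝ EQ]
  {HQ : Type*} [TopologicalSpace HQ] {IQ : ModelWithCorners ℝ EQ HQ}
  {Q : Type*} [TopologicalSpace Q] [ChartedSpace HQ Q] [IsManifold IQ ∞ Q] [MulAction Gᵐᵒᵖ Q]
  {π : Q → M}

theorem contMDiffOn_singleton {c : ℝ → M} {t : ℝ} : ContMDiffOn 𝓘(ℝ, ℝ) I ∞ c {t} :=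
  (contMDiffOn_const (c := c t)).congr fun s hs => by rw [mem_singleton_iff.1 hs]

theorem contMDiffOn_Icc_of_le {c : ℝ → M} {u v : ℝ} (h : v ≤ u) :
    ContMDiffOn 𝓘(ℝ, ℝ) I ∞ c (Icc u v) :=
  (contMDiffOn_singleton (t := u)).mono fun _ hs => le_antisymm (hs.2.trans h) hs.1

namespace PrincipalConnection

/-- The curve `c` is smooth on `[u, v]`, up to the end points, with horizontal velocity. -/
def HorizOn (A : PrincipalConnection I G IQ π) (c : ℝ → Q) (u v : ℝ) : Prop :=
  ContMDiffOn 𝓘(ℝ, ℝ) IQ ∞ c (Icc u v) ∧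
    ∀ t ∈ Ioo u v, mfderiv 𝓘(ℝ, ℝ) IQ c t (1 : ℝ) ∈ A.horizontal (c t)

/-- The curve `c` is a piecewise smooth horizontal lift of `γ` on `[u, v]`. -/
def LiftOn (A : PrincipalConnection I G IQ π) (γ : ℝ → M) (c : ℝ → Q) (u v : ℝ) : Prop :=
  ContinuousOn c (Icc u v) ∧ (∀ t ∈ Icc u v, π (c t) = γ t) ∧
    ∃ T : Finset ℝ, ∀ p r, Icc p r ⊆ Icc u v → Disjoint (Ioo p r) (T : Set ℝ) → A.HorizOn c p r

variable {A : PrincipalConnection I G IQ π} {γ : ℝ → M} {c c' : ℝ → Q} {u v w : ℝ}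

theorem HorizOn.mdifferentiableAt (h : A.HorizOn c u v) {t : ℝ} (ht : t ∈ Ioo u v) :
    MDifferentiableAt 𝓘(ℝ, ℝ) IQ c t :=
  ((h.1 t (Ioo_subset_Icc_self ht)).contMDiffAt (Icc_mem_nhds ht.1 ht.2)).mdifferentiableAt (by simp)

theorem horizOn_of_le (A : PrincipalConnection I G IQ π) (c : ℝ → Q) (h : v ≤ u) :
    A.HorizOn c u v :=
  ⟨contMDiffOn_Icc_of_le h, fun _ ht => absurd (ht.1.trans ht.2) (not_lt.2 h)⟩

theorem HorizOn.mono (h : A.HorizOn c u v) {p r : ℝ} (hs : Icc p r ⊆ Icc u v) :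
    A.HorizOn c p r := by
  rcases le_or_gt r p with hrp | hpr
  · exact horizOn_of_le A c hrp
  · refine ⟨h.1.mono hs, fun t ht => h.2 t ?_⟩
    have h1 := hs (left_mem_Icc.2 hpr.le)
    have h2 := hs (right_mem_Icc.2 hpr.le)
    exact ⟨h1.1.trans_lt ht.1, ht.2.trans_le h2.2⟩

theorem HorizOn.congr (h : A.HorizOn c u v) (hc : EqOn c' c (Icc u v)) : A.HorizOn c' u v := by
  refine ⟨h.1.congr hc, fun t ht => ?_⟩
  have h1 : c' =ᶠ[𝓝 t] c := Filter.eventuallyEq_of_mem (Icc_mem_nhds ht.1 ht.2) hc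
  have h2 := h.2 t ht
  have h3 : (mfderiv 𝓘(ℝ, ℝ) IQ c' t : ℝ →L[ℝ] EQ) = mfderiv 𝓘(ℝ, ℝ) IQ c t := h1.mfderiv_eq
  have key : ∀ q, q = c t → ∀ z : TangentSpace IQ q, (z : EQ) = mfderiv 𝓘(ℝ, ℝ) IQ c t (1 : ℝ) →
      z ∈ A.horizontal q := by
    rintro q rfl z rfl
    exact h2
  exact key _ (hc (Ioo_subset_Icc_self ht)) _ (DFunLike.congr_fun h3 (1 : ℝ))

theorem LiftOn.mono (h : A.LiftOn γ c u v) {p r : ℝ} (hs : Icc p r ⊆ Icc u v) :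
    A.LiftOn γ c p r := by
  obtain ⟨T, hT⟩ := h.2.2
  exact ⟨h.1.mono hs, fun t ht => h.2.1 t (hs ht), T, fun p' r' h' hd => hT p' r' (h'.trans hs) hd⟩

theorem LiftOn.congr (h : A.LiftOn γ c u v) (hc : EqOn c' c (Icc u v)) {γ' : ℝ → M}
    (hγ : EqOn γ' γ (Icc u v)) : A.LiftOn γ' c' u v := by
  obtain ⟨T, hT⟩ := h.2.2
  exact ⟨h.1.congr hc, fun t ht => by rw [hc ht, hγ ht, h.2.1 t ht], T,
    fun p r h' hd => (hT p r h' hd).congr (hc.mono h')⟩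

theorem LiftOn.of_horizOn (h : A.HorizOn c u v) (hγ : ∀ t ∈ Icc u v, π (c t) = γ t) :
    A.LiftOn γ c u v :=
  ⟨h.1.continuousOn, hγ, ∅, fun _ _ hs _ => h.mono hs⟩

theorem HorizOn.smul (hπ : IsPrincipalBundle I IG G IQ π) (h : A.HorizOn c u v) (g : G) :
    A.HorizOn (fun t => op g • c t) u v := by
  refine ⟨(hπ.contMDiff_smul g).comp_contMDiffOn h.1, fun t ht => ?_⟩
  have h1 := ((hπ.contMDiff_smul g).mdifferentiable (by simp) (c t)).hasMFDerivAt.comp t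
    (h.mdifferentiableAt ht).hasMFDerivAt
  have h2 : mfderiv 𝓘(ℝ, ℝ) IQ (fun t => op g • c t) t = _ := h1.mfderiv
  rw [h2, ← A.invariant g (c t)]
  exact Submodule.mem_map_of_mem (h.2 t ht)

theorem LiftOn.smul (hπ : IsPrincipalBundle I IG G IQ π) (h : A.LiftOn γ c u v) (g : G) :
    A.LiftOn γ (fun t => op g • c t) u v := by
  obtain ⟨T, hT⟩ := h.2.2
  exact ⟨(hπ.contMDiff_smul g).continuous.comp_continuousOn h.1,
    fun t ht => by rw [hπ.proj_act, h.2.1 t ht], T, fun p r hs hd => (hT p r hs hd).smul hπ g⟩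

theorem LiftOn.trans (h : A.LiftOn γ c u v) (h' : A.LiftOn γ c' v w) (hv : c v = c' v)
    (huv : u ≤ v) (hvw : v ≤ w) : A.LiftOn γ (fun t => if t ≤ v then c t else c' t) u w := by
  classical
  have hl : EqOn (fun t => if t ≤ v then c t else c' t) c (Iic v) := fun t ht => if_pos ht
  have hr : EqOn (fun t => if t ≤ v then c t else c' t) c' (Ici v) := by
    intro t ht
    rcases (mem_Ici.1 ht).eq_or_lt with rfl | h'
    · simpa using hv
    · exact if_neg (not_le.2 h')
  obtain ⟨T, hT⟩ := h.2.2
  obtain ⟨T', hT'⟩ := h'.2.2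
  refine ⟨?_, fun t ht => ?_, insert v (T ∪ T'), fun p r hs hd => ?_⟩
  · rw [← Icc_union_Icc_eq_Icc huv hvw]
    exact (h.1.congr (hl.mono fun t ht => ht.2)).union_of_isClosed
      (h'.1.congr (hr.mono fun t ht => ht.1)) isClosed_Icc isClosed_Icc
  · rcases le_total t v with h1 | h1
    · exact (congrArg π (hl h1)).trans (h.2.1 t ⟨ht.1, h1⟩)
    · exact (congrArg π (hr h1)).trans (h'.2.1 t ⟨h1, ht.2⟩)
  · rcases le_or_gt r p with hrp | hpr
    · exact horizOn_of_le A _ hrp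
    have hp := hs (left_mem_Icc.2 hpr.le)
    have hr' := hs (right_mem_Icc.2 hpr.le)
    have hb : r ≤ v ∨ v ≤ p := by
      by_contra hcon
      push Not at hcon
      exact Set.disjoint_left.1 hd (show v ∈ Ioo p r from ⟨hcon.2, hcon.1⟩) (by simp)
    rcases hb with hb | hb
    · exact (hT p r (Icc_subset_Icc hp.1 hb) (hd.mono_right fun x hx => by
        simp only [Finset.coe_insert, Finset.coe_union]; exact Or.inr (Or.inl hx))).congr
        (hl.mono fun t ht => ht.2.trans hb)
    · exact (hT' p r (Icc_subset_Icc hb hr'.2) (hd.mono_right fun x hx => by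
        simp only [Finset.coe_insert, Finset.coe_union]; exact Or.inr (Or.inr hx))).congr
        (hr.mono fun t ht => hb.trans ht.1)

theorem HorizOn.comp (h : A.HorizOn c u v) {θ : ℝ → ℝ} {p r : ℝ}
    (hθ : ContDiffOn ℝ ∞ θ (Icc p r)) (hmaps : MapsTo θ (Icc p r) (Icc u v))
    (hmaps' : MapsTo θ (Ioo p r) (Ioo u v)) : A.HorizOn (c ∘ θ) p r := by
  refine ⟨h.1.comp hθ.contMDiffOn hmaps, fun t ht => ?_⟩
  have h1 : HasDerivAt θ (deriv θ t) t := (((hθ t (Ioo_subset_Icc_self ht)).contDiffAt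
    (Icc_mem_nhds ht.1 ht.2)).differentiableAt (by simp)).hasDerivAt
  have h2 := (h.mdifferentiableAt (hmaps' ht)).hasMFDerivAt.comp t h1.hasFDerivAt.hasMFDerivAt
  rw [h2.mfderiv]
  have h3 := (A.horizontal (c (θ t))).smul_mem (deriv θ t) (h.2 _ (hmaps' ht))
  have h4 : (ContinuousLinearMap.toSpanSingleton ℝ (deriv θ t)) (1 : ℝ) = deriv θ t • (1 : ℝ) := by
    simp
  have h5 : mfderiv 𝓘(ℝ, ℝ) IQ c (θ t) (deriv θ t • (1 : ℝ)) =
    deriv θ t • mfderiv 𝓘(ℝ, ℝ) IQ c (θ t) (1 : ℝ) := map_smul _ _ _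
  change mfderiv 𝓘(ℝ, ℝ) IQ c (θ t)
    ((ContinuousLinearMap.toSpanSingleton ℝ (deriv θ t)) (1 : ℝ)) ∈ A.horizontal (c (θ t))
  rw [h4, h5]
  exact h3

/-- Horizontal lifts may be reparametrized by strictly increasing smooth functions, whose
derivative may have zeros. -/
theorem LiftOn.comp (h : A.LiftOn γ c u v) {θ : ℝ → ℝ} {p r : ℝ}
    (hθ : ContDiffOn ℝ ∞ θ (Icc p r)) (hmono : StrictMonoOn θ (Icc p r))
    (hmaps : MapsTo θ (Icc p r) (Icc u v)) : A.LiftOn (γ ∘ θ) (c ∘ θ) p r := by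
  classical
  obtain ⟨T, hT⟩ := h.2.2
  have hfin : (Icc p r ∩ θ ⁻¹' (T : Set ℝ)).Finite := by
    refine Set.Finite.of_finite_image (f := θ) (T.finite_toSet.subset ?_)
      (hmono.injOn.mono inter_subset_left)
    rintro _ ⟨t, ht, rfl⟩
    exact ht.2
  refine ⟨h.1.comp hθ.continuousOn hmaps, fun t ht => h.2.1 _ (hmaps ht), hfin.toFinset,
    fun p' r' hs hd => ?_⟩
  rcases le_or_gt r' p' with hrp | hpr
  · exact horizOn_of_le A _ hrp
  have hp := hs (left_mem_Icc.2 hpr.le)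
  have hr := hs (right_mem_Icc.2 hpr.le)
  have hm1 : MapsTo θ (Icc p' r') (Icc (θ p') (θ r')) := fun t ht =>
    ⟨hmono.monotoneOn hp (hs ht) ht.1, hmono.monotoneOn (hs ht) hr ht.2⟩
  have hm2 : MapsTo θ (Ioo p' r') (Ioo (θ p') (θ r')) := fun t ht =>
    ⟨hmono hp (hs (Ioo_subset_Icc_self ht)) ht.1, hmono (hs (Ioo_subset_Icc_self ht)) hr ht.2⟩
  refine (hT (θ p') (θ r') (Icc_subset_Icc (hmaps hp).1 (hmaps hr).2) ?_).comp (hθ.mono hs) hm1 hm2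
  refine Set.disjoint_left.2 fun y hy hyT => ?_
  obtain ⟨t, ht, rfl⟩ := intermediate_value_Icc hpr.le (hθ.continuousOn.mono hs)
    (Ioo_subset_Icc_self hy)
  have ht' : t ∈ Ioo p' r' := by
    refine ⟨lt_of_le_of_ne ht.1 ?_, lt_of_le_of_ne ht.2 ?_⟩
    · rintro rfl; exact lt_irrefl _ hy.1
    · rintro rfl; exact lt_irrefl _ hy.2
  exact Set.disjoint_left.1 hd ht' (by simpa using ⟨hs ht, hyT⟩)

end PrincipalConnection

end HorizontalCurves

/-! ### Existence and uniqueness of horizontal lifts -/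

/-- A relation between the end points of subintervals of `[a, b]` which is transitive and holds for
all short intervals starting or ending at a given point holds for `[a, b]`. -/
theorem interval_induction {a b : ℝ} (hab : a ≤ b) {R : ℝ → ℝ → Prop}
    (trans : ∀ u v w, a ≤ u → u ≤ v → v ≤ w → w ≤ b → R u v → R v w → R u w)
    (right : ∀ t ∈ Ico a b, ∃ δ > 0, ∀ v, t ≤ v → v ≤ t + δ → v ≤ b → R t v)
    (left : ∀ t ∈ Ioc a b, ∃ δ > 0, ∀ u, u ≤ t → t - δ ≤ u → a ≤ u → R u t)
    (refl : R a a) : R a b := by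
  set S := {t | t ∈ Icc a b ∧ R a t} with hS
  have haS : a ∈ S := ⟨left_mem_Icc.2 hab, refl⟩
  have hbdd : BddAbove S := ⟨b, fun t ht => ht.1.2⟩
  set m := sSup S with hm
  have ham : a ≤ m := le_csSup hbdd haS
  have hmb : m ≤ b := csSup_le ⟨a, haS⟩ fun t ht => ht.1.2
  have hmS : R a m := by
    rcases ham.eq_or_lt with h | h
    · rw [← h]; exact refl
    · obtain ⟨δ, hδ, hR⟩ := left m ⟨h, hmb⟩
      obtain ⟨t, ht, htm⟩ := exists_lt_of_lt_csSup ⟨a, haS⟩ (show m - δ < sSup S by linarith)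
      have htm' : t ≤ m := le_csSup hbdd ht
      exact trans a t m le_rfl ht.1.1 htm' hmb ht.2 (hR t htm' htm.le ht.1.1)
  rcases hmb.eq_or_lt with h | h
  · rw [← h]; exact hmS
  · obtain ⟨δ, hδ, hR⟩ := right m ⟨ham, h⟩
    have h1 : m < min (m + δ) b := lt_min (by linarith) h
    have h2 : min (m + δ) b ∈ S := ⟨⟨ham.trans h1.le, min_le_right _ _⟩,
      trans a m _ le_rfl ham h1.le (min_le_right _ _) hmS
        (hR _ h1.le (min_le_left _ _) (min_le_right _ _))⟩
    exact absurd (le_csSup hbdd h2) (not_le.2 h1)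

/-- Short intervals with end point `t` contain no break points in their interior. -/
theorem exists_pos_disjoint_Ioo (T : Finset ℝ) (t : ℝ) : ∃ δ > 0, ∀ s, |s - t| ≤ δ →
    Disjoint (Ioo t s) (T : Set ℝ) ∧ Disjoint (Ioo s t) (T : Set ℝ) := by
  have h : ((T : Set ℝ) \ {t})ᶜ ∈ 𝓝 t :=
    (T.finite_toSet.subset sdiff_subset).isClosed.isOpen_compl.mem_nhds (by simp)
  obtain ⟨δ, hδ, hsub⟩ := Metric.nhds_basis_closedBall.mem_iff.1 h
  refine ⟨δ, hδ, fun s hs => ⟨?_, ?_⟩⟩ <;>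
  · refine Set.disjoint_left.2 fun r hr hrT => hsub (?_ : r ∈ _) ⟨hrT, ?_⟩
    · have h1 := hr.1
      have h2 := hr.2
      rw [abs_le] at hs
      rw [Metric.mem_closedBall, Real.dist_eq, abs_le]
      constructor <;> linarith
    · rintro rfl
      first | exact lt_irrefl _ hr.1 | exact lt_irrefl _ hr.2

theorem ContDiffWithinAt.continuousWithinAt_derivWithin_Icc {F : Type*} [NormedAddCommGroup F]
    [NormedSpace ℝ F] {f : ℝ → F} {u v t : ℝ} (h : ContDiffWithinAt ℝ ∞ f (Icc u v) t)
    (huv : u < v) (ht : t ∈ Icc u v) :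
    ContinuousWithinAt (derivWithin f (Icc u v)) (Icc u v) t := by
  have h1 : ContDiffWithinAt ℝ 0 (fderivWithin ℝ f (Icc u v)) (Icc u v) t :=
    h.fderivWithin_right (uniqueDiffOn_Icc huv) (by simp) ht
  exact h1.continuousWithinAt.clm_apply continuousWithinAt_const

section Lifts

variable {E : Type*} [NormedAddCommGroup E] [NormedSpace ℝ E]
  {H : Type*} [TopologicalSpace H] {I : ModelWithCorners ℝ E H}
  {M : Type*} [TopologicalSpace M] [ChartedSpace H M] [IsManifold I ∞ M]
  {EG : Type*} [NormedAddCommGroup EG] [NormedSpace ℝ EG]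
  {HG : Type*} [TopologicalSpace HG] {IG : ModelWithCorners ℝ EG HG}
  {G : Type*} [Group G] [TopologicalSpace G] [ChartedSpace HG G]
  {EQ : Type*} [NormedAddCommGroup EQ] [NormedSpace ℝ EQ]
  {HQ : Type*} [TopologicalSpace HQ] {IQ : ModelWithCorners ℝ EQ HQ}
  {Q : Type*} [TopologicalSpace Q] [ChartedSpace HQ Q] [IsManifold IQ ∞ Q] [MulAction Gᵐᵒᵖ Q]
  {π : Q → M}

namespace PrincipalConnection

variable [FiniteDimensional ℝ E] [IQ.Boundaryless]
  {A : PrincipalConnection I G IQ π} {γ : ℝ → M} {c c' : ℝ → Q} {u v w : ℝ}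

/-- The velocity of a horizontal curve is horizontal also at the end points. -/
theorem HorizOn.mfderivWithin_mem (hπ : IsPrincipalBundle I IG G IQ π) (h : A.HorizOn c u v)
    (huv : u < v) {t : ℝ} (ht : t ∈ Icc u v) :
    mfderivWithin 𝓘(ℝ, ℝ) IQ c (Icc u v) t (1 : ℝ) ∈ A.horizontal (c t) := by
  obtain ⟨W, L, hL⟩ := A.exists_isLocalForm hπ (c t)
  have hpi := hπ.contMDiff_proj
  have hud : UniqueDiffOn ℝ (Icc u v) := uniqueDiffOn_Icc huv
  have hct := h.1 t ht
  set y := extChartAt IQ (c t) ∘ c with hy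
  set x := extChartAt I (π (c t)) ∘ π ∘ c with hx
  have hys : ContDiffWithinAt ℝ ∞ y (Icc u v) t :=
    ((contMDiffAt_extChartAt (I := IQ) (n := ∞) (x := c t)).comp_contMDiffWithinAt t hct).contDiffWithinAt
  have hxs : ContDiffWithinAt ℝ ∞ x (Icc u v) t :=
    ((contMDiffAt_extChartAt (I := I) (n := ∞) (x := π (c t))).comp_contMDiffWithinAt t
      (hpi.contMDiffAt.comp_contMDiffWithinAt t hct)).contDiffWithinAt
  have hN : ∀ᶠ s in 𝓝[Icc u v] t, c s ∈ (chartAt HQ (c t)).source ∧ y s ∈ W :=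
    (hct.continuousWithinAt.eventually ((chartAt HQ (c t)).open_source.mem_nhds
      (mem_chart_source _ _))).and (hys.continuousWithinAt.eventually (hL.isOpen.mem_nhds hL.mem))
  have hLt : ContinuousAt L (y t) := (hL.contDiffOn.continuousOn).continuousAt (hL.isOpen.mem_nhds hL.mem)
  have h1 := hys.continuousWithinAt_derivWithin_Icc huv ht
  have h2 : ContinuousWithinAt (fun s => L (y s) (derivWithin x (Icc u v) s)) (Icc u v) t :=
    (hLt.comp_continuousWithinAt hys.continuousWithinAt).clm_apply
      (hxs.continuousWithinAt_derivWithin_Icc huv ht)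
  have hne : (𝓝[Ioo u v] t).NeBot := by
    rw [← mem_closure_iff_nhdsWithin_neBot, closure_Ioo huv.ne]; exact ht
  have heq : ∀ᶠ s in 𝓝[Ioo u v] t, derivWithin y (Icc u v) s = L (y s) (derivWithin x (Icc u v) s) := by
    filter_upwards [nhdsWithin_mono t Ioo_subset_Icc_self hN, self_mem_nhdsWithin] with s hs hsI
    have hd := h.mdifferentiableAt hsI
    have hsI' := Ioo_subset_Icc_self hsI
    refine (hL.mem_iff_derivWithin hpi hd.mdifferentiableWithinAt (hud s hsI') hs.1 hs.2).1 ?_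
    rw [mfderivWithin_of_mem_nhds (Icc_mem_nhds hsI.1 hsI.2)]
    exact h.2 s hsI
  refine (hL.mem_iff_derivWithin hpi (hct.mdifferentiableWithinAt (by simp)) (hud t ht)
    (mem_chart_source _ _) hL.mem).2 ?_
  exact tendsto_nhds_unique_of_eventuallyEq (h1.mono Ioo_subset_Icc_self)
    (h2.mono Ioo_subset_Icc_self) heq

/-- A horizontal curve solves the equation `y' = L(y) x'` up to the end points. -/
theorem HorizOn.hasDerivWithinAt (hπ : IsPrincipalBundle I IG G IQ π) (h : A.HorizOn c u v)
    (huv : u < v) {q₀ : Q} {W : Set EQ} {L : EQ → E →L[ℝ] EQ}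
    (hL : IsLocalForm I IQ π (fun q => (A.horizontal q : Set (TangentSpace IQ q))) q₀ W L)
    {t : ℝ} (ht : t ∈ Icc u v) (hs : c t ∈ (chartAt HQ q₀).source)
    (hW : extChartAt IQ q₀ (c t) ∈ W) :
    HasDerivWithinAt (extChartAt IQ q₀ ∘ c) (L (extChartAt IQ q₀ (c t))
      (derivWithin (extChartAt I (π q₀) ∘ π ∘ c) (Icc u v) t)) (Icc u v) t := by
  have hd : MDifferentiableWithinAt 𝓘(ℝ, ℝ) IQ c (Icc u v) t :=
    (h.1 t ht).mdifferentiableWithinAt (by simp)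
  have hud := uniqueDiffOn_Icc huv t ht
  have h1 := hd.hasMFDerivWithinAt.hasDerivWithinAt_extChartAt hs
  rw [← h1.derivWithin hud] at h1
  rwa [(hL.mem_iff_derivWithin hπ.contMDiff_proj hd hud hs hW).1 (h.mfderivWithin_mem hπ huv ht)]
    at h1

/-- The set on which two lifts agree is closed, and by uniqueness for ordinary differential
equations it is also open to the right. -/
theorem LiftOn.eqOn_of_left [T2Space Q] (hπ : IsPrincipalBundle I IG G IQ π) (h : A.LiftOn γ c u v)
    (h' : A.LiftOn γ c' u v) (hu : c u = c' u) : EqOn c c' (Icc u v) := by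
  have hclosed : IsClosed ({t | c t = c' t} ∩ Icc u v) := by
    have := (h.1.prodMk h'.1).preimage_isClosed_of_isClosed isClosed_Icc isClosed_diagonal
    rw [inter_comm]
    exact this
  refine hclosed.Icc_subset_of_forall_exists_gt hu fun t ht s hs => ?_
  obtain ⟨⟨htc : c t = c' t, htI⟩, hs : t < s⟩ := And.intro ht hs
  obtain ⟨T, hT⟩ := h.2.2
  obtain ⟨T', hT'⟩ := h'.2.2
  obtain ⟨δ, hδ, hd⟩ := exists_pos_disjoint_Ioo T t
  obtain ⟨δ', hδ', hd'⟩ := exists_pos_disjoint_Ioo T' t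
  obtain ⟨W, L, hL⟩ := A.exists_isLocalForm hπ (c t)
  have hdom : (extChartAt IQ (c t)).source ∩ extChartAt IQ (c t) ⁻¹' W ∈ 𝓝 (c t) :=
    ((continuousOn_extChartAt (I := IQ) (c t)).isOpen_inter_preimage (isOpen_extChartAt_source _)
      hL.isOpen).mem_nhds ⟨mem_extChartAt_source _, hL.mem⟩
  have htv : t < v := htI.2
  have hev : ∀ᶠ r in 𝓝[≥] t, c r ∈ (extChartAt IQ (c t)).source ∩ extChartAt IQ (c t) ⁻¹' W ∧
      c' r ∈ (extChartAt IQ (c t)).source ∩ extChartAt IQ (c t) ⁻¹' W := by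
    have hn : 𝓝[≥] t ≤ 𝓝[Icc u v] t := nhdsWithin_le_of_mem
      (Icc_mem_nhdsGE_of_mem htI)
    exact (((h.1 t (Ico_subset_Icc_self htI)).mono_left hn).eventually hdom).and
      (((h'.1 t (Ico_subset_Icc_self htI)).mono_left hn).eventually (by rw [← htc]; exact hdom))
  obtain ⟨w₀, hw₀, hw₀'⟩ := (mem_nhdsGE_iff_exists_mem_Ioc_Ico_subset
    (lt_min htv (lt_min hs (lt_min (by linarith : t < t + δ) (by linarith : t < t + δ'))))).1 hev
  obtain ⟨w, htw, hww⟩ := exists_between hw₀.1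
  have hwle := hww.le.trans hw₀.2
  simp only [le_min_iff] at hwle
  have hsub : Icc t w ⊆ Icc u v := Icc_subset_Icc htI.1 hwle.1
  have habs : ∀ r, w ≤ t + r → |w - t| ≤ r := fun r hr => by
    rw [abs_of_pos (by linarith)]; linarith
  have H := hT t w hsub (hd w (habs _ hwle.2.2.1)).1
  have H' := hT' t w hsub (hd' w (habs _ hwle.2.2.2)).1
  have hmem : ∀ r ∈ Icc t w, c r ∈ (extChartAt IQ (c t)).source ∩ extChartAt IQ (c t) ⁻¹' W ∧
      c' r ∈ (extChartAt IQ (c t)).source ∩ extChartAt IQ (c t) ⁻¹' W := fun r hr =>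
    hw₀' ⟨hr.1, hr.2.trans_lt hww⟩
  set ξ := derivWithin (extChartAt I (π (c t)) ∘ γ) (Icc t w) with hξ
  have hproj : ∀ b : ℝ → Q, (∀ r ∈ Icc u v, π (b r) = γ r) → ∀ r ∈ Icc t w,
      derivWithin (extChartAt I (π (c t)) ∘ π ∘ b) (Icc t w) r = ξ r := by
    intro b hb r hr
    exact derivWithin_congr (fun s hs => congrArg (extChartAt I (π (c t))) (hb s (hsub hs)))
      (congrArg (extChartAt I (π (c t))) (hb r (hsub hr)))
  have hγ : ContDiffOn ℝ ∞ (extChartAt I (π (c t)) ∘ γ) (Icc t w) := by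
    have h1 := contMDiffOn_extChartAt_comp (I := I) (x₀ := π (c t)) le_rfl
      (hπ.contMDiff_proj.comp_contMDiffOn H.1) (fun r hr => by
        have h2 := hL.proj_mem _ (hmem r hr).1.2
        rwa [(extChartAt IQ (c t)).left_inv (hmem r hr).1.1] at h2)
    exact h1.congr fun r hr => congrArg (extChartAt I (π (c t))) (h.2.1 r (hsub hr)).symm
  have hξc : ContinuousOn ξ (Icc t w) := fun r hr =>
    (hγ r hr).continuousWithinAt_derivWithin_Icc htw hr
  have hder : ∀ b : ℝ → Q, A.HorizOn b t w → (∀ r ∈ Icc u v, π (b r) = γ r) →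
      (∀ r ∈ Icc t w, b r ∈ (extChartAt IQ (c t)).source ∩ extChartAt IQ (c t) ⁻¹' W) →
      ∀ r ∈ Icc t w, HasDerivWithinAt (extChartAt IQ (c t) ∘ b)
        (L ((extChartAt IQ (c t) ∘ b) r) (ξ r)) (Icc t w) r := by
    intro b hb hb' hbm r hr
    rw [← hproj b hb' r hr]
    exact hb.hasDerivWithinAt hπ htw hL hr (by rw [← extChartAt_source IQ]; exact (hbm r hr).1)
      (hbm r hr).2
  obtain ⟨w', hw', heq⟩ := solution_unique_right hL.isOpen hL.contDiffOn hξc htw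
    (hder c H h.2.1 fun r hr => (hmem r hr).1) (hder c' H' h'.2.1 fun r hr => (hmem r hr).2)
    (congrArg (extChartAt IQ (c t)) htc) hL.mem
  have hw'I : w' ∈ Icc t w := Ioc_subset_Icc_self hw'
  refine ⟨w', (extChartAt IQ (c t)).injOn (hmem w' hw'I).1.1 (hmem w' hw'I).2.1
    (heq (right_mem_Icc.2 hw'.1.le)), hw'.1, hw'.2.trans hwle.2.1⟩

/-- Horizontal lifts of the same curve which agree at one point are equal. -/
theorem LiftOn.eqOn [T2Space Q] (hπ : IsPrincipalBundle I IG G IQ π) (h : A.LiftOn γ c u v)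
    (h' : A.LiftOn γ c' u v) {t : ℝ} (ht : t ∈ Icc u v) (hct : c t = c' t) :
    EqOn c c' (Icc u v) := by
  have huv := ht.1.trans ht.2
  have hu := left_mem_Icc.2 huv
  obtain ⟨g, hg⟩ := hπ.exists_smul_eq ((h.2.1 u hu).trans (h'.2.1 u hu).symm)
  have heq := (h.smul hπ g).eqOn_of_left hπ h' hg.symm
  have h1 : op g • c t = c t := (heq ht).trans hct.symm
  rw [hπ.eq_one_of_smul_eq h1] at heq
  intro s hs
  simpa using heq hs

/-- Solutions of `y' = L(y) x'` in a chart are horizontal lifts: as `L` lifts tangent vectors, the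
projection of `y` has the same velocity as `x`. -/
theorem horizOn_of_solution [FiniteDimensional ℝ EQ] (hπ : IsPrincipalBundle I IG G IQ π)
    {A : PrincipalConnection I G IQ π}
    {q₀ : Q} {W : Set EQ} {L : EQ → E →L[ℝ] EQ}
    (hL : IsLocalForm I IQ π (fun q => (A.horizontal q : Set (TangentSpace IQ q))) q₀ W L)
    (huv : u < v) (hγ : ContMDiffOn 𝓘(ℝ, ℝ) I ∞ γ (Icc u v))
    (hchart : MapsTo γ (Icc u v) (chartAt H (π q₀)).source) {y : ℝ → EQ}
    (hyW : ∀ t ∈ Icc u v, y t ∈ W)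
    (hy : ∀ t ∈ Icc u v, HasDerivWithinAt y
      (L (y t) (derivWithin (extChartAt I (π q₀) ∘ γ) (Icc u v) t)) (Icc u v) t)
    {t₀ : ℝ} (ht₀ : t₀ ∈ Icc u v) (h0 : projInCharts I IQ π q₀ (y t₀) = extChartAt I (π q₀) (γ t₀)) :
    A.HorizOn (fun t => (extChartAt IQ q₀).symm (y t)) u v ∧
      ∀ t ∈ Icc u v, π ((extChartAt IQ q₀).symm (y t)) = γ t := by
  have : CompleteSpace EQ := FiniteDimensional.complete ℝ EQ
  have hpi := hπ.contMDiff_proj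
  set x := extChartAt I (π q₀) ∘ γ with hx
  have hud := uniqueDiffOn_Icc huv
  have hxs : ContDiffOn ℝ ∞ x (Icc u v) := contMDiffOn_extChartAt_comp le_rfl hγ hchart
  set ξ := derivWithin x (Icc u v) with hξ
  have hξs : ContDiffOn ℝ ∞ ξ (Icc u v) := hxs.derivWithin hud (by simp)
  have hys : ContDiffOn ℝ ∞ y (Icc u v) := by
    refine ODE.contDiffOn_enat_Icc_of_hasDerivWithinAt (n := ⊤) (f := fun t y => L y (ξ t)) (u := W) ?_
      hy hyW
    exact (hL.contDiffOn.comp contDiffOn_snd fun z hz => hz.2).clm_apply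
      (hξs.comp contDiffOn_fst fun z hz => hz.1)
  have htgt : MapsTo y (Icc u v) (extChartAt IQ q₀).target := fun t ht => hL.subset (hyW t ht)
  set c := fun t => (extChartAt IQ q₀).symm (y t) with hc
  have hcs : ContMDiffOn 𝓘(ℝ, ℝ) IQ ∞ c (Icc u v) := contMDiffOn_extChartAt_symm_comp hys htgt
  have hcsrc : ∀ t ∈ Icc u v, c t ∈ (chartAt HQ q₀).source := fun t ht => by
    rw [← extChartAt_source IQ]; exact (extChartAt IQ q₀).map_target (htgt ht)
  have hφc : ∀ t ∈ Icc u v, extChartAt IQ q₀ (c t) = y t := fun t ht =>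
    (extChartAt IQ q₀).right_inv (htgt ht)
  have hproj : ∀ t ∈ Icc u v, projInCharts I IQ π q₀ (y t) = x t := by
    have hd : ∀ t ∈ Icc u v, HasDerivWithinAt (fun t => projInCharts I IQ π q₀ (y t) - x t) 0
        (Icc u v) t := by
      intro t ht
      have h1 : DifferentiableAt ℝ (projInCharts I IQ π q₀) (y t) :=
        ((contDiffOn_projInCharts hpi q₀ univ).contDiffAt
          ((isOpen_chartDomain hpi.continuous q₀ isOpen_univ).mem_nhds
            ⟨htgt ht, trivial, hL.proj_mem _ (hyW t ht)⟩)).differentiableAt (by simp)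
      have h2 := h1.hasFDerivAt.comp_hasDerivWithinAt t (hy t ht)
      rw [hL.proj_lift _ (hyW t ht)] at h2
      have h3 : HasDerivWithinAt x (ξ t) (Icc u v) t :=
        ((hxs t ht).differentiableWithinAt (by simp)).hasDerivWithinAt
      exact (h2.sub h3).congr_deriv (sub_self _)
    intro t ht
    have hconst : ∀ t ∈ Icc u v, projInCharts I IQ π q₀ (y t) - x t =
        projInCharts I IQ π q₀ (y u) - x u :=
      constant_of_derivWithin_zero (fun t ht => (hd t ht).differentiableWithinAt)
        fun t ht => (hd t (Ico_subset_Icc_self ht)).derivWithin (hud t (Ico_subset_Icc_self ht))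
    exact sub_eq_zero.1 (((hconst t ht).trans (hconst t₀ ht₀).symm).trans (sub_eq_zero.2 h0))
  have hcover : ∀ t ∈ Icc u v, π (c t) = γ t := by
    intro t ht
    refine (extChartAt I (π q₀)).injOn ?_ ?_ (hproj t ht)
    · rw [extChartAt_source]; exact hL.proj_mem _ (hyW t ht)
    · rw [extChartAt_source]; exact hchart ht
  refine ⟨⟨hcs, fun t ht => ?_⟩, hcover⟩
  have htI := Ioo_subset_Icc_self ht
  rw [← mfderivWithin_of_mem_nhds (Icc_mem_nhds ht.1 ht.2)]
  have hcd : MDifferentiableWithinAt 𝓘(ℝ, ℝ) IQ c (Icc u v) t :=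
    (hcs t htI).mdifferentiableWithinAt (by simp)
  refine (hL.mem_iff_derivWithin hpi hcd (hud t htI) (hcsrc t htI)
    (by rw [hφc t htI]; exact hyW t htI)).2 ?_
  have hyt : derivWithin (extChartAt IQ q₀ ∘ c) (Icc u v) t = L (y t) (ξ t) :=
    (derivWithin_congr hφc (hφc t htI)).trans ((hy t htI).derivWithin (hud t htI))
  have hxt : derivWithin (extChartAt I (π q₀) ∘ π ∘ c) (Icc u v) t = ξ t :=
    derivWithin_congr (fun s hs => congrArg (extChartAt I (π q₀)) (hcover s hs))
      (congrArg (extChartAt I (π q₀)) (hcover t htI))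
  rw [hφc t htI, hyt, hxt]

/-- Local existence of horizontal lifts, on a neighbourhood of `t₀` in `[u, v]`. -/
theorem exists_horizOn_near (hπ : IsPrincipalBundle I IG G IQ π) [FiniteDimensional ℝ EQ]
    (A : PrincipalConnection I G IQ π)
    (hγ : ContMDiffOn 𝓘(ℝ, ℝ) I ∞ γ (Icc u v)) (huv : u < v) {t₀ : ℝ} (ht₀ : t₀ ∈ Icc u v)
    {q₀ : Q} (hq₀ : π q₀ = γ t₀) : ∃ ε > 0, ∃ c : ℝ → Q, c t₀ = q₀ ∧
      A.HorizOn c (max u (t₀ - ε)) (min v (t₀ + ε)) ∧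
      ∀ t ∈ Icc (max u (t₀ - ε)) (min v (t₀ + ε)), π (c t) = γ t := by
  have : CompleteSpace EQ := FiniteDimensional.complete ℝ EQ
  obtain ⟨W, L, hL⟩ := A.exists_isLocalForm hπ q₀
  have hpi := hπ.contMDiff_proj
  -- shrink the interval so that `γ` stays in the chart at `π q₀`
  have hev : ∀ᶠ t in 𝓝[Icc u v] t₀, γ t ∈ (chartAt H (π q₀)).source :=
    (hγ t₀ ht₀).continuousWithinAt.eventually
      ((chartAt H (π q₀)).open_source.mem_nhds (by rw [← hq₀]; exact mem_chart_source _ _))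
  rw [eventually_nhdsWithin_iff] at hev
  obtain ⟨η, hη, hηs⟩ := Metric.nhds_basis_closedBall.mem_iff.1 hev
  set u' := max u (t₀ - η) with hu'
  set v' := min v (t₀ + η) with hv'
  have hsub : Icc u' v' ⊆ Icc u v := Icc_subset_Icc (le_max_left _ _) (min_le_left _ _)
  have hu'v' : u' < v' := by
    rw [hu', hv', max_lt_iff, lt_min_iff, lt_min_iff]
    exact ⟨⟨huv, by linarith [ht₀.1]⟩, by linarith [ht₀.2], by linarith⟩
  have ht₀' : t₀ ∈ Icc u' v' := ⟨max_le ht₀.1 (by linarith), le_min ht₀.2 (by linarith)⟩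
  have hchart : MapsTo γ (Icc u' v') (chartAt H (π q₀)).source := fun t ht => by
    refine hηs ?_ (hsub ht)
    have h1 := (le_max_right _ _).trans ht.1
    have h2 := ht.2.trans (min_le_right _ _)
    rw [Metric.mem_closedBall, Real.dist_eq, abs_le]
    constructor <;> linarith
  set x := extChartAt I (π q₀) ∘ γ with hx
  have hxs : ContDiffOn ℝ ∞ x (Icc u' v') :=
    contMDiffOn_extChartAt_comp le_rfl (hγ.mono hsub) hchart
  set ξ := derivWithin x (Icc u' v') with hξ
  have hξc : ContinuousOn ξ (Icc u' v') := fun t ht =>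
    (hxs t ht).continuousWithinAt_derivWithin_Icc hu'v' ht
  obtain ⟨ε, hε, y, hy0, hy⟩ := exists_solution_near hL.isOpen hL.contDiffOn hξc ht₀' hL.mem
  set p := max u' (t₀ - ε) with hp
  set r := min v' (t₀ + ε) with hr
  have hpr : p < r := by
    exact max_lt (lt_min hu'v' (by linarith [ht₀'.1])) (lt_min (by linarith [ht₀'.2]) (by linarith))
  have hsub' : Icc p r ⊆ Icc u' v' := Icc_subset_Icc (le_max_left _ _) (min_le_left _ _)
  have ht₀p : t₀ ∈ Icc p r := ⟨max_le ht₀'.1 (by linarith), le_min ht₀'.2 (by linarith)⟩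
  have hder : ∀ t ∈ Icc p r, derivWithin x (Icc p r) t = ξ t := fun t ht =>
    (((hxs t (hsub' ht)).differentiableWithinAt (by simp)).hasDerivWithinAt.mono hsub').derivWithin
      (uniqueDiffOn_Icc hpr t ht)
  obtain ⟨hH, hcover⟩ := horizOn_of_solution hπ hL hpr (hγ.mono (hsub'.trans hsub))
    (hchart.mono_left hsub') (fun t ht => (hy t ht).1)
    (fun t ht => by
      rw [← hx, hder t ht]
      exact (hy t ht).2) ht₀p (by rw [hy0, projInCharts, extChartAt_to_inv, hq₀])
  have hfin : Icc (max u (t₀ - min η ε)) (min v (t₀ + min η ε)) ⊆ Icc p r := by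
    refine Icc_subset_Icc ?_ ?_
    · rw [hp, hu', max_le_iff, max_le_iff]
      exact ⟨⟨le_max_left _ _, (by linarith [min_le_left η ε] : t₀ - η ≤ t₀ - min η ε).trans
        (le_max_right _ _)⟩, (by linarith [min_le_right η ε] : t₀ - ε ≤ t₀ - min η ε).trans
        (le_max_right _ _)⟩
    · rw [hr, hv', le_min_iff, le_min_iff]
      exact ⟨⟨min_le_left _ _, (min_le_right _ _).trans
        (by linarith [min_le_left η ε] : t₀ + min η ε ≤ t₀ + η)⟩, (min_le_right _ _).trans
        (by linarith [min_le_right η ε] : t₀ + min η ε ≤ t₀ + ε)⟩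
  refine ⟨min η ε, lt_min hη hε, _, ?_, hH.mono hfin, fun t ht => hcover t (hfin ht)⟩
  rw [hy0, extChartAt_to_inv]

/-- Piecewise smooth curves have horizontal lifts with given initial value. -/
theorem exists_liftOn (hπ : IsPrincipalBundle I IG G IQ π) [FiniteDimensional ℝ EQ]
    (A : PrincipalConnection I G IQ π) (huv : u ≤ v) {T : Finset ℝ}
    (hγ : ∀ p r, Icc p r ⊆ Icc u v → Disjoint (Ioo p r) (T : Set ℝ) →
      ContMDiffOn 𝓘(ℝ, ℝ) I ∞ γ (Icc p r)) {q : Q} (hq : π q = γ u) :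
    ∃ c : ℝ → Q, A.LiftOn γ c u v ∧ c u = q := by
  refine interval_induction (R := fun p r => ∀ q, π q = γ p → ∃ c : ℝ → Q, A.LiftOn γ c p r ∧ c p = q)
    huv ?_ ?_ ?_ ?_ q hq
  · intro p r s hp hpr hrs hs h1 h2 q hq
    obtain ⟨c, hc, hcp⟩ := h1 q hq
    obtain ⟨c', hc', hcr⟩ := h2 (c r) (hc.2.1 r (right_mem_Icc.2 hpr))
    exact ⟨_, hc.trans hc' hcr.symm hpr hrs, (if_pos hpr).trans hcp⟩
  · intro t ht
    obtain ⟨δ, hδ, hd⟩ := exists_pos_disjoint_Ioo T t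
    have hlt : t < min v (t + δ) := lt_min ht.2 (by linarith)
    obtain ⟨q₁, hq₁⟩ := hπ.surjective (γ t)
    obtain ⟨ε, hε, c, hct, hc, hcov⟩ := exists_horizOn_near hπ A
      (hγ t _ (Icc_subset_Icc ht.1 (min_le_left _ _)) (hd _ (by
        rw [abs_of_pos (by linarith)]; linarith [min_le_right v (t + δ)])).1) hlt
      (left_mem_Icc.2 hlt.le) hq₁
    refine ⟨min δ ε, lt_min hδ hε, fun s hts hs hsv q hq => ?_⟩
    have hsub : Icc t s ⊆ Icc (max t (t - ε)) (min (min v (t + δ)) (t + ε)) :=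
      Icc_subset_Icc (max_le le_rfl (by linarith)) (le_min (le_min hsv
        (by linarith [min_le_left δ ε])) (by linarith [min_le_right δ ε]))
    obtain ⟨g, hg⟩ := hπ.exists_smul_eq (hq₁.trans hq.symm)
    exact ⟨_, (LiftOn.of_horizOn (hc.mono hsub) fun t ht => hcov t (hsub ht)).smul hπ g,
      by rw [hct, ← hg]⟩
  · intro t ht
    obtain ⟨δ, hδ, hd⟩ := exists_pos_disjoint_Ioo T t
    have hlt : max u (t - δ) < t := max_lt ht.1 (by linarith)
    obtain ⟨q₁, hq₁⟩ := hπ.surjective (γ t)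
    obtain ⟨ε, hε, c, hct, hc, hcov⟩ := exists_horizOn_near hπ A
      (hγ _ t (Icc_subset_Icc (le_max_left _ _) ht.2) (hd _ (by
        rw [abs_of_neg (by linarith)]; linarith [le_max_right u (t - δ)])).2) hlt
      (right_mem_Icc.2 hlt.le) hq₁
    refine ⟨min δ ε, lt_min hδ hε, fun s hts hs hsu q hq => ?_⟩
    have hsub : Icc s t ⊆ Icc (max (max u (t - δ)) (t - ε)) (min t (t + ε)) :=
      Icc_subset_Icc (max_le (max_le hsu (by linarith [min_le_left δ ε]))
        (by linarith [min_le_right δ ε])) (le_min le_rfl (by linarith))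
    obtain ⟨g, hg⟩ := hπ.exists_smul_eq ((hcov s (hsub (left_mem_Icc.2 hts))).trans hq.symm)
    exact ⟨_, (LiftOn.of_horizOn (hc.mono hsub) fun t ht => hcov t (hsub ht)).smul hπ g, hg.symm⟩
  · intro q hq
    exact ⟨fun _ => q, LiftOn.of_horizOn (horizOn_of_le A _ le_rfl) fun t ht => by
      rw [hq, le_antisymm ht.2 ht.1], rfl⟩

end PrincipalConnection

end Lifts

/-! ### Smooth dependence of horizontal lifts on parameters -/

/-- A smooth map on an open set agrees near any given point with an everywhere smooth map. -/
theorem exists_contDiff_eventuallyEq {X Y : Type*} [NormedAddCommGroup X] [NormedSpace ℝ X]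
    [FiniteDimensional ℝ X] [NormedAddCommGroup Y] [NormedSpace ℝ Y] {f : X → Y} {O : Set X}
    (hO : IsOpen O) (hf : ContDiffOn ℝ ∞ f O) {z : X} (hz : z ∈ O) :
    ∃ g : X → Y, ContDiff ℝ ∞ g ∧ g =ᶠ[𝓝 z] f := by
  obtain ⟨r, hr, hsub⟩ := Metric.nhds_basis_closedBall.mem_iff.1 (hO.mem_nhds hz)
  let χ : ContDiffBump z := ⟨r / 2, r, by linarith, by linarith⟩
  refine ⟨fun x => χ x • f x, contDiff_iff_contDiffAt.2 fun x => ?_, ?_⟩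
  · by_cases hx : x ∈ Metric.closedBall z r
    · exact χ.contDiff.contDiffAt.smul (hf.contDiffAt (hO.mem_nhds (hsub hx)))
    · refine (contDiffAt_const (c := (0 : Y))).congr_of_eventuallyEq ?_
      filter_upwards [Metric.isClosed_closedBall.isOpen_compl.mem_nhds hx] with y hy
      rw [χ.zero_of_le_dist (le_of_lt (not_le.1 hy)), zero_smul]
  · filter_upwards [χ.eventuallyEq_one] with x hx
    rw [hx, Pi.one_apply, one_smul]

section Dependence

variable {E : Type*} [NormedAddCommGroup E] [NormedSpace ℝ E]
  {H : Type*} [TopologicalSpace H] {I : ModelWithCorners ℝ E H}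
  {M : Type*} [TopologicalSpace M] [ChartedSpace H M] [IsManifold I ∞ M]
  {EG : Type*} [NormedAddCommGroup EG] [NormedSpace ℝ EG]
  {HG : Type*} [TopologicalSpace HG] {IG : ModelWithCorners ℝ EG HG}
  {G : Type*} [Group G] [TopologicalSpace G] [ChartedSpace HG G]
  {EQ : Type*} [NormedAddCommGroup EQ] [NormedSpace ℝ EQ]
  {HQ : Type*} [TopologicalSpace HQ] {IQ : ModelWithCorners ℝ EQ HQ}
  {Q : Type*} [TopologicalSpace Q] [ChartedSpace HQ Q] [IsManifold IQ ∞ Q] [MulAction Gᵐᵒᵖ Q]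
  {π : Q → M}
  {ES : Type*} [NormedAddCommGroup ES] [NormedSpace ℝ ES] [FiniteDimensional ℝ ES]
  {HS : Type*} [TopologicalSpace HS] {J : ModelWithCorners ℝ ES HS} [J.Boundaryless]
  {S : Type*} [TopologicalSpace S] [ChartedSpace HS S] [IsManifold J ∞ S]

namespace PrincipalConnection

variable [FiniteDimensional ℝ E] [FiniteDimensional ℝ EQ] [IQ.Boundaryless] [T2Space Q]
  {A : PrincipalConnection I G IQ π}

/-- A curve of the product of a parameter space, the time axis and a chart follows the field
`(0, 1, L(y) ∂ₜx)` exactly when the parameter is fixed, time runs at unit speed and the last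
component solves the lifting equation; here this is read off a solution with rescaled time. -/
theorem components_of_solution {F : Type*} [NormedAddCommGroup F] [NormedSpace ℝ F]
    {V : ES × ℝ → F → F} {l : ℝ} {Z : ℝ → (ES × ℝ) × F}
    (hZ : ∀ t ∈ Icc (0 : ℝ) 1, HasDerivWithinAt Z
      (l • (((0 : ES), (1 : ℝ)), V (Z t).1 (Z t).2)) (Icc 0 1) t) :
    (∀ t ∈ Icc (0 : ℝ) 1, (Z t).1 = ((Z 0).1.1, (Z 0).1.2 + l * t)) ∧
      ∀ t ∈ Icc (0 : ℝ) 1, HasDerivWithinAt (fun t => (Z t).2) (l • V (Z t).1 (Z t).2) (Icc 0 1) t := by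
  have h1 : ∀ t ∈ Icc (0 : ℝ) 1, HasDerivWithinAt (fun t => (Z t).1) (l • ((0 : ES), (1 : ℝ)))
      (Icc 0 1) t := fun t ht =>
    (hasFDerivAt_fst (𝕜 := ℝ) (p := Z t)).comp_hasDerivWithinAt t (hZ t ht)
  refine ⟨fun t ht => ?_, fun t ht =>
    (hasFDerivAt_snd (𝕜 := ℝ) (p := Z t)).comp_hasDerivWithinAt t (hZ t ht)⟩
  have hd : ∀ t ∈ Icc (0 : ℝ) 1, HasDerivWithinAt
      (fun t => (Z t).1 - t • (l • ((0 : ES), (1 : ℝ)))) 0 (Icc 0 1) t := fun t ht =>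
    ((h1 t ht).sub ((hasDerivWithinAt_id t _).smul_const _)).congr_deriv (by simp)
  have hc := constant_of_derivWithin_zero (fun t ht => (hd t ht).differentiableWithinAt)
    (fun t ht => (hd t (Ico_subset_Icc_self ht)).derivWithin
      (uniqueDiffOn_Icc zero_lt_one t (Ico_subset_Icc_self ht))) t ht
  simp only [zero_smul, sub_zero] at hc
  rw [sub_eq_iff_eq_add] at hc
  rw [hc]
  ext <;> simp [mul_comm]

/-- Smooth dependence on short intervals, for families which are smooth on an open interval of
times. In charts, the lifts are integral curves of the field `(0, 1, L(y) ∂ₜx)`; by equivariance, it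
suffices to consider lifts which start near a reference point over `Γ s₀ 0`. -/
theorem exists_smooth_dependence_near (hπ : IsPrincipalBundle I IG G IQ π) {Γ : S → ℝ → M} {ρ : ℝ}
    (hρ : 0 < ρ) (hΓ : ContMDiffOn (J.prod 𝓘(ℝ, ℝ)) I ∞ (fun p : S × ℝ => Γ p.1 p.2)
      (univ ×ˢ Ioo (-ρ) ρ)) (s₀ : S) :
    ∃ ε > 0, ∀ τ₁ τ₂ : ℝ, -ε < τ₁ → τ₁ ≤ τ₂ → τ₂ < ε → ∀ c : S → ℝ → Q,
      (∀ s, A.LiftOn (Γ s) (c s) τ₁ τ₂) → ContMDiffAt J IQ ∞ (fun s => c s τ₁) s₀ →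
        ContMDiffAt J IQ ∞ (fun s => c s τ₂) s₀ := by
  have : CompleteSpace EQ := FiniteDimensional.complete ℝ EQ
  have : CompleteSpace ES := FiniteDimensional.complete ℝ ES
  have h0ρ : (0 : ℝ) ∈ Ioo (-ρ) ρ := ⟨by linarith, hρ⟩
  obtain ⟨q₀, hq₀⟩ := hπ.surjective (Γ s₀ 0)
  obtain ⟨W, L, hL⟩ := A.exists_isLocalForm hπ q₀
  -- the family in charts
  set κ := extChartAt J s₀ with hκ
  set φ := extChartAt IQ q₀ with hφ
  set ψ := extChartAt I (π q₀) with hψ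
  have hfam : ContMDiffOn (𝓘(ℝ, ES × ℝ)) I ∞ (fun p : ES × ℝ => Γ (κ.symm p.1) p.2)
      (κ.target ×ˢ Ioo (-ρ) ρ) := by
    have h1 : ContMDiffOn 𝓘(ℝ, ES × ℝ) (J.prod 𝓘(ℝ, ℝ)) ∞ (fun p : ES × ℝ => (κ.symm p.1, p.2))
        (κ.target ×ˢ Ioo (-ρ) ρ) :=
      ((contMDiffOn_extChartAt_symm (I := J) (n := ∞) s₀).comp
        contDiff_fst.contMDiff.contMDiffOn fun p hp => hp.1).prodMk
        contDiff_snd.contMDiff.contMDiffOn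
    exact hΓ.comp h1 fun p hp => ⟨trivial, hp.2⟩
  set x : ES × ℝ → E := fun p => ψ (Γ (κ.symm p.1) p.2) with hx
  set O₁ : Set (ES × ℝ) := (κ.target ×ˢ Ioo (-ρ) ρ) ∩
    (fun p : ES × ℝ => Γ (κ.symm p.1) p.2) ⁻¹' (chartAt H (π q₀)).source with hO₁
  have hO₁o : IsOpen O₁ := hfam.continuousOn.isOpen_inter_preimage
    ((isOpen_extChartAt_target s₀).prod isOpen_Ioo) (chartAt H (π q₀)).open_source
  have hp₀ : (κ s₀, (0 : ℝ)) ∈ O₁ := by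
    refine ⟨⟨mem_extChartAt_target s₀, h0ρ⟩, ?_⟩
    simp only [mem_preimage, hκ, extChartAt_to_inv, ← hq₀]
    exact mem_chart_source _ _
  have hxs : ContDiffOn ℝ ∞ x O₁ := by
    rw [← contMDiffOn_iff_contDiffOn]
    exact (contMDiffOn_extChartAt (I := I) (n := ∞) (x := π q₀)).comp (hfam.mono inter_subset_left)
      fun p hp => hp.2
  set V : ES × ℝ → EQ → EQ := fun p y => L y (fderiv ℝ x p (0, 1)) with hV
  have hVs : ContDiffOn ℝ ∞ (fun z : (ES × ℝ) × EQ => (((0 : ES), (1 : ℝ)), V z.1 z.2))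
      (O₁ ×ˢ W) := by
    refine contDiffOn_const.prodMk ?_
    refine (hL.contDiffOn.comp contDiffOn_snd fun z hz => hz.2).clm_apply ?_
    exact (((hxs.fderiv_of_isOpen hO₁o (m := ∞) (by simp)).comp contDiffOn_fst
      fun z hz => hz.1)).clm_apply contDiffOn_const
  set z₀ : (ES × ℝ) × EQ := ((κ s₀, 0), φ q₀) with hz₀
  have hz₀O : z₀ ∈ O₁ ×ˢ W := ⟨hp₀, hL.mem⟩
  obtain ⟨f, hf, hfe⟩ := exists_contDiff_eventuallyEq (hO₁o.prod hL.isOpen) hVs hz₀O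
  obtain ⟨ε₁, hε₁, Ψ, hΨ, hΨs⟩ := exists_smooth_flow hf z₀
    (Filter.inter_mem hfe ((hO₁o.prod hL.isOpen).mem_nhds hz₀O))
  -- a reference point over `Γ s₀ τ` near `q₀`
  obtain ⟨U, σ, hU, hqU, hσ, hσq, hπσ⟩ := hπ.exists_local_section q₀
  have hΓc : ContinuousAt (fun τ => Γ s₀ τ) 0 := by
    have h1 : ContMDiffAt (J.prod 𝓘(ℝ, ℝ)) I ∞ (fun p : S × ℝ => Γ p.1 p.2) (s₀, 0) :=
      hΓ.contMDiffAt (by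
        rw [mem_nhds_prod_iff]
        exact ⟨univ, Filter.univ_mem, Ioo (-ρ) ρ, Ioo_mem_nhds h0ρ.1 h0ρ.2, subset_rfl⟩)
    exact h1.continuousAt.comp (f := fun τ : ℝ => (s₀, τ)) (by fun_prop)
  have hσc : ContinuousAt (fun τ => σ (Γ s₀ τ)) 0 := by
    have h1 : ContinuousAt σ (Γ s₀ 0) := by
      rw [← hq₀]; exact (hσ.continuousOn).continuousAt (hU.mem_nhds hqU)
    exact h1.comp (f := fun τ => Γ s₀ τ) hΓc
  have hσ0 : σ (Γ s₀ 0) = q₀ := by rw [← hq₀, hσq]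
  have hφc : ContinuousAt φ q₀ := continuousAt_extChartAt q₀
  have hev : ∀ᶠ τ in 𝓝 (0 : ℝ), Γ s₀ τ ∈ U ∧ σ (Γ s₀ τ) ∈ (chartAt HQ q₀).source ∧
      dist ((κ s₀, τ), φ (σ (Γ s₀ τ))) z₀ < ε₁ := by
    refine (hΓc.eventually (hU.mem_nhds (by dsimp only; rw [← hq₀]; exact hqU))).and ((hσc.eventually
      ((chartAt HQ q₀).open_source.mem_nhds (by
        dsimp only; rw [hσ0]; exact mem_chart_source _ _))).and ?_)
    have h1 : ContinuousAt (fun τ : ℝ => ((κ s₀, τ), φ (σ (Γ s₀ τ)))) 0 :=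
      (continuousAt_const.prodMk continuousAt_id).prodMk
        (ContinuousAt.comp (g := φ) (by rw [hσ0]; exact hφc) hσc)
    refine h1.eventually (p := fun z => dist z z₀ < ε₁) ?_
    dsimp only
    rw [hσ0]
    exact Metric.ball_mem_nhds z₀ hε₁
  obtain ⟨ε₂, hε₂, hball⟩ := Metric.eventually_nhds_iff.1 hev
  set ε := min ε₂ (ε₁ / 2) with hε
  have hεle₁ : ε ≤ ε₁ / 2 := min_le_right _ _
  have hεle₂ : ε ≤ ε₂ := min_le_left _ _
  refine ⟨ε, lt_min hε₂ (by linarith), fun τ₁ τ₂ hτ₁ hτ hτ₂ c hc hcs => ?_⟩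
  rcases hτ.eq_or_lt with rfl | hlt
  · exact hcs
  obtain ⟨hτU, hτsrc, hτd⟩ := hball (show dist τ₁ 0 < ε₂ by
    rw [Real.dist_eq, sub_zero, abs_lt]; constructor <;> linarith)
  -- translate the lifts so that the one over `s₀` starts at the reference point
  obtain ⟨g, hg⟩ := hπ.exists_smul_eq (q := c s₀ τ₁) (q' := σ (Γ s₀ τ₁))
    (by rw [hπσ _ hτU, (hc s₀).2.1 _ (left_mem_Icc.2 hτ)])
  set b : S → ℝ → Q := fun s t => op g • c s t with hb
  have hbl : ∀ s, A.LiftOn (Γ s) (b s) τ₁ τ₂ := fun s => (hc s).smul hπ g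
  have hbs : ContMDiffAt J IQ ∞ (fun s => b s τ₁) s₀ := (hπ.contMDiff_smul g).contMDiffAt.comp s₀ hcs
  have hb0 : b s₀ τ₁ = σ (Γ s₀ τ₁) := hg.symm
  suffices hgoal : ContMDiffAt J IQ ∞ (fun s => b s τ₂) s₀ by
    have h1 := (hπ.contMDiff_smul g⁻¹).contMDiffAt.comp s₀ hgoal
    refine h1.congr_of_eventuallyEq (Filter.Eventually.of_forall fun s => ?_)
    simp [hb, smul_smul]
  set l := τ₂ - τ₁ with hl
  have hl0 : 0 < l := sub_pos.2 hlt
  have hlε : |l| < ε₁ := by rw [abs_of_pos hl0]; linarith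
  set z : S → (ES × ℝ) × EQ := fun s => ((κ s, τ₁), φ (b s τ₁)) with hz
  have hφs : ContMDiffAt IQ 𝓘(ℝ, EQ) ∞ φ (b s₀ τ₁) := by
    rw [hb0]; exact contMDiffAt_extChartAt' hτsrc
  have hzs : ContMDiffAt J 𝓘(ℝ, (ES × ℝ) × EQ) ∞ z s₀ :=
    ((contMDiffAt_extChartAt (I := J) (n := ∞) (x := s₀)).prodMk_space contMDiffAt_const).prodMk_space
      (hφs.comp s₀ hbs)
  have hzd : dist (z s₀) z₀ < ε₁ := by rw [hz]; dsimp only; rw [hb0]; exact hτd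
  have hevs : ∀ᶠ s in 𝓝 s₀, s ∈ κ.source ∧ b s τ₁ ∈ φ.source ∧ dist (z s) z₀ < ε₁ :=
    ((isOpen_extChartAt_source (I := J) s₀).mem_nhds (mem_extChartAt_source s₀) |>
      Filter.eventually_mem_set.2).and ((hbs.continuousAt.eventually
        ((isOpen_extChartAt_source (I := IQ) q₀).mem_nhds (by
          dsimp only; rw [hb0, extChartAt_source]; exact hτsrc))).and
      (hzs.continuousAt.eventually (p := fun z => dist z z₀ < ε₁)
        (Metric.isOpen_ball.mem_nhds hzd)))
  have hend : ∀ s, s ∈ κ.source → b s τ₁ ∈ φ.source → dist (z s) z₀ < ε₁ →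
      (Ψ l (z s) 1).2 ∈ φ.target ∧ b s τ₂ = φ.symm (Ψ l (z s) 1).2 := by
    intro s hsκ hsφ hsd
    obtain ⟨hΨ0, hΨt⟩ := hΨ l (z s) hlε hsd
    set Z := Ψ l (z s) with hZ
    have hZmem : ∀ t ∈ Icc (0 : ℝ) 1, Z t ∈ O₁ ×ˢ W := fun t ht => (hΨt t ht).1.2
    obtain ⟨hZ1, hZ2⟩ := components_of_solution (V := V) (l := l) (Z := Z) (fun t ht => by
      have h1 := (hΨt t ht).2
      have h2 : f (Z t) = _ := (hΨt t ht).1.1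
      rwa [h2] at h1)
    have hZ1' : ∀ t ∈ Icc (0 : ℝ) 1, (Z t).1 = (κ s, τ₁ + l * t) := fun t ht => by
      rw [hZ1 t ht, hΨ0]
    set T : ℝ → ℝ := fun τ => (τ - τ₁) / l with hT
    have hTm : MapsTo T (Icc τ₁ τ₂) (Icc 0 1) := fun τ hτ =>
      ⟨div_nonneg (sub_nonneg.2 hτ.1) hl0.le, (div_le_one hl0).2 (by linarith [hτ.2])⟩
    have hTl : ∀ τ, τ₁ + l * T τ = τ := fun τ => by rw [hT]; field_simp; ring
    have hO : ∀ τ ∈ Icc τ₁ τ₂, (κ s, τ) ∈ O₁ := fun τ hτ => by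
      have h1 := (hZmem _ (hTm hτ)).1
      rwa [hZ1' _ (hTm hτ), hTl] at h1
    have hκs : κ.symm (κ s) = s := κ.left_inv hsκ
    have hγ : ContMDiffOn 𝓘(ℝ, ℝ) I ∞ (Γ s) (Icc τ₁ τ₂) :=
      hΓ.comp (contMDiff_const.prodMk contMDiff_id).contMDiffOn fun τ hτ => ⟨trivial, (hO τ hτ).1.2⟩
    have hchart : MapsTo (Γ s) (Icc τ₁ τ₂) (chartAt H (π q₀)).source := fun τ hτ => by
      have h1 := (hO τ hτ).2
      rwa [mem_preimage, hκs] at h1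
    have hud := uniqueDiffOn_Icc hlt
    have hxd : ∀ τ ∈ Icc τ₁ τ₂, derivWithin (ψ ∘ Γ s) (Icc τ₁ τ₂) τ = fderiv ℝ x (κ s, τ) (0, 1) := by
      intro τ hτ
      have h1 : HasFDerivAt x (fderiv ℝ x (κ s, τ)) (κ s, τ) :=
        ((hxs.contDiffAt (hO₁o.mem_nhds (hO τ hτ))).differentiableAt (by simp)).hasFDerivAt
      have h2 : HasDerivAt (fun τ : ℝ => (κ s, τ)) ((0 : ES), (1 : ℝ)) τ :=
        (hasDerivAt_const τ (κ s)).prodMk (hasDerivAt_id τ)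
      have h3 := h1.comp_hasDerivAt τ h2
      have h4 : x ∘ (fun τ : ℝ => (κ s, τ)) = ψ ∘ Γ s := by
        funext τ; simp only [hx, Function.comp, hκs]
      rw [h4] at h3
      exact h3.hasDerivWithinAt.derivWithin (hud τ hτ)
    obtain ⟨hH, hcov⟩ := horizOn_of_solution (y := fun τ => (Z (T τ)).2) hπ hL hlt hγ hchart
      (fun τ hτ => (hZmem _ (hTm hτ)).2) (fun τ hτ => by
        have h1 : HasDerivWithinAt T (1 / l) (Icc τ₁ τ₂) τ :=
          (((hasDerivAt_id τ).sub_const τ₁).div_const l).hasDerivWithinAt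
        have h2 := (hZ2 _ (hTm hτ)).scomp τ h1 hTm
        rw [smul_smul, one_div_mul_cancel hl0.ne', one_smul] at h2
        refine h2.congr_deriv ?_
        rw [hxd τ hτ, hV]
        dsimp only
        rw [hZ1' _ (hTm hτ), hTl]) (left_mem_Icc.2 hτ) (by
        have h1 : T τ₁ = 0 := by simp [hT]
        rw [h1, hΨ0, hz]
        dsimp only
        rw [projInCharts, φ.left_inv hsφ, (hbl s).2.1 _ (left_mem_Icc.2 hτ)])
    have hlift : A.LiftOn (Γ s) (fun τ => φ.symm (Z (T τ)).2) τ₁ τ₂ := LiftOn.of_horizOn hH hcov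
    have heq := (hbl s).eqOn hπ hlift (left_mem_Icc.2 hτ) (by
      have h1 : T τ₁ = 0 := by simp [hT]
      rw [h1, hΨ0]
      exact (φ.left_inv hsφ).symm)
    have h1 : T τ₂ = 1 := by simp only [hT]; exact div_self hl0.ne'
    refine ⟨hL.subset (hZmem 1 (right_mem_Icc.2 zero_le_one)).2, ?_⟩
    rw [heq (right_mem_Icc.2 hτ)]
    dsimp only
    rw [h1]
  have hsm : ContMDiffAt J 𝓘(ℝ, EQ) ∞ (fun s => (Ψ l (z s) 1).2) s₀ :=
    contDiff_snd.contMDiff.contMDiffAt.comp s₀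
      ((hΨs l (z s₀) hlε hzd).contMDiffAt.comp s₀ hzs)
  have htgt : (Ψ l (z s₀) 1).2 ∈ φ.target := by
    obtain ⟨h1, h2, h3⟩ := hevs.self_of_nhds
    exact (hend s₀ h1 h2 h3).1
  have hsymm : ContMDiffAt 𝓘(ℝ, EQ) IQ ∞ φ.symm (Ψ l (z s₀) 1).2 :=
    (contMDiffOn_extChartAt_symm (I := IQ) (n := ∞) q₀).contMDiffAt
      ((isOpen_extChartAt_target q₀).mem_nhds htgt)
  refine (hsymm.comp s₀ hsm).congr_of_eventuallyEq ?_
  filter_upwards [hevs] with s hs using (hend s hs.1 hs.2.1 hs.2.2).2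

/-- Horizontal lifts of a smooth family of curves whose initial values depend smoothly on the
parameter have end points which depend smoothly on the parameter. Near a point `t`, the family is
reparametrized by `τ ↦ t ± τ²`: this turns one-sided smoothness at `t` into smoothness on an open
interval around `0`. -/
theorem contMDiffAt_liftOn_right (hπ : IsPrincipalBundle I IG G IQ π) {Γ : S → ℝ → M} {u v : ℝ}
    (huv : u ≤ v) {T : Finset ℝ}
    (hΓ : ∀ p r, Icc p r ⊆ Icc u v → Disjoint (Ioo p r) (T : Set ℝ) →
      ContMDiffOn (J.prod 𝓘(ℝ, ℝ)) I ∞ (fun p : S × ℝ => Γ p.1 p.2) (univ ×ˢ Icc p r)) {s₀ : S}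
    {c : S → ℝ → Q} (hc : ∀ s, A.LiftOn (Γ s) (c s) u v)
    (hcs : ContMDiffAt J IQ ∞ (fun s => c s u) s₀) : ContMDiffAt J IQ ∞ (fun s => c s v) s₀ := by
  refine interval_induction (R := fun p r => ∀ c : S → ℝ → Q, (∀ s, A.LiftOn (Γ s) (c s) p r) →
    ContMDiffAt J IQ ∞ (fun s => c s p) s₀ → ContMDiffAt J IQ ∞ (fun s => c s r) s₀)
    huv ?_ ?_ ?_ (fun c _ h => h) c hc hcs
  · intro p r s hp hpr hrs hs h1 h2 c hc hcs
    exact h2 c (fun s => (hc s).mono (Icc_subset_Icc_left hpr))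
      (h1 c (fun s => (hc s).mono (Icc_subset_Icc_right hrs)) hcs)
  · intro t ht
    obtain ⟨δ, hδ, hd⟩ := exists_pos_disjoint_Ioo T t
    set w := min v (t + δ) with hw
    have hlt : t < w := lt_min ht.2 (by linarith)
    have hwδ : w ≤ t + δ := min_le_right _ _
    have hsm := hΓ t w (Icc_subset_Icc ht.1 (min_le_left _ _))
      (hd _ (by rw [abs_of_pos (by linarith)]; linarith)).1
    set ρ := Real.sqrt (w - t) with hρ
    have hρ0 : 0 < ρ := Real.sqrt_pos.2 (by linarith)
    have hρ2 : ρ ^ 2 = w - t := Real.sq_sqrt (by linarith)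
    obtain ⟨ε, hε, hR⟩ := exists_smooth_dependence_near (A := A) (J := J) hπ
      (Γ := fun s τ => Γ s (t + τ ^ 2)) hρ0 (by
        have h1 : ContMDiff (J.prod 𝓘(ℝ, ℝ)) (J.prod 𝓘(ℝ, ℝ)) ∞ (fun p : S × ℝ => (p.1, t + p.2 ^ 2)) :=
          contMDiff_fst.prodMk ((contDiff_const.add (contDiff_id.pow 2)).contMDiff.comp contMDiff_snd)
        refine hsm.comp h1.contMDiffOn fun p hp => ⟨trivial, ?_, ?_⟩
        · dsimp only; nlinarith [sq_nonneg p.2]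
        · have := hp.2.1; have := hp.2.2
          dsimp only; nlinarith) s₀
    refine ⟨(ε / 2) ^ 2, by positivity, fun r htr hr hrv c hc hcs => ?_⟩
    set θ : ℝ → ℝ := fun τ => t + τ ^ 2 with hθ
    set τ₂ := Real.sqrt (r - t) with hτ₂
    have hτ0 : 0 ≤ τ₂ := Real.sqrt_nonneg _
    have hτ2 : τ₂ ^ 2 = r - t := Real.sq_sqrt (by linarith)
    have hτε : τ₂ ≤ ε / 2 := by
      rw [hτ₂, Real.sqrt_le_left (by positivity)]; linarith
    have hθ0 : θ 0 = t := by simp [hθ]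
    have hθ2 : θ τ₂ = r := by simp [hθ, hτ2]
    have hmono : StrictMonoOn θ (Icc 0 τ₂) := fun a ha b hb hab => by
      simp only [hθ]; nlinarith [ha.1, hab]
    have h1 := hR 0 τ₂ (by linarith) hτ0 (by linarith) (fun s => c s ∘ θ) (fun s =>
      (hc s).comp (contDiff_const.add (contDiff_id.pow 2)).contDiffOn hmono fun τ hτ => by
        have h1 := hmono.monotoneOn (left_mem_Icc.2 hτ0) hτ hτ.1
        have h2 := hmono.monotoneOn hτ (right_mem_Icc.2 hτ0) hτ.2
        rw [hθ0] at h1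
        rw [hθ2] at h2
        exact ⟨h1, h2⟩)
      (by simpa only [Function.comp, hθ0] using hcs)
    simpa only [Function.comp, hθ2] using h1
  · intro t ht
    obtain ⟨δ, hδ, hd⟩ := exists_pos_disjoint_Ioo T t
    set w := max u (t - δ) with hw
    have hlt : w < t := max_lt ht.1 (by linarith)
    have hwδ : t - δ ≤ w := le_max_right _ _
    have hsm := hΓ w t (Icc_subset_Icc (le_max_left _ _) ht.2)
      (hd _ (by rw [abs_of_neg (by linarith)]; linarith)).2
    set ρ := Real.sqrt (t - w) with hρ
    have hρ0 : 0 < ρ := Real.sqrt_pos.2 (by linarith)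
    have hρ2 : ρ ^ 2 = t - w := Real.sq_sqrt (by linarith)
    obtain ⟨ε, hε, hR⟩ := exists_smooth_dependence_near (A := A) (J := J) hπ
      (Γ := fun s τ => Γ s (t - τ ^ 2)) hρ0 (by
        have h1 : ContMDiff (J.prod 𝓘(ℝ, ℝ)) (J.prod 𝓘(ℝ, ℝ)) ∞ (fun p : S × ℝ => (p.1, t - p.2 ^ 2)) :=
          contMDiff_fst.prodMk ((contDiff_const.sub (contDiff_id.pow 2)).contMDiff.comp contMDiff_snd)
        refine hsm.comp h1.contMDiffOn fun p hp => ⟨trivial, ?_, ?_⟩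
        · have := hp.2.1; have := hp.2.2
          dsimp only; nlinarith
        · dsimp only; nlinarith [sq_nonneg p.2]) s₀
    refine ⟨(ε / 2) ^ 2, by positivity, fun r hrt hr hru c hc hcs => ?_⟩
    set θ : ℝ → ℝ := fun τ => t - τ ^ 2 with hθ
    set τ₁ := Real.sqrt (t - r) with hτ₁
    have hτ0 : 0 ≤ τ₁ := Real.sqrt_nonneg _
    have hτ2 : τ₁ ^ 2 = t - r := Real.sq_sqrt (by linarith)
    have hτε : τ₁ ≤ ε / 2 := by
      rw [hτ₁, Real.sqrt_le_left (by positivity)]; linarith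
    have hθ0 : θ 0 = t := by simp [hθ]
    have hθ1 : θ (-τ₁) = r := by simp [hθ, hτ2]
    have hle : -τ₁ ≤ 0 := by linarith
    have hmono : StrictMonoOn θ (Icc (-τ₁) 0) := fun a ha b hb hab => by
      simp only [hθ]; nlinarith [hb.2, hab]
    have h1 := hR (-τ₁) 0 (by linarith) hle hε (fun s => c s ∘ θ) (fun s =>
      (hc s).comp (contDiff_const.sub (contDiff_id.pow 2)).contDiffOn hmono fun τ hτ => by
        have h1 := hmono.monotoneOn (left_mem_Icc.2 hle) hτ hτ.1
        have h2 := hmono.monotoneOn hτ (right_mem_Icc.2 hle) hτ.2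
        rw [hθ1] at h1
        rw [hθ0] at h2
        exact ⟨h1, h2⟩)
      (by simpa only [Function.comp, hθ1] using hcs)
    simpa only [Function.comp, hθ0] using h1

end PrincipalConnection

end Dependence

/-! ### The parallel transport of a connection -/

namespace PSPath

variable {E : Type*} [NormedAddCommGroup E] [NormedSpace ℝ E]
  {H : Type*} [TopologicalSpace H] {I : ModelWithCorners ℝ E H}
  {M : Type*} [TopologicalSpace M] [ChartedSpace H M] {a b : ℝ}

theorem ext_toFun {γ γ' : PSPath I M a b} (h : γ.toFun = γ'.toFun) : γ = γ' := by
  cases γ; cases γ'; congr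

theorem extend_of_mem (γ : PSPath I M a b) {t : ℝ} (ht : t ∈ Icc a b) :
    γ.extend t = γ.toFun ⟨t, ht⟩ := IccExtend_of_mem _ _ ht

theorem extend_left (γ : PSPath I M a b) : γ.extend a = γ.source := γ.extend_of_mem _

theorem extend_right (γ : PSPath I M a b) : γ.extend b = γ.target := γ.extend_of_mem _

/-- The path on `[a, b]` given by a function on `ℝ`. -/
def ofFun (c : ℝ → M) (hab : a ≤ b) (hc : ContinuousOn c (Icc a b))
    (h : ∃ T : Finset ℝ, ∀ u v : ℝ, Icc u v ⊆ Icc a b → Disjoint (Ioo u v) (T : Set ℝ) →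
      ContMDiffOn 𝓘(ℝ, ℝ) I ∞ c (Icc u v)) : PSPath I M a b where
  toFun t := c t
  le := hab
  continuous_toFun := hc.comp_continuous continuous_subtype_val fun t => t.2
  piecewise_smooth := by
    obtain ⟨T, hT⟩ := h
    exact ⟨T, fun u v huv hd => (hT u v huv hd).congr fun t ht => IccExtend_of_mem _ _ (huv ht)⟩

theorem extend_ofFun {c : ℝ → M} {hab : a ≤ b} {hc : ContinuousOn c (Icc a b)}
    {h : ∃ T : Finset ℝ, ∀ u v : ℝ, Icc u v ⊆ Icc a b → Disjoint (Ioo u v) (T : Set ℝ) →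
      ContMDiffOn 𝓘(ℝ, ℝ) I ∞ c (Icc u v)} {t : ℝ} (ht : t ∈ Icc a b) :
    (ofFun c hab hc h).extend t = c t := extend_of_mem _ ht

theorem extend_restrict (γ : PSPath I M a b) {c d : ℝ} (hcd : c ≤ d) (h : Icc c d ⊆ Icc a b)
    {t : ℝ} (ht : t ∈ Icc c d) : (γ.restrict hcd h).extend t = γ.extend t := by
  rw [extend_of_mem _ ht, extend_of_mem _ (h ht)]
  rfl

end PSPath

section Transport

variable {E : Type*} [NormedAddCommGroup E] [NormedSpace ℝ E]
  {H : Type*} [TopologicalSpace H] {I : ModelWithCorners ℝ E H}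
  {M : Type*} [TopologicalSpace M] [ChartedSpace H M] [IsManifold I ∞ M]
  {EG : Type*} [NormedAddCommGroup EG] [NormedSpace ℝ EG]
  {HG : Type*} [TopologicalSpace HG] {IG : ModelWithCorners ℝ EG HG}
  {G : Type*} [Group G] [TopologicalSpace G] [ChartedSpace HG G]
  {EQ : Type*} [NormedAddCommGroup EQ] [NormedSpace ℝ EQ]
  {HQ : Type*} [TopologicalSpace HQ] {IQ : ModelWithCorners ℝ EQ HQ}
  {Q : Type*} [TopologicalSpace Q] [ChartedSpace HQ Q] [IsManifold IQ ∞ Q] [MulAction Gᵐᵒᵖ Q]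
  {π : Q → M}

namespace PrincipalConnection

variable [FiniteDimensional ℝ E] [IQ.Boundaryless]
  {A : PrincipalConnection I G IQ π} {a b : ℝ}

/-- As velocities are horizontal at the end points of smooth pieces as well, the velocity of a lift
is horizontal wherever it exists, also at break points. -/
theorem isHorizontalLift_iff (hπ : IsPrincipalBundle I IG G IQ π) {γ : PSPath I M a b}
    {γ' : PSPath IQ Q a b} : A.IsHorizontalLift γ γ' ↔ A.LiftOn γ.extend γ'.extend a b := by
  constructor
  · rintro ⟨h1, h2⟩
    obtain ⟨T, hT⟩ := γ'.piecewise_smooth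
    refine ⟨γ'.continuous_extend.continuousOn, fun t ht => ?_, T, fun p r hs hd => ?_⟩
    · rw [γ.extend_of_mem ht, γ'.extend_of_mem ht, h1]
    · rcases le_or_gt r p with hrp | hpr
      · exact horizOn_of_le A _ hrp
      have hsm : ContMDiffOn 𝓘(ℝ, ℝ) IQ ∞ γ'.extend (Icc p r) := hT p r hs hd
      refine ⟨hsm, fun t ht => h2 t ?_ ?_⟩
      · exact ⟨(hs (left_mem_Icc.2 hpr.le)).1.trans_lt ht.1,
          ht.2.trans_le (hs (right_mem_Icc.2 hpr.le)).2⟩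
      · exact ((hsm t (Ioo_subset_Icc_self ht)).contMDiffAt
          (Icc_mem_nhds ht.1 ht.2)).mdifferentiableAt (by simp)
  · rintro ⟨h1, h2, T, hT⟩
    refine ⟨fun t => ?_, fun t ht hd => ?_⟩
    · have := h2 t t.2
      rwa [γ.extend_of_mem t.2, γ'.extend_of_mem t.2] at this
    · -- at a break point, the velocity is the one-sided derivative along the next smooth piece
      obtain ⟨δ, hδ, hδT⟩ := exists_pos_disjoint_Ioo T t
      have hlt : t < min b (t + δ) := lt_min ht.2 (by linarith)
      have hle : min b (t + δ) ≤ t + δ := min_le_right _ _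
      have h3 := (hT t (min b (t + δ)) (Icc_subset_Icc ht.1.le (min_le_left _ _))
        (hδT _ (by rw [abs_of_pos (by linarith)]; linarith)).1).mfderivWithin_mem hπ hlt
          (left_mem_Icc.2 hlt.le)
      rwa [mfderivWithin_eq_mfderiv ((uniqueDiffOn_Icc hlt).uniqueMDiffOn _
        (left_mem_Icc.2 hlt.le)) hd] at h3

variable [FiniteDimensional ℝ EQ]

theorem exists_horizontalLift (hπ : IsPrincipalBundle I IG G IQ π) (A : PrincipalConnection I G IQ π)
    (γ : PSPath I M a b) (q : π ⁻¹' {γ.source}) :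
    ∃ γ' : PSPath IQ Q a b, A.IsHorizontalLift γ γ' ∧ γ'.source = q := by
  obtain ⟨T, hT⟩ := γ.piecewise_smooth
  obtain ⟨c, hc, hca⟩ := exists_liftOn (T := T) (γ := γ.extend) hπ A γ.le hT (q := q)
    (by rw [γ.extend_left]; exact q.2)
  have h : ∃ T : Finset ℝ, ∀ u v : ℝ, Icc u v ⊆ Icc a b → Disjoint (Ioo u v) (T : Set ℝ) →
      ContMDiffOn 𝓘(ℝ, ℝ) IQ ∞ c (Icc u v) := by
    obtain ⟨T', hT'⟩ := hc.2.2
    exact ⟨T', fun u v huv hd => (hT' u v huv hd).1⟩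
  refine ⟨PSPath.ofFun c γ.le hc.1 h, (isHorizontalLift_iff hπ).2 (hc.congr (fun t ht =>
    PSPath.extend_ofFun ht) fun t ht => rfl), ?_⟩
  exact hca

/-- The end point of a horizontal lift of `γ` starting at `q`. -/
noncomputable def endPoint (hπ : IsPrincipalBundle I IG G IQ π) (A : PrincipalConnection I G IQ π)
    (γ : PSPath I M a b) (q : π ⁻¹' {γ.source}) : Q :=
  (A.exists_horizontalLift hπ γ q).choose.target

variable [T2Space Q]

theorem existsUnique_horizontalLift (hπ : IsPrincipalBundle I IG G IQ π)
    (A : PrincipalConnection I G IQ π) (γ : PSPath I M a b) (q : π ⁻¹' {γ.source}) :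
    ∃! γ' : PSPath IQ Q a b, A.IsHorizontalLift γ γ' ∧ γ'.source = q := by
  obtain ⟨γ', h, hq⟩ := A.exists_horizontalLift hπ γ q
  refine ⟨γ', ⟨h, hq⟩, fun γ'' ⟨h', hq'⟩ => PSPath.ext_toFun (funext fun t => ?_)⟩
  have := ((isHorizontalLift_iff hπ).1 h').eqOn_of_left hπ ((isHorizontalLift_iff hπ).1 h)
    (by rw [PSPath.extend_left, PSPath.extend_left, hq, hq']) t.2
  rwa [PSPath.extend_of_mem _ t.2, PSPath.extend_of_mem _ t.2] at this

theorem endPoint_eq (hπ : IsPrincipalBundle I IG G IQ π) {γ : PSPath I M a b} {c : ℝ → Q}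
    (hc : A.LiftOn γ.extend c a b) (q : π ⁻¹' {γ.source}) (hq : c a = q) :
    A.endPoint hπ γ q = c b := by
  obtain ⟨h1, h2⟩ := (A.exists_horizontalLift hπ γ q).choose_spec
  have := ((isHorizontalLift_iff hπ).1 h1).eqOn_of_left hπ hc
    (by rw [PSPath.extend_left, h2, hq]) (right_mem_Icc.2 γ.le)
  rwa [PSPath.extend_right] at this

theorem exists_liftOn_endPoint (hπ : IsPrincipalBundle I IG G IQ π) (A : PrincipalConnection I G IQ π)
    (γ : PSPath I M a b) (q : π ⁻¹' {γ.source}) :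
    ∃ c : ℝ → Q, A.LiftOn γ.extend c a b ∧ c a = q ∧ c b = A.endPoint hπ γ q := by
  obtain ⟨h1, h2⟩ := (A.exists_horizontalLift hπ γ q).choose_spec
  exact ⟨_, (isHorizontalLift_iff hπ).1 h1, by rw [PSPath.extend_left, h2],
    by rw [PSPath.extend_right]; rfl⟩

theorem proj_endPoint (hπ : IsPrincipalBundle I IG G IQ π) (A : PrincipalConnection I G IQ π)
    (γ : PSPath I M a b) (q : π ⁻¹' {γ.source}) : π (A.endPoint hπ γ q) = γ.target := by
  obtain ⟨c, hc, -, hb⟩ := A.exists_liftOn_endPoint hπ γ q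
  rw [← hb, hc.2.1 b (right_mem_Icc.2 γ.le), PSPath.extend_right]

theorem endPoint_juxt (hπ : IsPrincipalBundle I IG G IQ π) (A : PrincipalConnection I G IQ π)
    {c : ℝ} (γ₁ : PSPath I M a b) (γ₂ : PSPath I M b c) (h : γ₁.target = γ₂.source)
    (q : π ⁻¹' {γ₁.source}) (q' : π ⁻¹' {(γ₁.juxt γ₂ h).source}) (hq : (q' : Q) = q)
    (h' : π (A.endPoint hπ γ₁ q) = γ₂.source) :
    A.endPoint hπ (γ₁.juxt γ₂ h) q' = A.endPoint hπ γ₂ ⟨A.endPoint hπ γ₁ q, h'⟩ := by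
  obtain ⟨d, hd, hda, hdc⟩ := A.exists_liftOn_endPoint hπ (γ₁.juxt γ₂ h) q'
  have hs1 : Icc a b ⊆ Icc a c := Icc_subset_Icc_right γ₂.le
  have hs2 : Icc b c ⊆ Icc a c := Icc_subset_Icc_left γ₁.le
  have h1 : A.endPoint hπ γ₁ q = d b := by
    refine endPoint_eq hπ ((hd.mono hs1).congr (fun _ _ => rfl) fun t ht => ?_) q (hda.trans hq)
    rw [PSPath.extend_of_mem _ (hs1 ht)]
    exact (PSPath.juxtFun_left _ _ ht.2).symm
  rw [← hdc]
  refine (endPoint_eq hπ ((hd.mono hs2).congr (fun _ _ => rfl) fun t ht => ?_) _ h1.symm).symm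
  rw [PSPath.extend_of_mem _ (hs2 ht)]
  exact (PSPath.juxtFun_right _ _ h ht.1).symm

theorem endPoint_reparam (hπ : IsPrincipalBundle I IG G IQ π) (A : PrincipalConnection I G IQ π)
    {c d : ℝ} (γ : PSPath I M a b) (γ' : PSPath I M c d) (h : γ'.IsReparametrization γ)
    (q : π ⁻¹' {γ.source}) (q' : π ⁻¹' {γ'.source}) (hq : (q' : Q) = q) :
    A.endPoint hπ γ' q' = A.endPoint hπ γ q := by
  obtain ⟨φ, ψ, hφ, hψ, hinv, hφs, -, hmono, hγ⟩ := h
  have ha := left_mem_Icc.2 γ.le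
  have hb := right_mem_Icc.2 γ.le
  have hc := left_mem_Icc.2 γ'.le
  have hd := right_mem_Icc.2 γ'.le
  have hφc : φ c = a := by
    refine le_antisymm ?_ (hφ hc).1
    have := hmono.monotoneOn hc (hψ ha) (hψ ha).1
    rwa [hinv.2 ha] at this
  have hφd : φ d = b := by
    refine le_antisymm (hφ hd).2 ?_
    have := hmono.monotoneOn (hψ hb) hd (hψ hb).2
    rwa [hinv.2 hb] at this
  obtain ⟨e, he, hea, heb⟩ := A.exists_liftOn_endPoint hπ γ q
  rw [← heb, ← hφd]
  exact endPoint_eq hπ ((he.comp hφs hmono hφ).congr (fun _ _ => rfl) hγ) q'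
    (by rw [Function.comp, hφc, hea, hq])

/-- The parallel transport of a connection. -/
noncomputable def transport (hπ : IsPrincipalBundle I IG G IQ π) (A : PrincipalConnection I G IQ π) :
    ParallelTransport I G IQ π where
  map γ q := ⟨A.endPoint hπ γ q, A.proj_endPoint hπ γ q⟩
  equivariant γ q q' g h := by
    obtain ⟨c, hc, ha, hb⟩ := A.exists_liftOn_endPoint hπ γ q
    dsimp only
    rw [← hb]
    exact endPoint_eq hπ (hc.smul hπ g) q' (by rw [ha, h])
  smooth n S _ _ _ _ _ Γ hΓ σ hσ := by
    intro s₀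
    obtain ⟨T, hT⟩ := hΓ
    choose c hc ha hb using fun s => A.exists_liftOn_endPoint hπ (Γ s) (σ s)
    simp only [← hb]
    exact contMDiffAt_liftOn_right hπ (Γ s₀).le hT hc (by simpa only [ha] using hσ s₀)
  map_const γ hγ q := by
    refine (endPoint_eq hπ (c := fun _ => (q : Q)) ⟨continuousOn_const, fun t ht => ?_, ∅,
      fun p r _ _ => ⟨contMDiffOn_const, fun t _ => ?_⟩⟩ q rfl)
    · rw [γ.extend_of_mem ht, hγ]; exact q.2
    · rw [mfderiv_const]; exact Submodule.zero_mem _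
  map_reparam γ γ' h q q' hq := A.endPoint_reparam hπ γ γ' h q q' hq
  map_juxt γ₁ γ₂ h q q' hq := A.endPoint_juxt hπ γ₁ γ₂ h q q' hq _

theorem transport_eq (hπ : IsPrincipalBundle I IG G IQ π) {γ : PSPath I M a b} {c : ℝ → Q}
    (hc : A.LiftOn γ.extend c a b) (q : π ⁻¹' {γ.source}) (hq : c a = q) :
    ((A.transport hπ).map γ q : Q) = c b := endPoint_eq hπ hc q hq

theorem isTransportedBy_transport (hπ : IsPrincipalBundle I IG G IQ π)
    (A : PrincipalConnection I G IQ π) : A.IsTransportedBy (A.transport hπ) := by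
  intro a b γ q
  obtain ⟨h1, h2⟩ := (A.exists_horizontalLift hπ γ q).choose_spec
  exact ⟨_, h1, h2, rfl⟩

end PrincipalConnection

end Transport

/-! ### Velocities of horizontal lifts -/

section Velocity

variable {E : Type*} [NormedAddCommGroup E] [NormedSpace ℝ E]
  {H : Type*} [TopologicalSpace H] {I : ModelWithCorners ℝ E H}
  {M : Type*} [TopologicalSpace M] [ChartedSpace H M]

/-- The path on `[a, b]` given by a smooth curve in `M`. -/
def PSPath.ofContMDiff {c : ℝ → M} (hc : ContMDiff 𝓘(ℝ, ℝ) I ∞ c) {a b : ℝ} (hab : a ≤ b) :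
    PSPath I M a b :=
  PSPath.ofFun c hab hc.continuous.continuousOn ⟨∅, fun _ _ _ _ => hc.contMDiffOn⟩

variable [IsManifold I ∞ M]

/-- The velocity of a curve may be computed in any chart. -/
theorem tangentMapWithin_one_eq_iff {c : ℝ → M} {s : Set ℝ} {t : ℝ} {q q₀ : M}
    (hc : MDifferentiableWithinAt 𝓘(ℝ, ℝ) I c s t) (hs : UniqueDiffWithinAt ℝ s t) (hq : c t = q)
    (hq₀ : q ∈ (chartAt H q₀).source) (v : TangentSpace I q) :
    tangentMapWithin 𝓘(ℝ, ℝ) I c s (⟨t, (1 : ℝ)⟩ : TangentBundle 𝓘(ℝ, ℝ) ℝ) =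
        (⟨q, v⟩ : TangentBundle I M) ↔
      HasDerivWithinAt (extChartAt I q₀ ∘ c) (chartDeriv I q₀ q v) s t := by
  subst hq
  have h1 := hc.hasMFDerivWithinAt.hasDerivWithinAt_extChartAt hq₀
  constructor
  · intro h
    have h2 : mfderivWithin 𝓘(ℝ, ℝ) I c s t (1 : ℝ) = v := by
      have := (Bundle.TotalSpace.mk.injEq _ _ _ _).mp h
      exact eq_of_heq this.2
    rwa [h2] at h1
  · intro h
    have h2 := chartDeriv_injective hq₀ (hs.eq_deriv _ h1 h)
    change (⟨c t, mfderivWithin 𝓘(ℝ, ℝ) I c s t (1 : ℝ)⟩ : TangentBundle I M) = _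
    rw [h2]

/-- Every tangent vector is the velocity of a curve which is smooth on all of `ℝ`. -/
theorem exists_contMDiff_curve [I.Boundaryless] {x x₀ : M} (hx : x ∈ (chartAt H x₀).source) (w : E) :
    ∃ α : ℝ → M, ContMDiff 𝓘(ℝ, ℝ) I ∞ α ∧ α 0 = x ∧ HasDerivAt (extChartAt I x₀ ∘ α) w 0 := by
  set ψ := extChartAt I x₀ with hψ
  have hxs : x ∈ ψ.source := by rwa [hψ, extChartAt_source]
  obtain ⟨r, hr, hsub⟩ := Metric.nhds_basis_ball.mem_iff.1
    ((isOpen_extChartAt_target (I := I) x₀).mem_nhds (ψ.map_source hxs))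
  set ε := r / (‖w‖ + 1) with hε
  have hε0 : 0 < ε := by positivity
  have hmem : ∀ t : ℝ, ψ x + (ε * Real.sin (t / ε)) • w ∈ ψ.target := by
    intro t
    refine hsub ?_
    rw [Metric.mem_ball, dist_eq_norm, add_sub_cancel_left, norm_smul, norm_mul,
      Real.norm_of_nonneg hε0.le]
    calc ε * ‖Real.sin (t / ε)‖ * ‖w‖ ≤ ε * 1 * ‖w‖ := by
          gcongr
          exact Real.abs_sin_le_one _
      _ < r := by
          rw [hε, mul_one, div_mul_eq_mul_div, div_lt_iff₀ (by positivity)]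
          nlinarith [norm_nonneg w]
  have hsm : ContDiff ℝ ∞ (fun t : ℝ => ψ x + (ε * Real.sin (t / ε)) • w) :=
    contDiff_const.add ((contDiff_const.mul
      (Real.contDiff_sin.comp (contDiff_id.div_const ε))).smul contDiff_const)
  refine ⟨fun t => ψ.symm (ψ x + (ε * Real.sin (t / ε)) • w), ?_, ?_, ?_⟩
  · exact contMDiffOn_univ.1 (contMDiffOn_extChartAt_symm_comp hsm.contDiffOn fun t _ => hmem t)
  · simp [ψ.left_inv hxs]
  · have h1 : ψ ∘ (fun t => ψ.symm (ψ x + (ε * Real.sin (t / ε)) • w)) =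
        fun t => ψ x + (ε * Real.sin (t / ε)) • w := funext fun t => ψ.right_inv (hmem t)
    rw [h1]
    have h2 : HasDerivAt (fun t : ℝ => ε * Real.sin (t / ε)) 1 0 := by
      have := (((hasDerivAt_id (0 : ℝ)).div_const ε).sin).const_mul ε
      refine this.congr_deriv ?_
      simp [hε0.ne']
    simpa using (h2.smul_const w).const_add (ψ x)

end Velocity

section Transport

variable {E : Type*} [NormedAddCommGroup E] [NormedSpace ℝ E]
  {H : Type*} [TopologicalSpace H] {I : ModelWithCorners ℝ E H}
  {M : Type*} [TopologicalSpace M] [ChartedSpace H M] [IsManifold I ∞ M]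
  {EG : Type*} [NormedAddCommGroup EG] [NormedSpace ℝ EG]
  {HG : Type*} [TopologicalSpace HG] {IG : ModelWithCorners ℝ EG HG}
  {G : Type*} [Group G] [TopologicalSpace G] [ChartedSpace HG G]
  {EQ : Type*} [NormedAddCommGroup EQ] [NormedSpace ℝ EQ]
  {HQ : Type*} [TopologicalSpace HQ] {IQ : ModelWithCorners ℝ EQ HQ}
  {Q : Type*} [TopologicalSpace Q] [ChartedSpace HQ Q] [IsManifold IQ ∞ Q] [MulAction Gᵐᵒᵖ Q]
  {π : Q → M}

namespace PrincipalConnection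

variable [FiniteDimensional ℝ E] [IQ.Boundaryless] {A : PrincipalConnection I G IQ π} {a b : ℝ}

theorem LiftOn.exists_horizOn_left {γ : ℝ → M} {c : ℝ → Q} (h : A.LiftOn γ c a b) (hab : a < b) :
    ∃ d ∈ Ioc a b, A.HorizOn c a d := by
  obtain ⟨T, hT⟩ := h.2.2
  obtain ⟨δ, hδ, hd⟩ := exists_pos_disjoint_Ioo T a
  have hlt : a < min b (a + δ) := lt_min hab (by linarith)
  have hle : min b (a + δ) ≤ a + δ := min_le_right _ _
  exact ⟨min b (a + δ), ⟨hlt, min_le_left _ _⟩, hT _ _ (Icc_subset_Icc_right (min_le_left _ _))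
    (hd _ (by rw [abs_of_pos (by linarith)]; linarith)).1⟩

theorem LiftOn.mdifferentiableWithinAt_left {γ : ℝ → M} {c : ℝ → Q} (h : A.LiftOn γ c a b)
    (hab : a < b) : MDifferentiableWithinAt 𝓘(ℝ, ℝ) IQ c (Icc a b) a := by
  obtain ⟨d, hd, hH⟩ := h.exists_horizOn_left hab
  exact ((hH.1 a (left_mem_Icc.2 hd.1.le)).mdifferentiableWithinAt (by simp)).mono_of_mem_nhdsWithin
    (Icc_mem_nhdsGE_of_mem ⟨le_rfl, hd.1⟩ |> nhdsWithin_mono _ Icc_subset_Ici_self)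

theorem LiftOn.mfderivWithin_left_mem (hπ : IsPrincipalBundle I IG G IQ π) {γ : ℝ → M} {c : ℝ → Q}
    (h : A.LiftOn γ c a b) (hab : a < b) :
    mfderivWithin 𝓘(ℝ, ℝ) IQ c (Icc a b) a (1 : ℝ) ∈ A.horizontal (c a) := by
  obtain ⟨d, hd, hH⟩ := h.exists_horizOn_left hab
  have h1 := hH.mfderivWithin_mem hπ hd.1 (left_mem_Icc.2 hd.1.le)
  rwa [mfderivWithin_subset (Icc_subset_Icc_right hd.2) ((uniqueDiffOn_Icc hd.1).uniqueMDiffOn _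
    (left_mem_Icc.2 hd.1.le)) (h.mdifferentiableWithinAt_left hab)] at h1

/-- A horizontal vector is the initial velocity of the horizontal lifts of any curve with the
projected velocity. -/
theorem LiftOn.tangentMapWithin_left_eq (hπ : IsPrincipalBundle I IG G IQ π) {γ : ℝ → M}
    {c : ℝ → Q} {q : Q} {v : TangentSpace IQ q} (hv : v ∈ A.horizontal q) (h : A.LiftOn γ c a b)
    (hab : a < b) (hca : c a = q)
    (hγ : HasDerivAt (extChartAt I (π q) ∘ γ)
      (chartDeriv I (π q) (π q) (mfderiv IQ I π q v)) a) :
    tangentMapWithin 𝓘(ℝ, ℝ) IQ c (Icc a b) (⟨a, (1 : ℝ)⟩ : TangentBundle 𝓘(ℝ, ℝ) ℝ) =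
      (⟨q, v⟩ : TangentBundle IQ Q) := by
  obtain ⟨W, L, hL⟩ := A.exists_isLocalForm hπ q
  have hq := mem_chart_source HQ q
  have haI := left_mem_Icc.2 hab.le
  have hud := uniqueDiffOn_Icc hab a haI
  rw [tangentMapWithin_one_eq_iff (h.mdifferentiableWithinAt_left hab) hud hca hq]
  obtain ⟨d, hd, hH⟩ := h.exists_horizOn_left hab
  have h1 := hH.hasDerivWithinAt hπ hd.1 hL (left_mem_Icc.2 hd.1.le) (by rwa [hca])
    (by rw [hca]; exact hL.mem)
  have h2 : derivWithin (extChartAt I (π q) ∘ π ∘ c) (Icc a d) a =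
      chartDeriv I (π q) (π q) (mfderiv IQ I π q v) := by
    refine (hγ.hasDerivWithinAt.congr (fun t ht => ?_) ?_).derivWithin
      (uniqueDiffOn_Icc hd.1 a (left_mem_Icc.2 hd.1.le))
    · exact congrArg (extChartAt I (π q)) (h.2.1 t ⟨ht.1, ht.2.trans hd.2⟩)
    · exact congrArg (extChartAt I (π q)) (h.2.1 a haI)
  have h3 := (hL.mem_iff q hq hL.mem v).1 hv
  rw [h2, hca, ← fderiv_projInCharts_comp hπ.contMDiff_proj hq (mem_chart_source _ _), ← h3] at h1
  exact h1.mono_of_mem_nhdsWithin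
    (Icc_mem_nhdsGE_of_mem ⟨le_rfl, hd.1⟩ |> nhdsWithin_mono _ Icc_subset_Ici_self)

variable [FiniteDimensional ℝ EQ] [T2Space Q]

theorem lift_transport_eqOn (hπ : IsPrincipalBundle I IG G IQ π) {γ : PSPath I M a b} {c : ℝ → Q}
    (hc : A.LiftOn γ.extend c a b) (q : π ⁻¹' {γ.source}) (hq : c a = q) :
    EqOn (IccExtend γ.le ((A.transport hπ).lift γ q)) c (Icc a b) := by
  intro t ht
  rw [IccExtend_of_mem _ _ ht]
  have hs : Icc a t ⊆ Icc a b := Icc_subset_Icc_right ht.2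
  exact transport_eq hπ ((hc.mono hs).congr (fun _ _ => rfl)
    fun s hs' => γ.extend_restrict ht.1 hs hs') _ hq

/-- A connection consists of the initial velocities of its lifted paths, hence is determined by its
parallel transport. -/
theorem liftedVectors_transport [I.Boundaryless] (hπ : IsPrincipalBundle I IG G IQ π)
    (A : PrincipalConnection I G IQ π) (p : Q) :
    (A.transport hπ).liftedVectors p = (A.horizontal p : Set (TangentSpace IQ p)) := by
  ext v
  constructor
  · rintro ⟨b, α, hp, hb, -, -, hv⟩
    obtain ⟨c, hc, hc0, -⟩ := A.exists_liftOn_endPoint hπ α ⟨p, hp⟩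
    have heq := lift_transport_eqOn hπ hc ⟨p, hp⟩ hc0
    have h0 := left_mem_Icc.2 hb.le
    have h1 : tangentMapWithin 𝓘(ℝ, ℝ) IQ c (Icc 0 b) (⟨0, (1 : ℝ)⟩ : TangentBundle 𝓘(ℝ, ℝ) ℝ) =
        (⟨p, v⟩ : TangentBundle IQ Q) := by
      rw [← hv]
      have hm := (hc.mdifferentiableWithinAt_left hb)
      have hud := uniqueDiffOn_Icc hb 0 h0
      have hm' := hm.congr_of_eventuallyEq
        (Filter.eventuallyEq_of_mem self_mem_nhdsWithin heq) (heq h0)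
      refine (tangentMapWithin_one_eq_iff hm hud (heq h0).symm (mem_chart_source HQ _) _).2 ?_
      exact ((tangentMapWithin_one_eq_iff hm' hud rfl (mem_chart_source HQ _) _).1 rfl).congr
        (fun t ht => congrArg _ (heq ht).symm) (congrArg _ (heq h0).symm)
    have h2 := hc.mfderivWithin_left_mem hπ hb
    have key : ∀ x y : TangentBundle IQ Q, x = y → x.2 ∈ A.horizontal x.1 → y.2 ∈ A.horizontal y.1 := by
      rintro x _ rfl h; exact h
    exact key _ _ h1 h2
  · intro hv
    obtain ⟨α, hα, hα0, hd⟩ := exists_contMDiff_curve (I := I) (mem_chart_source H (π p))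
      (chartDeriv I (π p) (π p) (mfderiv IQ I π p v))
    set γ := PSPath.ofContMDiff hα zero_le_one with hγ
    have hγe : EqOn α γ.extend (Icc 0 1) := fun t ht => (PSPath.extend_ofFun ht).symm
    have hp : π p = γ.source := hα0.symm
    obtain ⟨c, hc, hc0, -⟩ := A.exists_liftOn_endPoint hπ γ ⟨p, hp⟩
    have heq := lift_transport_eqOn hπ hc ⟨p, hp⟩ hc0
    have h1 := LiftOn.tangentMapWithin_left_eq hπ hv (hc.congr (fun _ _ => rfl) hγe) zero_lt_one hc0 hd
    have h0 := left_mem_Icc.2 (zero_le_one (α := ℝ))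
    have hud := uniqueDiffOn_Icc (zero_lt_one (α := ℝ)) 0 h0
    have hm := (hc.mdifferentiableWithinAt_left zero_lt_one)
    have hm' := hm.congr_of_eventuallyEq
        (Filter.eventuallyEq_of_mem self_mem_nhdsWithin heq) (heq h0)
    refine ⟨1, γ, hp, zero_lt_one, hα.contMDiffOn.congr fun t ht => (hγe ht).symm, hm', ?_⟩
    refine (tangentMapWithin_one_eq_iff hm' hud ((heq h0).trans hc0) (mem_chart_source HQ _) _).2 ?_
    exact ((tangentMapWithin_one_eq_iff hm hud hc0 (mem_chart_source HQ _) _).1 h1).congr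
      (fun t ht => congrArg _ (heq ht)) (congrArg _ (heq h0))

theorem transport_injective [I.Boundaryless] (hπ : IsPrincipalBundle I IG G IQ π) :
    Function.Injective fun A : PrincipalConnection I G IQ π => A.transport hπ := by
  intro A A' h
  refine PrincipalConnection.ext (funext fun p => SetLike.coe_injective ?_)
  rw [← liftedVectors_transport hπ, ← liftedVectors_transport hπ]
  exact congrArg (fun P => ParallelTransport.liftedVectors P p) h

theorem IsTransportedBy.map_eq (hπ : IsPrincipalBundle I IG G IQ π)
    {P : ParallelTransport I G IQ π} (hP : A.IsTransportedBy P) {γ : PSPath I M a b} {c : ℝ → Q}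
    (hc : A.LiftOn γ.extend c a b) (q : π ⁻¹' {γ.source}) (hq : c a = q) :
    (P.map γ q : Q) = c b := by
  obtain ⟨γ', h1, h2, h3⟩ := hP γ q
  rw [← h3, ← γ'.extend_right]
  exact ((isHorizontalLift_iff hπ).1 h1).eqOn_of_left hπ hc
    (by rw [γ'.extend_left, h2, hq]) (right_mem_Icc.2 γ.le)

section Naturality

variable {E' : Type*} [NormedAddCommGroup E'] [NormedSpace ℝ E'] [FiniteDimensional ℝ E']
  {H' : Type*} [TopologicalSpace H'] {I' : ModelWithCorners ℝ E' H'}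
  {M' : Type*} [TopologicalSpace M'] [ChartedSpace H' M'] [IsManifold I' ∞ M']
  {EQ' : Type*} [NormedAddCommGroup EQ'] [NormedSpace ℝ EQ'] [FiniteDimensional ℝ EQ']
  {HQ' : Type*} [TopologicalSpace HQ'] {IQ' : ModelWithCorners ℝ EQ' HQ'} [IQ'.Boundaryless]
  {Q' : Type*} [TopologicalSpace Q'] [T2Space Q'] [ChartedSpace HQ' Q'] [IsManifold IQ' ∞ Q']
  [MulAction Gᵐᵒᵖ Q'] {π' : Q' → M'} {A' : PrincipalConnection I' G IQ' π'} {F : Q → Q'} {f : M → M'}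

theorem LiftOn.map (hF : ContMDiff IQ IQ' ∞ F) (hFf : ∀ q, π' (F q) = f (π q))
    (hA : ∀ q, ∀ v ∈ A.horizontal q, mfderiv IQ IQ' F q v ∈ A'.horizontal (F q)) {γ : ℝ → M}
    {c : ℝ → Q} (hc : A.LiftOn γ c a b) : A'.LiftOn (f ∘ γ) (F ∘ c) a b := by
  obtain ⟨T, hT⟩ := hc.2.2
  refine ⟨hF.continuous.comp_continuousOn hc.1, fun t ht => ?_, T, fun p r hs hd =>
    ⟨hF.comp_contMDiffOn (hT p r hs hd).1, fun t ht => ?_⟩⟩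
  · rw [Function.comp, hFf, hc.2.1 t ht, Function.comp]
  · have h1 := (hF.mdifferentiable (by simp) (c t)).hasMFDerivAt.comp t
      ((hT p r hs hd).mdifferentiableAt ht).hasMFDerivAt
    rw [h1.mfderiv]
    exact hA _ _ ((hT p r hs hd).2 t ht)

/-- If `F` preserves horizontal vectors, it maps horizontal lifts to horizontal lifts. Conversely, a
horizontal vector is the velocity of a horizontal lift, whose image under `F` is a horizontal lift
if `F` commutes with the transport. -/
theorem map_horizontal_iff [I.Boundaryless] (hπ : IsPrincipalBundle I IG G IQ π)
    (hπ' : IsPrincipalBundle I' IG G IQ' π') {P' : ParallelTransport I' G IQ' π'}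
    (hP' : A'.IsTransportedBy P') (hF : ContMDiff IQ IQ' ∞ F) (hf : ContMDiff I I' ∞ f)
    (hFf : ∀ q, π' (F q) = f (π q)) :
    (∀ q, ∀ v ∈ A.horizontal q, mfderiv IQ IQ' F q v ∈ A'.horizontal (F q)) ↔
      ∀ {a b : ℝ} (γ : PSPath I M a b) (q : π ⁻¹' {γ.source}),
        (P'.map (γ.map f hf) ⟨F q, (hFf q).trans (congrArg f q.2)⟩ : Q') =
          F ((A.transport hπ).map γ q) := by
  have hext : ∀ {a b : ℝ} (γ : PSPath I M a b), EqOn (γ.map f hf).extend (f ∘ γ.extend) (Icc a b) :=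
    fun γ t ht => by rw [PSPath.extend_of_mem _ ht, Function.comp, PSPath.extend_of_mem _ ht]; rfl
  constructor
  · intro hA a b γ q
    obtain ⟨c, hc, hca, -⟩ := A.exists_liftOn_endPoint hπ γ q
    rw [transport_eq hπ hc q hca]
    exact hP'.map_eq hπ' ((hc.map hF hFf hA).congr (fun _ _ => rfl) (hext γ)) _
      (by rw [Function.comp, hca])
  · intro h q v hv
    obtain ⟨α, hα, hα0, hd⟩ := exists_contMDiff_curve (I := I) (mem_chart_source H (π q))
      (chartDeriv I (π q) (π q) (mfderiv IQ I π q v))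
    set γ := PSPath.ofContMDiff hα zero_le_one with hγ
    have hγe : EqOn α γ.extend (Icc 0 1) := fun t ht => (PSPath.extend_ofFun ht).symm
    have hp : π q = γ.source := hα0.symm
    obtain ⟨c, hc, hc0, -⟩ := A.exists_liftOn_endPoint hπ γ ⟨q, hp⟩
    obtain ⟨c', hc', hc'0, -⟩ := A'.exists_liftOn_endPoint hπ' (γ.map f hf)
      ⟨F q, (hFf q).trans (congrArg f hp)⟩
    have h1 := LiftOn.tangentMapWithin_left_eq hπ hv (hc.congr (fun _ _ => rfl) hγe) zero_lt_one hc0 hd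
    -- the image of the lift of `α` is the lift of `f ∘ α`
    have hFc : EqOn (F ∘ c) c' (Icc 0 1) := by
      intro t ht
      have hs : Icc 0 t ⊆ Icc (0 : ℝ) 1 := Icc_subset_Icc_right ht.2
      have h2 := h (γ.initial ⟨t, ht⟩) ⟨q, hp⟩
      rw [transport_eq hπ (γ := γ.initial ⟨t, ht⟩) ((hc.mono hs).congr (fun _ _ => rfl) fun s hs' =>
        γ.extend_restrict ht.1 hs hs') ⟨q, hp⟩ hc0] at h2
      rw [Function.comp, ← h2]
      refine hP'.map_eq hπ' ((hc'.mono hs).congr (fun _ _ => rfl) fun s hs' => ?_) _ hc'0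
      rw [hext _ hs', hext _ (hs hs'), Function.comp, Function.comp]
      exact congrArg f (γ.extend_restrict ht.1 hs hs')
    have h0 := left_mem_Icc.2 (zero_le_one (α := ℝ))
    have hud := (uniqueDiffOn_Icc (zero_lt_one (α := ℝ))).uniqueMDiffOn 0 h0
    have h3 := (hc'.congr hFc fun _ _ => rfl).mfderivWithin_left_mem hπ' zero_lt_one
    have h4 := ((hF.mdifferentiable (by simp) (c 0)).hasMFDerivAt.comp_hasMFDerivWithinAt 0
      (hc.mdifferentiableWithinAt_left zero_lt_one).hasMFDerivWithinAt).mfderivWithin hud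
    rw [h4] at h3
    have key : ∀ x y : TangentBundle IQ Q, x = y →
        mfderiv IQ IQ' F x.1 x.2 ∈ A'.horizontal (F x.1) →
        mfderiv IQ IQ' F y.1 y.2 ∈ A'.horizontal (F y.1) := by
      rintro x _ rfl h; exact h
    exact key _ _ h1 h3

end Naturality

end PrincipalConnection

end Transport

/-! ### Parallel transport along curves -/

section IsPSPath

variable {E : Type*} [NormedAddCommGroup E] [NormedSpace ℝ E]
  {H : Type*} [TopologicalSpace H] {I : ModelWithCorners ℝ E H}
  {M : Type*} [TopologicalSpace M] [ChartedSpace H M]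

variable (I) in
/-- The function `c` is a piecewise smooth path on `[a, b]`. -/
structure IsPSPath (c : ℝ → M) (a b : ℝ) : Prop where
  le : a ≤ b
  continuousOn : ContinuousOn c (Icc a b)
  piecewise_smooth : ∃ T : Finset ℝ, ∀ u v : ℝ, Icc u v ⊆ Icc a b → Disjoint (Ioo u v) (T : Set ℝ) →
    ContMDiffOn 𝓘(ℝ, ℝ) I ∞ c (Icc u v)

variable {c c' : ℝ → M} {a b : ℝ}

/-- The path on `[a, b]` with underlying function `c`. -/
def IsPSPath.toPSPath (h : IsPSPath I c a b) : PSPath I M a b :=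
  PSPath.ofFun c h.le h.continuousOn h.piecewise_smooth

theorem IsPSPath.extend_toPSPath (h : IsPSPath I c a b) {t : ℝ} (ht : t ∈ Icc a b) :
    h.toPSPath.extend t = c t := PSPath.extend_ofFun ht

theorem IsPSPath.mono (h : IsPSPath I c a b) {u v : ℝ} (huv : u ≤ v) (hs : Icc u v ⊆ Icc a b) :
    IsPSPath I c u v :=
  ⟨huv, h.continuousOn.mono hs, h.piecewise_smooth.imp fun _ hT p r hpr => hT p r (hpr.trans hs)⟩

theorem ContMDiffOn.isPSPath (h : ContMDiffOn 𝓘(ℝ, ℝ) I ∞ c (Icc a b)) (hab : a ≤ b) :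
    IsPSPath I c a b :=
  ⟨hab, h.continuousOn, ∅, fun _ _ hs _ => h.mono hs⟩

theorem PSPath.isPSPath (γ : PSPath I M a b) : IsPSPath I γ.extend a b :=
  ⟨γ.le, γ.continuous_extend.continuousOn, γ.piecewise_smooth⟩

end IsPSPath

section Along

variable {E : Type*} [NormedAddCommGroup E] [NormedSpace ℝ E]
  {H : Type*} [TopologicalSpace H] {I : ModelWithCorners ℝ E H}
  {M : Type*} [TopologicalSpace M] [ChartedSpace H M] [IsManifold I ∞ M]
  {EG : Type*} [NormedAddCommGroup EG] [NormedSpace ℝ EG]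
  {HG : Type*} [TopologicalSpace HG] {IG : ModelWithCorners ℝ EG HG}
  {G : Type*} [Group G] [TopologicalSpace G] [ChartedSpace HG G]
  {EQ : Type*} [NormedAddCommGroup EQ] [NormedSpace ℝ EQ]
  {HQ : Type*} [TopologicalSpace HQ] {IQ : ModelWithCorners ℝ EQ HQ}
  {Q : Type*} [TopologicalSpace Q] [ChartedSpace HQ Q] [IsManifold IQ ∞ Q] [MulAction Gᵐᵒᵖ Q]
  {π : Q → M}

namespace ParallelTransport

variable (P : ParallelTransport I G IQ π)

open Classical in
/-- The map `P` for the path given by the function `c` on `[a, b]`, as a function on all of `Q`: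
it is the identity on points of `Q` which do not lie over the starting point. -/
noncomputable def along (c : ℝ → M) (a b : ℝ) (q : Q) : Q :=
  if h : IsPSPath I c a b ∧ π q = c a then P.map h.1.toPSPath ⟨q, h.2⟩ else q

variable {P} {c c' : ℝ → M} {a b u v w : ℝ} {q : Q}

theorem along_eq {γ : PSPath I M a b} (h : EqOn γ.extend c (Icc a b)) (q : π ⁻¹' {γ.source}) :
    P.along c a b q = P.map γ q := by
  have h1 : IsPSPath I c a b := ⟨γ.le, γ.isPSPath.continuousOn.congr h.symm,
    γ.piecewise_smooth.imp fun T hT u v hs hd => (hT u v hs hd).congr fun t ht => (h (hs ht)).symm⟩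
  obtain rfl : h1.toPSPath = γ := by
    refine PSPath.ext_toFun (funext fun t => ?_)
    rw [← PSPath.extend_of_mem _ t.2, ← PSPath.extend_of_mem _ t.2, h t.2, h1.extend_toPSPath t.2]
  rw [along, dif_pos ⟨h1, q.2⟩]

theorem along_of_isPSPath (h : IsPSPath I c a b) (hq : π q = c a) :
    P.along c a b q = P.map h.toPSPath ⟨q, hq⟩ := dif_pos ⟨h, hq⟩

theorem along_congr (h : IsPSPath I c a b) (hc : EqOn c c' (Icc a b)) (hq : π q = c a) :
    P.along c a b q = P.along c' a b q := by
  rw [along_of_isPSPath h hq]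
  exact (along_eq (fun t ht => (h.extend_toPSPath ht).trans (hc ht)) ⟨q, hq⟩).symm

theorem proj_along (h : IsPSPath I c a b) (hq : π q = c a) : π (P.along c a b q) = c b := by
  rw [along_of_isPSPath h hq]
  exact (P.map h.toPSPath ⟨q, hq⟩).2

theorem along_smul (hπ : IsPrincipalBundle I IG G IQ π) (h : IsPSPath I c a b) (hq : π q = c a)
    (g : G) : P.along c a b (op g • q) = op g • P.along c a b q := by
  rw [along_of_isPSPath h hq, along_of_isPSPath h ((hπ.proj_act q g).trans hq)]
  exact P.equivariant _ _ _ g rfl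

theorem along_const (hab : a ≤ b) (hc : ∀ t ∈ Icc a b, c t = π q) : P.along c a b q = q := by
  have ha := hc a (left_mem_Icc.2 hab)
  have h : IsPSPath I c a b := (contMDiffOn_const.congr hc).isPSPath hab
  rw [along_of_isPSPath h ha.symm]
  exact P.map_const _ (fun t => (hc t t.2).trans ha.symm) _

theorem along_self : P.along c a a q = q := by
  by_cases h : c a = π q
  · exact along_const le_rfl fun t ht => by rw [le_antisymm ht.2 ht.1, h]
  · exact dif_neg fun h' => h h'.2.symm

theorem along_trans (h : IsPSPath I c u w) (huv : u ≤ v) (hvw : v ≤ w) (hq : π q = c u) :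
    P.along c u w q = P.along c v w (P.along c u v q) := by
  have hs1 : Icc u v ⊆ Icc u w := Icc_subset_Icc_right hvw
  have hs2 : Icc v w ⊆ Icc u w := Icc_subset_Icc_left huv
  have h1 := h.mono huv hs1
  have h2 := h.mono hvw hs2
  have hj : h1.toPSPath.target = h2.toPSPath.source := rfl
  have heq : EqOn (h1.toPSPath.juxt h2.toPSPath hj).extend c (Icc u w) := by
    intro t ht
    rw [PSPath.extend_of_mem _ ht]
    rcases le_total t v with htv | htv
    · exact (PSPath.juxtFun_left _ _ htv).trans (h1.extend_toPSPath ⟨ht.1, htv⟩)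
    · exact (PSPath.juxtFun_right _ _ hj htv).trans (h2.extend_toPSPath ⟨htv, ht.2⟩)
  have hsrc : (h1.toPSPath.juxt h2.toPSPath hj).source = c u := by
    rw [← PSPath.extend_left, heq (left_mem_Icc.2 h.le)]
  rw [along_of_isPSPath h2 (proj_along h1 hq)]
  rw [along_eq heq ⟨q, hq.trans hsrc.symm⟩, P.map_juxt _ _ hj ⟨q, hq⟩ _ rfl]
  congr 2
  exact Subtype.ext (along_of_isPSPath h1 hq).symm

/-- Affine reparametrization by the unit interval. This includes the case `u = v`, in which the
affine map is not invertible. -/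
theorem along_eq_unitInterval (h : IsPSPath I c u v) (hq : π q = c u) :
    P.along c u v q = P.along (fun t => c (u + (v - u) * t)) 0 1 q := by
  rcases h.le.eq_or_lt with rfl | huv
  · rw [along_self, along_const zero_le_one fun t _ => by simp [hq]]
  have hl : 0 < v - u := sub_pos.2 huv
  set φ : ℝ → ℝ := fun t => u + (v - u) * t with hφ
  set ψ : ℝ → ℝ := fun t => (t - u) / (v - u) with hψ
  have hφm : MapsTo φ (Icc 0 1) (Icc u v) := fun t ht =>
    ⟨by simp only [hφ]; nlinarith [ht.1], by simp only [hφ]; nlinarith [ht.2]⟩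
  have hψm : MapsTo ψ (Icc u v) (Icc 0 1) := fun t ht =>
    ⟨div_nonneg (sub_nonneg.2 ht.1) hl.le, (div_le_one hl).2 (by linarith [ht.2])⟩
  have hmono : StrictMono φ := fun s t hst => by simp only [hφ]; nlinarith
  have hφs : ContDiff ℝ ∞ φ := contDiff_const.add (contDiff_const.mul contDiff_id)
  have hinv : InvOn ψ φ (Icc 0 1) (Icc u v) :=
    ⟨fun t _ => by simp only [hφ, hψ]; field_simp; ring,
      fun t _ => by simp only [hφ, hψ]; field_simp; ring⟩
  have h' : IsPSPath I (c ∘ φ) 0 1 := by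
    classical
    obtain ⟨T, hT⟩ := h.piecewise_smooth
    refine ⟨zero_le_one, h.continuousOn.comp hφs.continuous.continuousOn hφm, T.image ψ,
      fun p r hs hd => ?_⟩
    refine (hT (φ p) (φ r) ?_ ?_).comp hφs.contMDiff.contMDiffOn fun t ht =>
      ⟨hmono.monotone ht.1, hmono.monotone ht.2⟩
    · rcases le_or_gt p r with hpr | hpr
      · exact Icc_subset_Icc (hφm (hs (left_mem_Icc.2 hpr))).1 (hφm (hs (right_mem_Icc.2 hpr))).2
      · rw [Icc_eq_empty (not_le.2 (hmono hpr))]; exact empty_subset _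
    · refine Set.disjoint_left.2 fun t ht htT => Set.disjoint_left.1 hd (?_ : ψ t ∈ Ioo p r)
        (by simpa using ⟨t, htT, rfl⟩)
      have h1 : φ (ψ t) = t := by simp only [hφ, hψ]; field_simp; ring
      rw [← h1] at ht
      exact ⟨hmono.lt_iff_lt.1 ht.1, hmono.lt_iff_lt.1 ht.2⟩
  have h0 : π q = (c ∘ φ) 0 := by simp [hφ, hq]
  change _ = P.along (c ∘ φ) 0 1 q
  rw [along_of_isPSPath h hq, along_of_isPSPath h' h0]
  refine (P.map_reparam _ _ ⟨φ, ψ, hφm, hψm, hinv, hφs.contDiffOn, ?_, hmono.strictMonoOn _,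
    fun t ht => ?_⟩ _ _ rfl).symm
  · exact ((contDiff_id.sub contDiff_const).div_const _).contDiffOn
  · rw [h'.extend_toPSPath ht, h.extend_toPSPath (hφm ht)]
    rfl

theorem _root_.ContMDiffOn.curve {V : Type*} [NormedAddCommGroup V] [NormedSpace ℝ V] {U : Set V}
    {s : Set ℝ} {c : V → ℝ → M}
    (hc : ContMDiffOn 𝓘(ℝ, V × ℝ) I ∞ (fun p : V × ℝ => c p.1 p.2) (U ×ˢ s)) {x : V} (hx : x ∈ U) :
    ContMDiffOn 𝓘(ℝ, ℝ) I ∞ (c x) s :=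
  hc.comp (contDiff_const.prodMk contDiff_id).contMDiff.contMDiffOn fun _ ht => ⟨hx, ht⟩

/-- Parallel transport depends smoothly on parameters in an open subset of a finite-dimensional
vector space. -/
theorem contMDiffOn_along {V : Type*} [NormedAddCommGroup V] [NormedSpace ℝ V]
    [FiniteDimensional ℝ V] {U : Set V} (hU : IsOpen U) (hab : a ≤ b) {c : V → ℝ → M}
    (hc : ContMDiffOn 𝓘(ℝ, V × ℝ) I ∞ (fun p : V × ℝ => c p.1 p.2) (U ×ˢ Icc a b)) {σ : V → Q}
    (hσ : ContMDiffOn 𝓘(ℝ, V) IQ ∞ σ U) (hσc : ∀ x ∈ U, π (σ x) = c x a) :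
    ContMDiffOn 𝓘(ℝ, V) IQ ∞ (fun x => P.along (c x) a b (σ x)) U := by
  set n := Module.finrank ℝ V
  let e : V ≃L[ℝ] EuclideanSpace ℝ (Fin n) := toEuclidean
  let S : TopologicalSpace.Opens (EuclideanSpace ℝ (Fin n)) :=
    ⟨e.symm ⁻¹' U, hU.preimage e.symm.continuous⟩
  have hval : ContMDiff (𝓡 n) 𝓘(ℝ, V) ∞ (fun s : S => e.symm s) :=
    e.symm.contDiff.contMDiff.comp contMDiff_subtype_val
  have hpath : ∀ x ∈ U, IsPSPath I (c x) a b := fun x hx =>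
    (hc.curve hx).isPSPath hab
  let Γ : S → PSPath I M a b := fun s => (hpath (e.symm s) s.2).toPSPath
  have hΓ : PSPath.IsSmoothFamily (𝓡 n) Γ := by
    refine ⟨∅, fun u v hs _ => ?_⟩
    have h1 : ContMDiff ((𝓡 n).prod 𝓘(ℝ, ℝ)) 𝓘(ℝ, V × ℝ) ∞
        (fun p : S × ℝ => (e.symm (p.1 : EuclideanSpace ℝ (Fin n)), p.2)) :=
      (hval.comp contMDiff_fst).prodMk_space contMDiff_snd
    refine (hc.comp h1.contMDiffOn fun p hp => ⟨p.1.2, hs hp.2⟩).congr fun p hp => ?_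
    exact (hpath _ p.1.2).extend_toPSPath (hs hp.2)
  have h2 := P.smooth n S Γ hΓ (fun s => ⟨σ (e.symm s), hσc _ s.2⟩) (hσ.comp_contMDiff hval fun s => s.2)
  intro x hx
  have hx' : e x ∈ S := by
    change e.symm (e x) ∈ U
    rwa [e.symm_apply_apply]
  have h3 : ContMDiffAt (𝓡 n) IQ ∞ (fun s : S => P.along (c (e.symm s)) a b (σ (e.symm s))) ⟨e x, hx'⟩ := by
    refine (h2 ⟨e x, hx'⟩).congr_of_eventuallyEq (Filter.Eventually.of_forall fun s => ?_)
    exact along_of_isPSPath (hpath _ s.2) (hσc _ s.2)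
  have h4 : ContMDiffAt (𝓡 n) IQ ∞ (fun z => P.along (c (e.symm z)) a b (σ (e.symm z))) (e x) :=
    (contMDiffAt_subtype_iff (U := S) (x := ⟨e x, hx'⟩)
      (f := fun z => P.along (c (e.symm z)) a b (σ (e.symm z)))).1 h3
  have h5 := h4.comp x e.contDiff.contMDiff.contMDiffAt
  simp only [Function.comp_def, e.symm_apply_apply] at h5
  exact h5.contMDiffWithinAt

end ParallelTransport

end Along

/-! ### Connections from local forms -/

section OfLocalForm

variable {E : Type*} [NormedAddCommGroup E] [NormedSpace ℝ E]
  {H : Type*} [TopologicalSpace H] {I : ModelWithCorners ℝ E H}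
  {M : Type*} [TopologicalSpace M] [ChartedSpace H M] [IsManifold I ∞ M]
  {EG : Type*} [NormedAddCommGroup EG] [NormedSpace ℝ EG]
  {HG : Type*} [TopologicalSpace HG] {IG : ModelWithCorners ℝ EG HG}
  {G : Type*} [Group G] [TopologicalSpace G] [ChartedSpace HG G]
  {EQ : Type*} [NormedAddCommGroup EQ] [NormedSpace ℝ EQ]
  {HQ : Type*} [TopologicalSpace HQ] {IQ : ModelWithCorners ℝ EQ HQ}
  {Q : Type*} [TopologicalSpace Q] [ChartedSpace HQ Q] [IsManifold IQ ∞ Q] [MulAction Gᵐᵒᵖ Q]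
  {π : Q → M}

/-- The lifts `L y e` of the vectors `e` of a basis of the model space form a smooth local frame. -/
theorem IsLocalForm.exists_frame [FiniteDimensional ℝ E] [IQ.Boundaryless]
    {D : ∀ q : Q, Submodule ℝ (TangentSpace IQ q)} {q₀ : Q} {W : Set EQ} {L : EQ → E →L[ℝ] EQ}
    (hL : IsLocalForm I IQ π (fun q => (D q : Set (TangentSpace IQ q))) q₀ W L) :
    ∃ U : Set Q, IsOpen U ∧ q₀ ∈ U ∧ ∃ (k : ℕ) (X : Fin k → ∀ q : Q, TangentSpace IQ q),
      (∀ i, ContMDiffOn IQ IQ.tangent ∞ (fun q => (⟨q, X i q⟩ : TangentBundle IQ Q)) U) ∧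
      ∀ q ∈ U, LinearIndependent ℝ (fun i => X i q) ∧
        Submodule.span ℝ (range fun i => X i q) = D q := by
  have := isManifold_one_of_infty IQ Q
  set U : Set Q := (extChartAt IQ q₀).source ∩ extChartAt IQ q₀ ⁻¹' W with hU
  have hUo : IsOpen U := (continuousOn_extChartAt q₀).isOpen_inter_preimage
    (isOpen_extChartAt_source q₀) hL.isOpen
  have hUs : U ⊆ (chartAt HQ q₀).source := fun q hq => by
    rw [← extChartAt_source IQ q₀]; exact hq.1
  let e := Module.finBasis ℝ E
  have hX : ∀ i, ∀ q : Q, ∃ v : TangentSpace IQ q, q ∈ U → chartDeriv IQ q₀ q v =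
      L (extChartAt IQ q₀ q) (e i) := by
    intro i q
    by_cases hq : q ∈ U
    · obtain ⟨v, hv⟩ := chartDeriv_surjective (I := IQ) (hUs hq) (L (extChartAt IQ q₀ q) (e i))
      exact ⟨v, fun _ => hv⟩
    · exact ⟨0, fun h => absurd h hq⟩
  choose X hX using hX
  refine ⟨U, hUo, ⟨mem_extChartAt_source q₀, hL.mem⟩, Module.finrank ℝ E, X, fun i => ?_,
    fun q hq => ⟨?_, le_antisymm ?_ ?_⟩⟩
  · have hb : (trivializationAt EQ (TangentSpace IQ : Q → Type _) q₀).baseSet =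
        (chartAt HQ q₀).source := TangentBundle.trivializationAt_baseSet q₀
    refine ((trivializationAt EQ (TangentSpace IQ : Q → Type _) q₀).contMDiffOn_section_iff
      (IB := IQ) (n := ∞) (s := X i) hUo (by rw [hb]; exact hUs)).2 ?_
    have h1 : ContMDiffOn IQ 𝓘(ℝ, EQ) ∞ (fun q => L (extChartAt IQ q₀ q) (e i)) U :=
      (hL.contDiffOn.clm_apply contDiffOn_const).contMDiffOn.comp
        ((contMDiffOn_extChartAt (I := IQ) (n := ∞) (x := q₀)).mono hUs) fun q hq => hq.2
    refine h1.congr fun q hq => ?_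
    have h3 : chartDeriv IQ q₀ q = (trivializationAt EQ (TangentSpace IQ) q₀).continuousLinearMapAt ℝ q :=
      (TangentBundle.continuousLinearMapAt_trivializationAt (hUs hq)).symm
    rw [← hX i q hq, h3, Bundle.Trivialization.continuousLinearMapAt_apply,
      Bundle.Trivialization.coe_linearMapAt_of_mem _ (by rw [hb]; exact hUs hq)]
  · refine LinearIndependent.of_comp ((fderiv ℝ (projInCharts I IQ π q₀)
      (extChartAt IQ q₀ q)).toLinearMap ∘ₗ (chartDeriv IQ q₀ q).toLinearMap) ?_
    convert e.linearIndependent using 1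
    funext i
    change fderiv ℝ (projInCharts I IQ π q₀) (extChartAt IQ q₀ q) (chartDeriv IQ q₀ q (X i q)) = e i
    rw [hX i q hq, hL.proj_lift _ hq.2]
  · rw [Submodule.span_le]
    rintro _ ⟨i, rfl⟩
    refine (hL.mem_iff q (hUs hq) hq.2 _).2 ?_
    rw [hX i q hq, hL.proj_lift _ hq.2]
  · intro v hv
    rw [Submodule.mem_span_range_iff_exists_fun]
    have h1 := (hL.mem_iff q (hUs hq) hq.2 v).1 hv
    set w := fderiv ℝ (projInCharts I IQ π q₀) (extChartAt IQ q₀ q) (chartDeriv IQ q₀ q v)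
    refine ⟨fun i => e.repr w i, chartDeriv_injective (hUs hq) ?_⟩
    rw [h1, map_sum]
    conv_rhs => rw [← e.sum_repr w, map_sum]
    refine Finset.sum_congr rfl fun i _ => ?_
    rw [map_smul, map_smul, hX i q hq]

theorem IsLocalForm.isCompl_verticalSpace [IQ.Boundaryless] (hπ : ContMDiff IQ I ∞ π)
    {D : ∀ q : Q, Submodule ℝ (TangentSpace IQ q)} {q₀ : Q} {W : Set EQ} {L : EQ → E →L[ℝ] EQ}
    (hL : IsLocalForm I IQ π (fun q => (D q : Set (TangentSpace IQ q))) q₀ W L) :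
    IsCompl (D q₀) (verticalSpace I IQ π q₀) := by
  have hq := mem_chart_source HQ q₀
  have hx := mem_chart_source H (π q₀)
  have hcomp := fderiv_projInCharts_comp hπ hq hx
  have hmem := hL.mem_iff q₀ hq hL.mem
  refine ⟨Submodule.disjoint_def.2 fun v hv hv' => ?_, codisjoint_iff_le_sup.2 fun v _ => ?_⟩
  · have h1 := (hmem v).1 hv
    have h2 : mfderiv IQ I π q₀ v = 0 := hv'
    rw [hcomp, h2, map_zero, map_zero] at h1
    exact chartDeriv_injective hq (h1.trans (map_zero _).symm)
  · obtain ⟨u, hu⟩ := chartDeriv_surjective (I := IQ) hq (L (extChartAt IQ q₀ q₀)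
      (fderiv ℝ (projInCharts I IQ π q₀) (extChartAt IQ q₀ q₀) (chartDeriv IQ q₀ q₀ v)))
    refine Submodule.mem_sup.2 ⟨u, (hmem u).2 ?_, v - u, ?_, add_sub_cancel _ _⟩
    · rw [hu, hL.proj_lift _ hL.mem]
    · refine chartDeriv_injective (I := I) hx ?_
      change chartDeriv I (π q₀) (π q₀) (mfderiv IQ I π q₀ (v - u)) = chartDeriv I (π q₀) (π q₀) 0
      rw [← hcomp, map_sub, map_sub, hu, hL.proj_lift _ hL.mem, sub_self, map_zero]

/-- An invariant family of sets of tangent vectors with local forms is a connection. -/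
theorem exists_connection_of_isLocalForm [FiniteDimensional ℝ E] [IQ.Boundaryless]
    (hπ : ContMDiff IQ I ∞ π) {D : ∀ q : Q, Set (TangentSpace IQ q)}
    (hD : ∀ q₀, ∃ W L, IsLocalForm I IQ π D q₀ W L)
    (hinv : ∀ (g : G) (q : Q), mfderiv IQ IQ (fun q' : Q => op g • q') q '' D q = D (op g • q)) :
    ∃ A : PrincipalConnection I G IQ π, ∀ q, (A.horizontal q : Set (TangentSpace IQ q)) = D q := by
  have hmem : ∀ q, ∃ B : EQ →L[ℝ] EQ, ∀ v : TangentSpace IQ q, v ∈ D q ↔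
      chartDeriv IQ q q v = B (chartDeriv IQ q q v) := fun q => by
    obtain ⟨W, L, hL⟩ := hD q
    exact ⟨(L (extChartAt IQ q q)).comp (fderiv ℝ (projInCharts I IQ π q) (extChartAt IQ q q)),
      hL.mem_iff q (mem_chart_source HQ q) hL.mem⟩
  choose B hB using hmem
  let S : ∀ q : Q, Submodule ℝ (TangentSpace IQ q) := fun q =>
    { carrier := D q
      add_mem' := fun {u v} hu hv => by
        rw [hB] at hu hv ⊢
        rw [map_add, map_add, ← hu, ← hv]
      zero_mem' := by rw [hB, map_zero, map_zero]
      smul_mem' := fun r v hv => by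
        rw [hB] at hv ⊢
        rw [map_smul, map_smul, ← hv] }
  refine ⟨⟨S, fun q₀ => ?_, fun q => ?_, fun g q => SetLike.coe_injective (hinv g q)⟩, fun q => rfl⟩
  · obtain ⟨W, L, hL⟩ := hD q₀
    exact IsLocalForm.exists_frame (D := S) hL
  · obtain ⟨W, L, hL⟩ := hD q
    exact IsLocalForm.isCompl_verticalSpace (D := S) hπ hL

end OfLocalForm

/-! ### Velocities of lifted curves -/

section LiftCurve

variable {E : Type*} [NormedAddCommGroup E] [NormedSpace ℝ E]
  {H : Type*} [TopologicalSpace H] {I : ModelWithCorners ℝ E H}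
  {M : Type*} [TopologicalSpace M] [ChartedSpace H M] [IsManifold I ∞ M]
  {EG : Type*} [NormedAddCommGroup EG] [NormedSpace ℝ EG]
  {HG : Type*} [TopologicalSpace HG] {IG : ModelWithCorners ℝ EG HG}
  {G : Type*} [Group G] [TopologicalSpace G] [ChartedSpace HG G]
  {EQ : Type*} [NormedAddCommGroup EQ] [NormedSpace ℝ EQ]
  {HQ : Type*} [TopologicalSpace HQ] {IQ : ModelWithCorners ℝ EQ HQ}
  {Q : Type*} [TopologicalSpace Q] [ChartedSpace HQ Q] [IsManifold IQ ∞ Q] [MulAction Gᵐᵒᵖ Q]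
  {π : Q → M}

theorem tangentMap_one_eq_iff {c : ℝ → M} {t : ℝ} {q q₀ : M}
    (hc : MDifferentiableAt 𝓘(ℝ, ℝ) I c t) (hq : c t = q)
    (hq₀ : q ∈ (chartAt H q₀).source) (v : TangentSpace I q) :
    tangentMap 𝓘(ℝ, ℝ) I c (⟨t, (1 : ℝ)⟩ : TangentBundle 𝓘(ℝ, ℝ) ℝ) =
        (⟨q, v⟩ : TangentBundle I M) ↔
      HasDerivAt (extChartAt I q₀ ∘ c) (chartDeriv I q₀ q v) t := by
  rw [← tangentMapWithin_univ, ← hasDerivWithinAt_univ]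
  exact tangentMapWithin_one_eq_iff (mdifferentiableWithinAt_univ.2 hc) uniqueDiffWithinAt_univ hq hq₀ v

namespace ParallelTransport

variable {P : ParallelTransport I G IQ π}

variable (P) in
/-- The curve `s ↦ P(t ∈ [0, 1] ↦ γ (s t))(q)`. It lifts `γ` and, unlike `s ↦ P(γ|[0, s])(q)`, it is
also defined for negative `s`. -/
noncomputable def liftCurve (γ : ℝ → M) (q : Q) (s : ℝ) : Q :=
  P.along (fun t => γ (s * t)) 0 1 q

variable {γ : ℝ → M} {q : Q}

theorem isPSPath_comp_mul (hγ : ContMDiff 𝓘(ℝ, ℝ) I ∞ γ) (s : ℝ) :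
    IsPSPath I (fun t => γ (s * t)) 0 1 :=
  (hγ.comp (contDiff_const.mul contDiff_id).contMDiff).contMDiffOn.isPSPath zero_le_one

theorem liftCurve_zero (hq : γ 0 = π q) : P.liftCurve γ q 0 = q :=
  along_const zero_le_one fun t _ => by rw [zero_mul, hq]

theorem liftCurve_smul (hπ : IsPrincipalBundle I IG G IQ π) (hγ : ContMDiff 𝓘(ℝ, ℝ) I ∞ γ)
    (hq : γ 0 = π q) (g : G) :
    P.liftCurve γ (op g • q) = fun s => op g • P.liftCurve γ q s :=
  funext fun s => along_smul hπ (isPSPath_comp_mul hγ s) (by rw [mul_zero, hq]) g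

theorem contMDiff_liftCurve (hγ : ContMDiff 𝓘(ℝ, ℝ) I ∞ γ) (hq : γ 0 = π q) :
    ContMDiff 𝓘(ℝ, ℝ) IQ ∞ (P.liftCurve γ q) := by
  rw [← contMDiffOn_univ]
  refine contMDiffOn_along (P := P) (c := fun s t => γ (s * t)) (σ := fun _ => q) isOpen_univ
    zero_le_one ?_ contMDiffOn_const fun s _ => by rw [mul_zero, hq]
  exact (hγ.comp (contDiff_fst.mul contDiff_snd).contMDiff).contMDiffOn

/-- The initial velocity of a lifted curve depends on the initial velocity of the curve only, and
may be computed with a straight line in a chart. Writing `γ t = x + t k(t)` in the chart, the family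
of curves `t ↦ x + r t k(s t)` contains `t ↦ γ (s t)` on the diagonal `r = s`, constant curves for
`r = 0` and straight lines for `s = 0`. -/
theorem hasDerivAt_liftCurve [I.Boundaryless] [FiniteDimensional ℝ E]
    (hγ : ContMDiff 𝓘(ℝ, ℝ) I ∞ γ) (hq : γ 0 = π q)
    {x₀ : M} (hx₀ : π q ∈ (chartAt H x₀).source) {q₀ : Q} (hq₀ : q ∈ (chartAt HQ q₀).source)
    {w : E} (hw : HasDerivAt (extChartAt I x₀ ∘ γ) w 0) {z : EQ}
    (hz : HasDerivAt (fun r : ℝ => extChartAt IQ q₀ (P.along (fun t => (extChartAt I x₀).symm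
      (extChartAt I x₀ (π q) + t • r • w)) 0 1 q)) z 0) :
    HasDerivAt (extChartAt IQ q₀ ∘ P.liftCurve γ q) z 0 := by
  have : CompleteSpace E := FiniteDimensional.complete ℝ E
  set ψ := extChartAt I x₀ with hψ
  set φ := extChartAt IQ q₀ with hφ
  have hψq : π q ∈ ψ.source := by rwa [hψ, extChartAt_source]
  have hO : IsOpen (γ ⁻¹' (chartAt H x₀).source) :=
    hγ.continuous.isOpen_preimage _ (chartAt H x₀).open_source
  obtain ⟨X, hX, hXe⟩ := exists_contDiff_eventuallyEq hO
    (contMDiffOn_extChartAt_comp le_rfl hγ.contMDiffOn fun t ht => ht :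
      ContDiffOn ℝ ∞ (ψ ∘ γ) _) (z := 0) (by rw [mem_preimage, hq]; exact hx₀)
  have hX0 : X 0 = ψ (π q) := by rw [hXe.self_of_nhds, Function.comp, hq]
  obtain ⟨k, hk, hXk, hk0⟩ := exists_contDiff_eq_add_smul hX
  have hkw : k 0 = w := by rw [hk0, hXe.deriv_eq, hw.deriv]
  have hev : ∀ᶠ s in 𝓝 (0 : ℝ), X s = ψ (γ s) ∧ γ s ∈ ψ.source :=
    hXe.and (by
      filter_upwards [hO.mem_nhds (show (0 : ℝ) ∈ _ by rw [mem_preimage, hq]; exact hx₀)] with s hs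
      rwa [hψ, extChartAt_source])
  obtain ⟨δ₁, hδ₁, hball⟩ := Metric.eventually_nhds_iff.1 hev
  obtain ⟨r, hr, hsub⟩ := Metric.nhds_basis_ball.mem_iff.1
    ((isOpen_extChartAt_target (I := I) x₀).mem_nhds (ψ.map_source hψq))
  obtain ⟨C, hC⟩ := (isCompact_Icc (a := (-1 : ℝ)) (b := 1)).exists_bound_of_continuousOn
    hk.continuous.continuousOn
  have hC0 : 0 ≤ C := (norm_nonneg _).trans (hC 0 (by constructor <;> norm_num))
  set δ := min 1 (r / (C + 1)) with hδ
  have hδ0 : 0 < δ := lt_min one_pos (by positivity)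
  -- the two-parameter family
  set c : ℝ × ℝ → ℝ → M := fun p t => ψ.symm (ψ (π q) + (p.2 * t) • k (p.1 * t)) with hc
  set N : Set (ℝ × ℝ) := Ioo (-δ) δ ×ˢ Ioo (-δ) δ with hN
  have hNo : IsOpen N := isOpen_Ioo.prod isOpen_Ioo
  have h0N : ((0 : ℝ), (0 : ℝ)) ∈ N := ⟨⟨by linarith, hδ0⟩, ⟨by linarith, hδ0⟩⟩
  have htarget : ∀ p ∈ N, ∀ t ∈ Icc (0 : ℝ) 1, ψ (π q) + (p.2 * t) • k (p.1 * t) ∈ ψ.target := by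
    intro p hp t ht
    refine hsub ?_
    rw [Metric.mem_ball, dist_eq_norm, add_sub_cancel_left, norm_smul]
    have h1 : |p.1| ≤ 1 := (abs_lt.2 ⟨hp.1.1, hp.1.2⟩).le.trans (min_le_left _ _)
    have h2 : |p.2| < r / (C + 1) := (abs_lt.2 ⟨hp.2.1, hp.2.2⟩).trans_le (min_le_right _ _)
    have h3 : |p.1 * t| ≤ 1 := by
      rw [abs_mul, abs_of_nonneg ht.1]; exact mul_le_one₀ h1 ht.1 ht.2
    have h4 := hC _ ⟨(abs_le.1 h3).1, (abs_le.1 h3).2⟩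
    have h5 : ‖p.2 * t‖ ≤ |p.2| := by
      rw [Real.norm_eq_abs, abs_mul, abs_of_nonneg ht.1]
      exact mul_le_of_le_one_right (abs_nonneg _) ht.2
    calc ‖p.2 * t‖ * ‖k (p.1 * t)‖ ≤ |p.2| * C := by gcongr
      _ ≤ |p.2| * (C + 1) := by gcongr; linarith
      _ < r := (lt_div_iff₀ (by positivity)).1 h2
  have hcs : ContMDiffOn 𝓘(ℝ, (ℝ × ℝ) × ℝ) I ∞ (fun p : (ℝ × ℝ) × ℝ => c p.1 p.2) (N ×ˢ Icc 0 1) := by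
    refine contMDiffOn_extChartAt_symm_comp (x₀ := x₀)
      (y := fun p : (ℝ × ℝ) × ℝ => ψ (π q) + (p.1.2 * p.2) • k (p.1.1 * p.2)) ?_
      fun p hp => htarget p.1 hp.1 p.2 hp.2
    exact ContDiff.contDiffOn (by fun_prop)
  have hms := contMDiffOn_along (P := P) hNo zero_le_one hcs (σ := fun _ => q) contMDiffOn_const
    fun p _ => by simp only [hc, mul_zero, zero_smul, add_zero, ψ.left_inv hψq]
  set m : ℝ × ℝ → EQ := fun p => φ (P.along (c p) 0 1 q) with hm
  have hconst : ∀ s, P.along (c (s, 0)) 0 1 q = q := fun s =>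
    along_const zero_le_one fun t _ => by
      simp only [hc, zero_mul, zero_smul, add_zero, ψ.left_inv hψq]
  have hmd : HasFDerivAt m (fderiv ℝ m (0, 0)) (0, 0) := by
    have h1 : ContMDiffAt 𝓘(ℝ, ℝ × ℝ) 𝓘(ℝ, EQ) ∞ m (0, 0) := by
      refine ContMDiffAt.comp (g := φ) (I' := IQ) _ (contMDiffAt_extChartAt' ?_)
        (hms.contMDiffAt (hNo.mem_nhds h0N))
      rwa [hconst]
    exact (h1.contDiffAt.differentiableAt (by simp)).hasFDerivAt
  set D := fderiv ℝ m (0, 0) with hD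
  have hcomp : ∀ (p : ℝ → ℝ × ℝ) (p' : ℝ × ℝ), HasDerivAt p p' 0 → p 0 = (0, 0) →
      HasDerivAt (fun s => m (p s)) (D p') 0 := fun p p' hp hp0 =>
    hmd.comp_hasDerivAt_of_eq (0 : ℝ) hp hp0.symm
  have hD1 : D (1, 0) = 0 := by
    have h1 : HasDerivAt (fun s : ℝ => (s, (0 : ℝ))) (1, 0) 0 :=
      (hasDerivAt_id _).prodMk (hasDerivAt_const _ _)
    refine (hcomp _ _ h1 rfl).unique ?_
    refine (hasDerivAt_const (0 : ℝ) (φ q)).congr_of_eventuallyEq (Filter.Eventually.of_forall ?_)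
    exact fun s => congrArg φ (hconst s)
  have hD2 : D (0, 1) = z := by
    have h1 : HasDerivAt (fun s : ℝ => ((0 : ℝ), s)) (0, 1) 0 :=
      (hasDerivAt_const _ _).prodMk (hasDerivAt_id _)
    refine (hcomp _ _ h1 rfl).unique (hz.congr_of_eventuallyEq
      (Filter.Eventually.of_forall fun s => ?_))
    have h2 : c (0, s) = fun t => ψ.symm (ψ (π q) + t • s • w) := by
      funext t
      simp only [hc, zero_mul, hkw, smul_smul, mul_comm s]
    simp only [hm, h2]
  have hD3 : HasDerivAt (fun s : ℝ => m (s, s)) (D (1, 1)) 0 :=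
    hcomp (fun s => (s, s)) _ ((hasDerivAt_id _).prodMk (hasDerivAt_id _)) rfl
  have hD4 : D (1, 1) = z := by
    have : ((1 : ℝ), (1 : ℝ)) = (1, 0) + (0, 1) := by simp
    rw [this, map_add, hD1, hD2, zero_add]
  rw [hD4] at hD3
  refine hD3.congr_of_eventuallyEq ?_
  filter_upwards [Metric.ball_mem_nhds (0 : ℝ) hδ₁] with s hs
  refine congrArg φ (along_congr (isPSPath_comp_mul hγ s) (fun t ht => ?_) (by rw [mul_zero, hq]))
  have h1 : dist (s * t) 0 < δ₁ := by
    rw [Metric.mem_ball, Real.dist_eq, sub_zero] at hs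
    rw [Real.dist_eq, sub_zero, abs_mul, abs_of_nonneg ht.1]
    exact (mul_le_of_le_one_right (abs_nonneg _) ht.2).trans_lt hs
  obtain ⟨h2, h3⟩ := hball h1
  simp only [hc]
  rw [← hX0, ← hXk, h2, ψ.left_inv h3]

end ParallelTransport

end LiftCurve

/-! ### The connection of a parallel-transport map -/

section Velocities

variable {E : Type*} [NormedAddCommGroup E] [NormedSpace ℝ E]
  {H : Type*} [TopologicalSpace H] {I : ModelWithCorners ℝ E H}
  {M : Type*} [TopologicalSpace M] [ChartedSpace H M] [IsManifold I ∞ M]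
  {EG : Type*} [NormedAddCommGroup EG] [NormedSpace ℝ EG]
  {HG : Type*} [TopologicalSpace HG] {IG : ModelWithCorners ℝ EG HG}
  {G : Type*} [Group G] [TopologicalSpace G] [ChartedSpace HG G]
  {EQ : Type*} [NormedAddCommGroup EQ] [NormedSpace ℝ EQ]
  {HQ : Type*} [TopologicalSpace HQ] {IQ : ModelWithCorners ℝ EQ HQ}
  {Q : Type*} [TopologicalSpace Q] [ChartedSpace HQ Q] [IsManifold IQ ∞ Q] [MulAction Gᵐᵒᵖ Q]
  {π : Q → M}

namespace ParallelTransport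

variable {P : ParallelTransport I G IQ π}

variable (P) in
/-- The initial velocities of the lifts through `q` of smooth curves in the base. -/
def velocities (q : Q) : Set (TangentSpace IQ q) :=
  {v | ∃ γ : ℝ → M, ContMDiff 𝓘(ℝ, ℝ) I ∞ γ ∧ γ 0 = π q ∧
    tangentMap 𝓘(ℝ, ℝ) IQ (P.liftCurve γ q) (⟨0, (1 : ℝ)⟩ : TangentBundle 𝓘(ℝ, ℝ) ℝ) =
      (⟨q, v⟩ : TangentBundle IQ Q)}

/-- Invariance under the action of `G`. -/
theorem image_velocities (hπ : IsPrincipalBundle I IG G IQ π) (g : G) (q : Q) :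
    mfderiv IQ IQ (fun q' : Q => op g • q') q '' P.velocities q = P.velocities (op g • q) := by
  have hR := hπ.contMDiff_smul g
  -- the lift of a curve through `op g • q` is the translate of the lift through `q`
  have htr : ∀ γ : ℝ → M, ContMDiff 𝓘(ℝ, ℝ) I ∞ γ → γ 0 = π q →
      tangentMap 𝓘(ℝ, ℝ) IQ (P.liftCurve γ (op g • q)) (⟨0, (1 : ℝ)⟩ : TangentBundle 𝓘(ℝ, ℝ) ℝ) =
        tangentMap IQ IQ (fun q' : Q => op g • q') (tangentMap 𝓘(ℝ, ℝ) IQ (P.liftCurve γ q)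
          (⟨0, (1 : ℝ)⟩ : TangentBundle 𝓘(ℝ, ℝ) ℝ)) := by
    intro γ hγ hq
    rw [liftCurve_smul hπ hγ hq g]
    exact tangentMap_comp_at (p := (⟨0, (1 : ℝ)⟩ : TangentBundle 𝓘(ℝ, ℝ) ℝ))
      (hR.mdifferentiable (by simp) _)
      ((contMDiff_liftCurve hγ hq).mdifferentiable (by simp) _)
  apply Subset.antisymm
  · rintro _ ⟨v, ⟨γ, hγ, hq, hv⟩, rfl⟩
    refine ⟨γ, hγ, hq.trans (hπ.proj_act q g).symm, ?_⟩
    rw [htr γ hγ hq, hv]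
    rfl
  · rintro u ⟨γ, hγ, hq, hu⟩
    rw [hπ.proj_act] at hq
    rw [htr γ hγ hq] at hu
    obtain ⟨v, hv⟩ : ∃ v : TangentSpace IQ q, tangentMap 𝓘(ℝ, ℝ) IQ (P.liftCurve γ q)
        (⟨0, (1 : ℝ)⟩ : TangentBundle 𝓘(ℝ, ℝ) ℝ) = (⟨q, v⟩ : TangentBundle IQ Q) := by
      have key : ∀ x : TangentBundle IQ Q, x.1 = q → ∃ v : TangentSpace IQ q, x = ⟨q, v⟩ := by
        rintro ⟨_, v⟩ rfl; exact ⟨v, rfl⟩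
      exact key _ (liftCurve_zero hq)
    refine ⟨v, ⟨γ, hγ, hq, hv⟩, ?_⟩
    rw [hv] at hu
    exact eq_of_heq ((Bundle.TotalSpace.mk.injEq _ _ _ _).mp hu).2

variable [FiniteDimensional ℝ E] [I.Boundaryless] [FiniteDimensional ℝ EQ] [IQ.Boundaryless]

/-- The lift `L y w` is the derivative at `r = 0` of the transport of the point with coordinates `y`
along the line `t ↦ x + t r w` in the chart of the base. -/
theorem exists_isLocalForm_velocities (hπ : IsPrincipalBundle I IG G IQ π)
    (P : ParallelTransport I G IQ π) (q₀ : Q) :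
    ∃ W L, IsLocalForm I IQ π P.velocities q₀ W L := by
  have hpi := hπ.contMDiff_proj
  set ψ := extChartAt I (π q₀) with hψ
  set φ := extChartAt IQ q₀ with hφ
  set p := projInCharts I IQ π q₀ with hp
  obtain ⟨r, hr, hsub⟩ := Metric.nhds_basis_ball.mem_iff.1
    ((isOpen_extChartAt_target (I := I) (π q₀)).mem_nhds (mem_extChartAt_target (π q₀)))
  have hps := contDiffOn_projInCharts (I := I) hpi q₀ univ
  set W₀ := chartDomain (H := H) IQ π q₀ univ with hW₀
  have hW₀o : IsOpen W₀ := isOpen_chartDomain hpi.continuous q₀ isOpen_univ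
  set W := W₀ ∩ p ⁻¹' Metric.ball (ψ (π q₀)) (r / 2) with hW
  have hWo : IsOpen W := hps.continuousOn.isOpen_inter_preimage hW₀o Metric.isOpen_ball
  have hφ0 : φ.symm (φ q₀) = q₀ := extChartAt_to_inv q₀
  have hφW : φ q₀ ∈ W := by
    refine ⟨⟨mem_extChartAt_target q₀, trivial, ?_⟩, ?_⟩
    · rw [mem_preimage, hφ0]; exact mem_chart_source _ _
    · rw [mem_preimage, hp, projInCharts, hφ0]; exact Metric.mem_ball_self (by linarith)
  have hpψ : ∀ y ∈ W, p y = ψ (π (φ.symm y)) := fun y _ => rfl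
  have hsrc : ∀ y ∈ W, π (φ.symm y) ∈ ψ.source := fun y hy => by
    rw [hψ, extChartAt_source]; exact hy.1.2.2
  -- transport along lines in the chart
  let c : EQ × E → ℝ → M := fun z t => ψ.symm (p z.1 + t • z.2)
  set ℓ : EQ × E → Q := fun z => P.along (c z) 0 1 (φ.symm z.1) with hℓ
  set B := Metric.ball (0 : E) (r / 2) with hB
  have hUo : IsOpen (W ×ˢ B) := hWo.prod Metric.isOpen_ball
  have htarget : ∀ z ∈ W ×ˢ B, ∀ t ∈ Icc (0 : ℝ) 1, p z.1 + t • z.2 ∈ ψ.target := by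
    intro z hz t ht
    refine hsub ?_
    have h1 : dist (p z.1) (ψ (π q₀)) < r / 2 := hz.1.2
    have h2 : ‖z.2‖ < r / 2 := mem_ball_zero_iff.1 hz.2
    have h3 : ‖t • z.2‖ ≤ ‖z.2‖ := by
      rw [norm_smul, Real.norm_of_nonneg ht.1]
      exact mul_le_of_le_one_left (norm_nonneg _) ht.2
    rw [Metric.mem_ball]
    calc dist (p z.1 + t • z.2) (ψ (π q₀)) ≤ dist (p z.1 + t • z.2) (p z.1) + dist (p z.1) (ψ (π q₀)) :=
          dist_triangle _ _ _
      _ < r := by rw [dist_eq_norm, add_sub_cancel_left]; linarith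
  have hpath : ContMDiffOn 𝓘(ℝ, (EQ × E) × ℝ) I ∞
      (fun z : (EQ × E) × ℝ => c z.1 z.2) ((W ×ˢ B) ×ˢ Icc 0 1) := by
    refine contMDiffOn_extChartAt_symm_comp (x₀ := π q₀)
      (y := fun z : (EQ × E) × ℝ => p z.1.1 + z.2 • z.1.2) ?_ fun z hz => htarget z.1 hz.1 z.2 hz.2
    refine (hps.comp (contDiff_fst.comp contDiff_fst).contDiffOn fun z hz => hz.1.1.1).add ?_
    exact ContDiff.contDiffOn (by fun_prop)
  have hc0 : ∀ y ∈ W, ∀ w, c (y, w) 0 = π (φ.symm y) := fun y hy w => by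
    simp only [c, zero_smul, add_zero, hpψ _ hy, ψ.left_inv (hsrc _ hy)]
  have hℓs : ContMDiffOn 𝓘(ℝ, EQ × E) IQ ∞ ℓ (W ×ˢ B) := by
    refine contMDiffOn_along (P := P) (V := EQ × E) (c := c)
      (σ := fun z => φ.symm z.1) hUo zero_le_one hpath ?_ fun z hz => ?_
    · exact contMDiffOn_extChartAt_symm_comp (x₀ := q₀) (y := fun z : EQ × E => z.1)
        contDiff_fst.contDiffOn fun z hz => hz.1.1.1
    · exact (hc0 _ hz.1 _).symm
  set O := (W ×ˢ B) ∩ ℓ ⁻¹' (chartAt HQ q₀).source with hO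
  have hOo : IsOpen O := hℓs.continuousOn.isOpen_inter_preimage hUo (chartAt HQ q₀).open_source
  have hℓ0 : ∀ y ∈ W, ℓ (y, 0) = φ.symm y := fun y hy => along_const zero_le_one fun t _ => by
    simp only [c, smul_zero, add_zero, hpψ _ hy, ψ.left_inv (hsrc _ hy)]
  have h0O : ∀ y ∈ W, (y, (0 : E)) ∈ O := fun y hy => by
    refine ⟨⟨hy, Metric.mem_ball_self (by linarith)⟩, ?_⟩
    rw [mem_preimage, hℓ0 y hy, ← extChartAt_source IQ]
    exact φ.map_target hy.1.1
  set μ : EQ × E → EQ := fun z => φ (ℓ z) with hμ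
  have hμs : ContDiffOn ℝ ∞ μ O := by
    rw [← contMDiffOn_iff_contDiffOn]
    exact (contMDiffOn_extChartAt (I := IQ) (n := ∞) (x := q₀)).comp (hℓs.mono inter_subset_left)
      fun z hz => hz.2
  have hμd : ∀ y ∈ W, HasFDerivAt μ (fderiv ℝ μ (y, 0)) (y, 0) := fun y hy =>
    ((hμs.contDiffAt (hOo.mem_nhds (h0O y hy))).differentiableAt (by simp)).hasFDerivAt
  have hμ0 : ∀ y ∈ W, μ (y, 0) = y := fun y hy => by
    simp only [hμ, hℓ0 y hy]; exact φ.right_inv hy.1.1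
  set L : EQ → E →L[ℝ] EQ := fun y => (fderiv ℝ μ (y, 0)).comp (ContinuousLinearMap.inr ℝ EQ E) with hL
  have hLs : ContDiffOn ℝ ∞ L W :=
    (((hμs.fderiv_of_isOpen hOo (m := ∞) (by simp)).comp
      (contDiff_id.prodMk contDiff_const).contDiffOn h0O)).clm_comp contDiffOn_const
  have hLd : ∀ y ∈ W, HasFDerivAt (fun w : E => μ (y, w)) (L y) 0 := fun y hy =>
    (hμd y hy).comp (f := fun w : E => (y, w)) (0 : E) (hasFDerivAt_prodMk_right y (0 : E))
  have hproj : ∀ y ∈ W, ∀ w, fderiv ℝ p y (L y w) = w := by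
    intro y hy w
    have h1 : HasFDerivAt p (fderiv ℝ p y) (μ (y, 0)) := by
      rw [hμ0 y hy]
      exact ((hps.contDiffAt (hW₀o.mem_nhds hy.1)).differentiableAt (by simp)).hasFDerivAt
    have h2 := h1.comp (0 : E) (hLd y hy)
    have h3 : HasFDerivAt (p ∘ fun w : E => μ (y, w)) (ContinuousLinearMap.id ℝ E) 0 := by
      refine ((hasFDerivAt_id (0 : E)).const_add (p y)).congr_of_eventuallyEq ?_
      filter_upwards [(Continuous.prodMk_right y).continuousAt.preimage_mem_nhds
        (hOo.mem_nhds (h0O y hy))] with w hw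
      have hw' : (y, w) ∈ O := hw
      have h4 : φ.symm (μ (y, w)) = ℓ (y, w) := φ.left_inv (by rw [hφ, extChartAt_source]; exact hw'.2)
      have h5 : π (ℓ (y, w)) = c (y, w) 1 :=
        proj_along ((hpath.curve hw'.1).isPSPath zero_le_one) (hc0 y hy w).symm
      change ψ (π (φ.symm (μ (y, w)))) = _
      rw [h4, h5]
      dsimp only [c]
      rw [ψ.right_inv (htarget _ hw'.1 1 (right_mem_Icc.2 zero_le_one)), one_smul]
      rfl
    exact DFunLike.congr_fun (h2.unique h3) w
  -- the velocities of lifted curves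
  have hvel : ∀ q ∈ (chartAt HQ q₀).source, φ q ∈ W → ∀ γ : ℝ → M, ContMDiff 𝓘(ℝ, ℝ) I ∞ γ →
      γ 0 = π q → ∀ w, HasDerivAt (ψ ∘ γ) w 0 →
        HasDerivAt (φ ∘ P.liftCurve γ q) (L (φ q) w) 0 := by
    intro q hq hqW γ hγ hγ0 w hw
    have hqs : φ.symm (φ q) = q := φ.left_inv (by rwa [hφ, extChartAt_source])
    have hπq := hsrc _ hqW
    rw [hqs, hψ, extChartAt_source] at hπq
    refine hasDerivAt_liftCurve hγ hγ0 hπq hq hw ?_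
    have h1 : HasDerivAt (fun r : ℝ => r • w) w 0 := by
      simpa using (hasDerivAt_id (0 : ℝ)).smul_const w
    have h2 := (hLd _ hqW).comp_hasDerivAt_of_eq (0 : ℝ) h1 (by simp)
    refine h2.congr_of_eventuallyEq (Filter.Eventually.of_forall fun r => ?_)
    simp only [hμ, hℓ, c, Function.comp, hpψ _ hqW, hqs]
    rfl
  refine ⟨W, L, hWo, hφW, fun y hy => hy.1.1, fun y hy => hy.1.2.2, hLs, hproj,
    fun q hq hqW v => ⟨?_, fun hv => ?_⟩⟩
  · rintro ⟨γ, hγ, hγ0, hv⟩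
    have hπq := hsrc _ hqW
    rw [φ.left_inv (by rwa [hφ, extChartAt_source]), hψ, extChartAt_source] at hπq
    have h1 := (tangentMap_one_eq_iff ((contMDiff_liftCurve hγ hγ0).mdifferentiable (by simp) 0)
      (liftCurve_zero hγ0) hq v).1 hv
    have h2 : HasDerivAt (ψ ∘ γ) (deriv (ψ ∘ γ) 0) 0 := by
      have h3 : ContMDiffAt 𝓘(ℝ, ℝ) 𝓘(ℝ, E) ∞ (ψ ∘ γ) 0 :=
        ContMDiffAt.comp (g := ψ) (I' := I) _
          (contMDiffAt_extChartAt' (by rwa [hγ0])) hγ.contMDiffAt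
      exact (h3.contDiffAt.differentiableAt (by simp)).hasDerivAt
    have h4 := h1.unique (hvel q hq hqW γ hγ hγ0 _ h2)
    rw [h4, hproj _ hqW]
  · have hπq := hsrc _ hqW
    rw [φ.left_inv (by rwa [hφ, extChartAt_source]), hψ, extChartAt_source] at hπq
    obtain ⟨γ, hγ, hγ0, hd⟩ := exists_contMDiff_curve (I := I) hπq
      (fderiv ℝ p (φ q) (chartDeriv IQ q₀ q v))
    refine ⟨γ, hγ, hγ0, (tangentMap_one_eq_iff
      ((contMDiff_liftCurve hγ hγ0).mdifferentiable (by simp) 0) (liftCurve_zero hγ0) hq v).2 ?_⟩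
    rw [hv]
    exact hvel q hq hqW γ hγ hγ0 _ hd

theorem exists_connection (hπ : IsPrincipalBundle I IG G IQ π) (P : ParallelTransport I G IQ π) :
    ∃ A : PrincipalConnection I G IQ π, ∀ q,
      (A.horizontal q : Set (TangentSpace IQ q)) = P.velocities q :=
  exists_connection_of_isLocalForm hπ.contMDiff_proj (exists_isLocalForm_velocities hπ P)
    (image_velocities hπ)

end ParallelTransport

end Velocities

/-! ### Parallel-transport maps are the transports of their connections -/

/-- A smooth function with values in a small interval which is the identity near `0`. -/
theorem exists_contDiff_eventuallyEq_id {η : ℝ} (hη : 0 < η) :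
    ∃ θ : ℝ → ℝ, ContDiff ℝ ∞ θ ∧ (∀ s, |θ s| < η) ∧ θ =ᶠ[𝓝 0] id := by
  let χ : ContDiffBump (0 : ℝ) := ⟨η / 2, η, by linarith, by linarith⟩
  refine ⟨fun s => χ s * s, χ.contDiff.mul contDiff_id, fun s => ?_, ?_⟩
  · rcases lt_or_ge |s| η with hs | hs
    · rw [abs_mul, abs_of_nonneg χ.nonneg]
      exact (mul_le_of_le_one_left (abs_nonneg _) χ.le_one).trans_lt hs
    · dsimp only
      rw [χ.zero_of_le_dist (by rwa [Real.dist_eq, sub_zero]), zero_mul, abs_zero]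
      exact hη
  · filter_upwards [χ.eventuallyEq_one] with s hs
    rw [hs, Pi.one_apply, one_mul, id]

section Surjectivity

variable {E : Type*} [NormedAddCommGroup E] [NormedSpace ℝ E]
  {H : Type*} [TopologicalSpace H] {I : ModelWithCorners ℝ E H}
  {M : Type*} [TopologicalSpace M] [ChartedSpace H M] [IsManifold I ∞ M]
  {EG : Type*} [NormedAddCommGroup EG] [NormedSpace ℝ EG]
  {HG : Type*} [TopologicalSpace HG] {IG : ModelWithCorners ℝ EG HG}
  {G : Type*} [Group G] [TopologicalSpace G] [ChartedSpace HG G]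
  {EQ : Type*} [NormedAddCommGroup EQ] [NormedSpace ℝ EQ]
  {HQ : Type*} [TopologicalSpace HQ] {IQ : ModelWithCorners ℝ EQ HQ}
  {Q : Type*} [TopologicalSpace Q] [ChartedSpace HQ Q] [IsManifold IQ ∞ Q] [MulAction Gᵐᵒᵖ Q]
  {π : Q → M}

namespace ParallelTransport

variable {P : ParallelTransport I G IQ π} {c : ℝ → M} {u v : ℝ} {q : Q}

/-- Smoothness in the end point of the path: rescaled to the unit interval, the initial pieces of a
smooth path form a smooth family. -/
theorem contMDiffOn_along_right (hc : ContMDiffOn 𝓘(ℝ, ℝ) I ∞ c (Icc u v)) (hq : π q = c u)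
    {h : ℝ → ℝ} {U : Set ℝ} (hU : IsOpen U) (hh : ContDiffOn ℝ ∞ h U) (hmaps : MapsTo h U (Icc u v)) :
    ContMDiffOn 𝓘(ℝ, ℝ) IQ ∞ (fun s => P.along c u (h s) q) U := by
  have h1 : ContDiffOn ℝ ∞ (fun p : ℝ × ℝ => u + (h p.1 - u) * p.2) (U ×ˢ Icc 0 1) :=
    contDiffOn_const.add (((hh.comp contDiffOn_fst fun p hp => hp.1).sub contDiffOn_const).mul
      contDiffOn_snd)
  have h2 := contMDiffOn_along (P := P) hU zero_le_one (c := fun s t => c (u + (h s - u) * t))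
    (σ := fun _ => q) (hc.comp h1.contMDiffOn fun p hp => by
      have h3 := hmaps hp.1
      have h4 := sub_nonneg.2 h3.1
      constructor
      · have := mul_nonneg h4 hp.2.1
        dsimp only; linarith
      · have := mul_le_of_le_one_right h4 hp.2.2
        dsimp only; linarith [h3.2]) contMDiffOn_const fun s _ => by rw [mul_zero, add_zero, hq]
  refine h2.congr fun s hs => ?_
  have h3 := hmaps hs
  exact along_eq_unitInterval ((hc.mono (Icc_subset_Icc_right h3.2)).isPSPath h3.1) hq

/-- The lifted path is continuous up to the end points. The surjection `(1 - cos s) / 2` of `ℝ` onto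
`[0, 1]` gives a smooth family over a parameter space without boundary. -/
theorem continuousOn_along (hc : ContMDiffOn 𝓘(ℝ, ℝ) I ∞ c (Icc u v)) (huv : u < v)
    (hq : π q = c u) : ContinuousOn (fun t => P.along c u t q) (Icc u v) := by
  have hl : 0 < v - u := sub_pos.2 huv
  set h : ℝ → ℝ := fun s => u + (v - u) * ((1 - Real.cos s) / 2) with hh
  set g : ℝ → ℝ := fun t => Real.arccos (1 - 2 * ((t - u) / (v - u))) with hg
  have h1 := contMDiffOn_along_right (P := P) (h := h) hc hq isOpen_univ
    (contDiff_const.add (contDiff_const.mul ((contDiff_const.sub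
      Real.contDiff_cos).div_const 2))).contDiffOn fun s _ => by
        have h2 := Real.cos_le_one s
        have h3 := Real.neg_one_le_cos s
        constructor <;> simp only [hh] <;> nlinarith
  have hgc : Continuous g := Real.continuous_arccos.comp (by fun_prop)
  refine (h1.continuousOn.comp hgc.continuousOn fun t _ => mem_univ _).congr fun t ht => ?_
  have h2 : 0 ≤ (t - u) / (v - u) := div_nonneg (sub_nonneg.2 ht.1) hl.le
  have h3 : (t - u) / (v - u) ≤ 1 := (div_le_one hl).2 (by linarith [ht.2])
  have h4 : h (g t) = t := by
    simp only [hh, hg]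
    rw [Real.cos_arccos (by linarith) (by linarith)]
    field_simp
    ring
  simp only [Function.comp, h4]

variable {A : PrincipalConnection I G IQ π}

/-- Away from the end points, the lifted path is smooth, and its velocity at `t₀` is the right
derivative of a lift through its value at `t₀`. -/
theorem horizOn_along (hA : ∀ q, (A.horizontal q : Set (TangentSpace IQ q)) = P.velocities q)
    (hc : ContMDiffOn 𝓘(ℝ, ℝ) I ∞ c (Icc u v)) (hq : π q = c u) {p r : ℝ}
    (hpr : Icc p r ⊆ Ioo u v) : A.HorizOn (fun t => P.along c u t q) p r := by
  set f : ℝ → Q := fun t => P.along c u t q with hf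
  have hfs : ContMDiffOn 𝓘(ℝ, ℝ) IQ ∞ f (Ioo u v) :=
    contMDiffOn_along_right (h := id) hc hq isOpen_Ioo contDiffOn_id fun t ht => Ioo_subset_Icc_self ht
  refine ⟨hfs.mono hpr, fun t₀ ht₀' => ?_⟩
  have ht₀ := hpr (Ioo_subset_Icc_self ht₀')
  have hpath : ∀ t ∈ Icc u v, IsPSPath I c u t := fun t ht =>
    (hc.mono (Icc_subset_Icc_right ht.2)).isPSPath ht.1
  obtain ⟨η, hη, hball⟩ := Metric.mem_nhds_iff.1 (Ioo_mem_nhds ht₀.1 ht₀.2)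
  obtain ⟨θ, hθ, hθη, hθe⟩ := exists_contDiff_eventuallyEq_id hη
  have hmem : ∀ s, t₀ + θ s ∈ Ioo u v := fun s => hball (by
    rw [Metric.mem_ball, Real.dist_eq, add_sub_cancel_left]; exact hθη s)
  set γ : ℝ → M := fun s => c (t₀ + θ s) with hγ
  have hγs : ContMDiff 𝓘(ℝ, ℝ) I ∞ γ := by
    rw [← contMDiffOn_univ]
    exact hc.comp (contDiff_const.add hθ).contMDiff.contMDiffOn fun s _ => Ioo_subset_Icc_self (hmem s)
  have hθ0 : θ 0 = 0 := hθe.self_of_nhds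
  have hft₀ : π (f t₀) = c t₀ := proj_along (hpath t₀ (Ioo_subset_Icc_self ht₀)) hq
  have hγ0 : γ 0 = π (f t₀) := by simp only [hγ, hθ0, add_zero, hft₀]
  change mfderiv 𝓘(ℝ, ℝ) IQ f t₀ (1 : ℝ) ∈ (A.horizontal (f t₀) : Set (TangentSpace IQ (f t₀)))
  rw [hA]
  refine ⟨γ, hγs, hγ0, ?_⟩
  have hlift := (contMDiff_liftCurve (P := P) hγs hγ0).mdifferentiable (by simp) 0
  have hsrc := mem_chart_source HQ (f t₀)
  rw [tangentMap_one_eq_iff hlift (liftCurve_zero hγ0) hsrc]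
  have hfd : HasDerivAt (extChartAt IQ (f t₀) ∘ f)
      (chartDeriv IQ (f t₀) (f t₀) (mfderiv 𝓘(ℝ, ℝ) IQ f t₀ (1 : ℝ))) t₀ :=
    (tangentMap_one_eq_iff ((hfs.contMDiffAt (isOpen_Ioo.mem_nhds ht₀)).mdifferentiableAt (by simp))
      rfl hsrc _).1 rfl
  have hld : HasDerivAt (extChartAt IQ (f t₀) ∘ P.liftCurve γ (f t₀))
      (deriv (extChartAt IQ (f t₀) ∘ P.liftCurve γ (f t₀)) 0) 0 := by
    have h3 : ContMDiffAt 𝓘(ℝ, ℝ) 𝓘(ℝ, EQ) ∞ (extChartAt IQ (f t₀) ∘ P.liftCurve γ (f t₀)) 0 :=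
      ContMDiffAt.comp (g := extChartAt IQ (f t₀)) (I' := IQ) _
        (contMDiffAt_extChartAt' (by rw [liftCurve_zero hγ0]; exact hsrc))
        (contMDiff_liftCurve hγs hγ0).contMDiffAt
    exact (h3.contDiffAt.differentiableAt (by simp)).hasDerivAt
  -- the two curves agree to the right of `t₀`
  have heq : ∀ᶠ s in 𝓝[≥] (0 : ℝ), f (t₀ + s) = P.liftCurve γ (f t₀) s := by
    obtain ⟨δ, hδ, hδθ⟩ := Metric.eventually_nhds_iff.1 hθe
    filter_upwards [Ico_mem_nhdsGE (lt_min hδ (sub_pos.2 ht₀.2))] with s hs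
    have hs1 : s < δ := hs.2.trans_le (min_le_left _ _)
    have hs2 : t₀ + s < v := by linarith [hs.2.trans_le (min_le_right _ _)]
    have hs3 : u ≤ t₀ + s := by linarith [ht₀.1, hs.1]
    have hle : t₀ ≤ t₀ + s := by linarith [hs.1]
    have h1 : f (t₀ + s) = P.along c t₀ (t₀ + s) (f t₀) :=
      along_trans (hpath _ ⟨hs3, hs2.le⟩) ht₀.1.le hle hq
    have h2 : IsPSPath I c t₀ (t₀ + s) := (hpath _ ⟨hs3, hs2.le⟩).mono hle (Icc_subset_Icc_left ht₀.1.le)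
    rw [h1, along_eq_unitInterval h2 hft₀]
    refine (along_congr (isPSPath_comp_mul hγs s) (fun t ht => ?_) (by rw [mul_zero, hγ0])).symm
    have h3 : θ (s * t) = s * t := hδθ (by
      rw [Real.dist_eq, sub_zero, abs_of_nonneg (mul_nonneg hs.1 ht.1)]
      exact (mul_le_of_le_one_right hs.1 ht.2).trans_lt hs1)
    simp only [hγ, h3, add_sub_cancel_left]
  have h1 : HasDerivAt (fun s => (extChartAt IQ (f t₀) ∘ f) (t₀ + s))
      (chartDeriv IQ (f t₀) (f t₀) (mfderiv 𝓘(ℝ, ℝ) IQ f t₀ (1 : ℝ))) 0 := by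
    refine HasDerivAt.comp_const_add t₀ 0 ?_
    rwa [add_zero]
  have h2 := hld.hasDerivWithinAt (s := Ici 0)
  have h3 := (h1.hasDerivWithinAt (s := Ici 0)).congr_of_eventuallyEq
    (heq.mono fun s hs => (congrArg (extChartAt IQ (f t₀)) hs).symm)
    (congrArg (extChartAt IQ (f t₀)) (by rw [add_zero, liftCurve_zero hγ0]))
  rwa [(uniqueDiffOn_Ici (0 : ℝ) 0 self_mem_Ici).eq_deriv _ h2 h3] at hld

variable [FiniteDimensional ℝ E] [IQ.Boundaryless] [T2Space Q]

/-- Both curves are horizontal on the open interval and continuous on the closed one. Up to a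
translation they agree at an interior point, hence everywhere. -/
theorem along_eq_of_contMDiffOn (hπ : IsPrincipalBundle I IG G IQ π)
    (hA : ∀ q, (A.horizontal q : Set (TangentSpace IQ q)) = P.velocities q)
    (hc : ContMDiffOn 𝓘(ℝ, ℝ) I ∞ c (Icc u v)) (huv : u ≤ v) {d : ℝ → Q} (hd : A.LiftOn c d u v)
    (hdu : d u = q) : P.along c u v q = d v := by
  rcases huv.eq_or_lt with rfl | hlt
  · rw [along_self, hdu]
  have hu := left_mem_Icc.2 huv
  have hv := right_mem_Icc.2 huv
  have hq : π q = c u := by rw [← hdu, hd.2.1 u hu]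
  set f : ℝ → Q := fun t => P.along c u t q with hf
  have hfπ : ∀ t ∈ Icc u v, π (f t) = c t := fun t ht =>
    proj_along ((hc.mono (Icc_subset_Icc_right ht.2)).isPSPath ht.1) hq
  obtain ⟨m, hm⟩ := exists_between hlt
  have hmI : m ∈ Icc u v := Ioo_subset_Icc_self hm
  -- the translate of `d` which meets the lifted path over an interior point
  obtain ⟨g, hg⟩ := hπ.exists_smul_eq ((hd.2.1 m hmI).trans (hfπ m hmI).symm)
  have hd' := hd.smul hπ g
  have h1 : EqOn f (fun t => op g • d t) (Ioo u v) := by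
    intro t ht
    have hs : Icc (min t m) (max t m) ⊆ Ioo u v :=
      fun s hs => ⟨(lt_min ht.1 hm.1).trans_le hs.1, hs.2.trans_lt (max_lt ht.2 hm.2)⟩
    have h2 : A.LiftOn c f (min t m) (max t m) :=
      PrincipalConnection.LiftOn.of_horizOn (horizOn_along hA hc hq hs)
        fun s hs' => hfπ s (Ioo_subset_Icc_self (hs hs'))
    exact h2.eqOn hπ (hd'.mono (hs.trans Ioo_subset_Icc_self)) ⟨min_le_right _ _, le_max_right _ _⟩ hg
      ⟨min_le_left _ _, le_max_left _ _⟩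
  have h2 : EqOn f (fun t => op g • d t) (Icc u v) :=
    h1.of_subset_closure (continuousOn_along hc hlt hq) hd'.1 Ioo_subset_Icc_self
      (by rw [closure_Ioo hlt.ne])
  have h3 := h2 hu
  have h4 : f u = d u := by rw [hdu]; exact along_self
  exact (h2 hv).trans (hd'.eqOn_of_left hπ hd (h3.symm.trans h4) hv)

variable [FiniteDimensional ℝ EQ]

theorem transport_eq_of_velocities (hπ : IsPrincipalBundle I IG G IQ π)
    (hA : ∀ q, (A.horizontal q : Set (TangentSpace IQ q)) = P.velocities q) :
    A.transport hπ = P := by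
  refine ParallelTransport.ext ?_
  funext a b γ q
  refine Subtype.ext ?_
  obtain ⟨d, hd, hda, hdb⟩ := A.exists_liftOn_endPoint hπ γ q
  rw [PrincipalConnection.transport_eq hπ hd q hda,
    ← along_eq (fun t _ => rfl : EqOn γ.extend γ.extend (Icc a b)) q]
  obtain ⟨T, hT⟩ := γ.piecewise_smooth
  refine (interval_induction (R := fun u v => ∀ (q : Q) (d : ℝ → Q), A.LiftOn γ.extend d u v → d u = q →
    P.along γ.extend u v q = d v) γ.le ?_ ?_ ?_ ?_ q d hd hda).symm
  · intro u v w hu huv hvw hw h1 h2 q d hd hdu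
    have hpath : IsPSPath I γ.extend u w := γ.isPSPath.mono (huv.trans hvw) (Icc_subset_Icc hu hw)
    rw [along_trans hpath huv hvw (by rw [← hdu, hd.2.1 u (left_mem_Icc.2 (huv.trans hvw))]),
      h1 q d (hd.mono (Icc_subset_Icc_right hvw)) hdu]
    exact h2 _ d (hd.mono (Icc_subset_Icc_left huv)) rfl
  · intro t ht
    obtain ⟨δ, hδ, hδT⟩ := exists_pos_disjoint_Ioo T t
    refine ⟨δ, hδ, fun v htv hv hvb q d hd hdt => ?_⟩
    exact along_eq_of_contMDiffOn hπ hA (hT t v (Icc_subset_Icc ht.1 hvb)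
      (hδT v (by rw [abs_of_nonneg (by linarith)]; linarith)).1) htv hd hdt
  · intro t ht
    obtain ⟨δ, hδ, hδT⟩ := exists_pos_disjoint_Ioo T t
    refine ⟨δ, hδ, fun u hut hu hau q d hd hdu => ?_⟩
    exact along_eq_of_contMDiffOn hπ hA (hT u t (Icc_subset_Icc hau ht.2)
      (hδT u (by rw [abs_of_nonpos (by linarith)]; linarith)).2) hut hd hdu
  · intro q d _ hd
    rw [along_self, hd]

theorem transport_surjective [I.Boundaryless] (hπ : IsPrincipalBundle I IG G IQ π) :
    Function.Surjective fun A : PrincipalConnection I G IQ π => A.transport hπ := fun P => by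
  obtain ⟨A, hA⟩ := exists_connection hπ P
  exact ⟨A, transport_eq_of_velocities hπ hA⟩

end ParallelTransport

end Surjectivity

/-- Connections on a principal `G`-bundle `π : Q → M` correspond bijectively and naturally to
parallel-transport maps: `Φ A` transports along the (unique) horizontal lifts of paths, `Φ.symm P`
consists of the derivatives at `0` of the lifted paths, and morphisms of principal `G`-bundles
preserve connections if and only if they preserve the corresponding parallel-transport maps. -/
theorem mainTheorem1
    {E : Type*} [NormedAddCommGroup E] [NormedSpace ℝ E] [FiniteDimensional ℝ E]
    {H : Type*} [TopologicalSpace H] (I : ModelWithCorners ℝ E H) [I.Boundaryless]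
    {M : Type*} [TopologicalSpace M] [T2Space M]
    [ChartedSpace H M] [IsManifold I ∞ M]
    {EG : Type*} [NormedAddCommGroup EG] [NormedSpace ℝ EG] [FiniteDimensional ℝ EG]
    {HG : Type*} [TopologicalSpace HG] (IG : ModelWithCorners ℝ EG HG) [IG.Boundaryless]
    {G : Type*} [Group G] [TopologicalSpace G] [T2Space G]
    [ChartedSpace HG G] [LieGroup IG ∞ G]
    {EQ : Type*} [NormedAddCommGroup EQ] [NormedSpace ℝ EQ] [FiniteDimensional ℝ EQ]
    {HQ : Type*} [TopologicalSpace HQ] (IQ : ModelWithCorners ℝ EQ HQ) [IQ.Boundaryless]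
    {Q : Type*} [TopologicalSpace Q] [T2Space Q]
    [ChartedSpace HQ Q] [IsManifold IQ ∞ Q] [MulAction Gᵐᵒᵖ Q]
    (π : Q → M) (hπ : IsPrincipalBundle I IG G IQ π) :
    ∃ Φ : PrincipalConnection I G IQ π ≃ ParallelTransport I G IQ π,
      -- horizontal lifts exist and are unique, and they define the parallel transport of `A`
      (∀ (A : PrincipalConnection I G IQ π) {a b : ℝ} (γ : PSPath I M a b) (q : π ⁻¹' {γ.source}),
        ∃! γ' : PSPath IQ Q a b, A.IsHorizontalLift γ γ' ∧ γ'.source = q) ∧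
      (∀ A : PrincipalConnection I G IQ π, A.IsTransportedBy (Φ A)) ∧
      -- the inverse correspondence
      (∀ (P : ParallelTransport I G IQ π) (p : Q),
        ((Φ.symm P).horizontal p : Set (TangentSpace IQ p)) = P.liftedVectors p) ∧
      -- naturality with respect to morphisms `(F, f)` of principal `G`-bundles
      (∀ {E' : Type*} [NormedAddCommGroup E'] [NormedSpace ℝ E'] [FiniteDimensional ℝ E']
        {H' : Type*} [TopologicalSpace H'] (I' : ModelWithCorners ℝ E' H') [I'.Boundaryless]
        {M' : Type*} [TopologicalSpace M'] [T2Space M']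
        [ChartedSpace H' M'] [IsManifold I' ∞ M']
        {EQ' : Type*} [NormedAddCommGroup EQ'] [NormedSpace ℝ EQ'] [FiniteDimensional ℝ EQ']
        {HQ' : Type*} [TopologicalSpace HQ'] (IQ' : ModelWithCorners ℝ EQ' HQ') [IQ'.Boundaryless]
        {Q' : Type*} [TopologicalSpace Q'] [T2Space Q']
        [ChartedSpace HQ' Q'] [IsManifold IQ' ∞ Q'] [MulAction Gᵐᵒᵖ Q']
        (π' : Q' → M') (_ : IsPrincipalBundle I' IG G IQ' π')
        (A : PrincipalConnection I G IQ π) (A' : PrincipalConnection I' G IQ' π')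
        (P' : ParallelTransport I' G IQ' π') (_ : A'.IsTransportedBy P')
        (F : Q → Q') (f : M → M') (_ : ContMDiff IQ IQ' ∞ F) (hf : ContMDiff I I' ∞ f)
        (_ : ∀ (q : Q) (g : G), F (op g • q) = op g • F q)
        (hFf : ∀ q, π' (F q) = f (π q)),
        (∀ q, ∀ v ∈ A.horizontal q, mfderiv IQ IQ' F q v ∈ A'.horizontal (F q)) ↔
          ∀ {a b : ℝ} (γ : PSPath I M a b) (q : π ⁻¹' {γ.source}),
            (P'.map (γ.map f hf) ⟨F q, (hFf q).trans (congrArg f q.2)⟩ : Q') =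
              F ((Φ A).map γ q)) := by
  let Φ : PrincipalConnection I G IQ π ≃ ParallelTransport I G IQ π :=
    Equiv.ofBijective (fun A => A.transport hπ)
      ⟨PrincipalConnection.transport_injective hπ, ParallelTransport.transport_surjective hπ⟩
  refine ⟨Φ, fun A {a b} γ q => A.existsUnique_horizontalLift hπ γ q,
    fun A => A.isTransportedBy_transport hπ, fun P p => ?_, ?_⟩
  · rw [← PrincipalConnection.liftedVectors_transport hπ (Φ.symm P) p]
    exact congrArg (fun P => ParallelTransport.liftedVectors P p) (Φ.apply_symm_apply P)
  · intro E' _ _ _ H' _ I' _ M' _ _ _ _ EQ' _ _ _ HQ' _ IQ' _ Q' _ _ _ _ _ π' hπ' A A' P' hP' F f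
      hF hf _ hFf
    exact PrincipalConnection.map_horizontal_iff hπ hπ' hP' hF hf hFf
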